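/- Let $M$ be a smooth manifold (Hausdorff, second countable, without boundary) of dimension $n\ge 1$ with a volume form $\mu$ (for instance, an oriented Riemannian manifold with its Riemannian volume form). Let $\Gamma\subset M$ be a closed smooth hypersurface which divides $M$ into two open regions, $M=D^+\sqcup\Gamma\sqcup D^-$, such that near each point of $\Gamma$ there are smooth coordinates in which $D^+,\Gamma,D^-$ are $\{y_0<0\},\{y_0=0\},\{y_0>0\}$; orient $\Gamma$ as $\partial D^+$. A discontinuous tensor field is $\xi=\chi^+\xi^++\chi^-\xi^-$ with $\chi^\pm$ the characteristic functions of $D^\pm$ and $\xi^\pm$ smooth on $D^\pm$ up to $\Gamma$. Write $\mathrm{DC}^\infty(M,\Gamma)$ and $\mathrm D\Omega^1(M,\Gamma)$ for the discontinuous functions and $1$-forms, and $\mathrm{DVect}(M,\Gamma)$ for the compactly supported discontinuous vector fields $v$ for which $v^+-v^-$ is tangent to $\Gamma$ along $\Gamma$ (if $M$ is compact, the support condition is void). The regularized operators $d^{\mathcal R}$, $\mathrm{div}^{\mathcal R}$ (with respect to $\mu$) and $[\cdot,\cdot]^{\mathcal R}$ are $d$, $\mathrm{div}$ and the Lie bracket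 applied on $D^+$ and $D^-$ separately, and $\mathrm{jump}(f)=f^+|_\Gamma-f^-|_\Gamma$. Let $T_\Gamma \mathrm V(M)=\Omega^{n-1}_c(\Gamma)$ (compactly supported smooth forms) and $T^*_\Gamma \mathrm V(M)=C^\infty(\Gamma)$ (writing $\tilde n$ for the covector given by a function $n$), paired by $\langle\tilde n,\xi\rangle=\int_\Gamma n\,\xi$. The anchor map is $\#:\mathrm{DVect}(M,\Gamma)\to T_\Gamma\mathrm V(M)$, $\#v=i_v\mu|_\Gamma$. Let $\mathrm{DVect}(M,\Gamma)^*$ be the space of linear functionals on $\mathrm{DVect}(M,\Gamma)$; a $1$-form density $\alpha\otimes\mu$ with $\alpha\in\mathrm D\Omega^1(M,\Gamma)$ is viewed as the functional $\langle\alpha\otimes\mu,u\rangle=\int_M (i_u\alpha)\,\mu$. For $h\in\mathrm{DC}^\infty(M,\Gamma)$ the functional $T^{\mathcal R}h\otimes\mu$ is defined by $\langle T^{\mathcal R}h\otimes\mu,u\rangle=\int_M \mathrm{div}^{\mathcal R}(u)\,h\,\mu$. The dual $\#^*:T^*_\Gamma\mathrm V(M)\to\mathrm{DVect}(M,\Gamma)^*$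 of the anchor map is $\langle\#^*\tilde n,u\rangle=\langle\tilde n,\#u\rangle$. Let $m\in\mathrm D\Omega^1(M,\Gamma)$ and $\tilde m=m\otimes\mu$. Put $T^*_{\tilde m}\mathrm{DVect}(M)^*=\mathrm{DVect}(M,\Gamma)\oplus T^*_\Gamma\mathrm V(M)$ and $T_{\tilde m}\mathrm{DVect}(M)^*=\mathrm{DVect}(M,\Gamma)^*\oplus T_\Gamma\mathrm V(M)$, with the pairing $\langle (v,\tilde n),(\ell,\xi)\rangle=\ell(v)+\langle\tilde n,\xi\rangle$. The Poisson bracket on $\mathrm{DVect}(M)^*$ at $\tilde m$ is $$\mathcal P_{\tilde m}\big((v_1,\tilde n_1),(v_2,\tilde n_2)\big)=\int_M m([v_1,v_2]^{\mathcal R})\,\mu+\int_\Gamma\big(n_2-\mathrm{jump}(i_{v_2}m)\big)\,i_{v_1}\mu-\int_\Gamma\big(n_1-\mathrm{jump}(i_{v_1}m)\big)\,i_{v_2}\mu .$$ Then there is exactly one map (the Hamiltonian operator) $\mathcal P^\#_{\tilde m}:T^*_{\tilde m}\mathrm{DVect}(M)^*\to T_{\tilde m}\mathrm{DVect}(M)^*$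 with $\langle b,\mathcal P^\#_{\tilde m}(a)\rangle=\mathcal P_{\tilde m}(a,b)$ for all $a,b\in T^*_{\tilde m}\mathrm{DVect}(M)^*$. It is linear, and it is given by $$(v,\tilde n)\mapsto\Big(\big(-i_vd^{\mathcal R}m-\mathrm{div}^{\mathcal R}(v)\,m-d^{\mathcal R}i_vm\big)\otimes\mu+\#^*\widetilde{\mathrm{jump}(i_vm)}-\#^*\tilde n,\ \#v\Big).$$ Moreover, for each $n\in C^\infty(\Gamma)$ there is $h\in\mathrm{DC}^\infty(M,\Gamma)$ with $\mathrm{jump}(h)=n$, and for every such $h$ $$\#^*\tilde n=(d^{\mathcal R}h+T^{\mathcal R}h)\otimes\mu .$$ -/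

import Mathlib

open Set MeasureTheory
open scoped Manifold ContDiff

noncomputable section

namespace VortexSheet

/-- The coordinate space of a manifold of dimension `k + 1`. -/
abbrev Coord (k : ℕ) : Type := EuclideanSpace ℝ (Fin (k + 1))

section Fields

variable (k : ℕ) (M : Type*) [TopologicalSpace M] [ChartedSpace (Coord k) M]

/-- (Not necessarily smooth) vector fields on `M`. -/
abbrev VField : Type _ := (x : M) → TangentSpace (𝓡 (k + 1)) x

/-- (Not necessarily smooth) `1`-forms on `M`. -/
abbrev OneForm : Type _ := (x : M) → (TangentSpace (𝓡 (k + 1)) x →L[ℝ] ℝ)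

end Fields

variable {k : ℕ} {M : Type*} [TopologicalSpace M] [ChartedSpace (Coord k) M]

/-- The coordinate vector `∂ᵢ` of the chart `φ` at the point with coordinates `y`. -/
def coordVec (φ : OpenPartialHomeomorph M (Coord k)) (y : Coord k) (i : Fin (k + 1)) :
    TangentSpace (𝓡 (k + 1)) (φ.symm y) :=
  mfderiv 𝓘(ℝ, Coord k) (𝓡 (k + 1)) φ.symm y (EuclideanSpace.single i (1 : ℝ) : Coord k)

/-- The components of tangent vectors at `x` in the chart `φ`. -/
def chartDeriv (φ : OpenPartialHomeomorph M (Coord k)) (x : M) :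
    TangentSpace (𝓡 (k + 1)) x →L[ℝ] Coord k :=
  mfderiv (𝓡 (k + 1)) 𝓘(ℝ, Coord k) φ x

/-- Smoothness of a vector field on a set (for a closed domain: up to the boundary). -/
def SmoothVFieldOn (v : VField k M) (s : Set M) [IsManifold (𝓡 (k + 1)) ∞ M] : Prop :=
  ContMDiffOn (𝓡 (k + 1)) ((𝓡 (k + 1)).prod 𝓘(ℝ, Coord k)) ∞
    (fun x => (⟨x, v x⟩ : TangentBundle (𝓡 (k + 1)) M)) s

/-- Smoothness of a `1`-form on a set, as a section of the cotangent bundle. -/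
def SmoothOneFormOn (m : OneForm k M) (s : Set M) [IsManifold (𝓡 (k + 1)) ∞ M] : Prop :=
  ContMDiffOn (𝓡 (k + 1)) ((𝓡 (k + 1)).prod 𝓘(ℝ, Coord k →L[ℝ] ℝ)) ∞
    (fun x => Bundle.TotalSpace.mk' (Coord k →L[ℝ] ℝ)
      (E := fun x : M => (TangentSpace (𝓡 (k + 1)) x →L[ℝ] Bundle.Trivial M ℝ x)) x (m x)) s

variable (k M) in
/-- A volume form on a manifold of dimension `k + 1`: a smooth nowhere vanishing form of top
degree. It also provides the orientation of `M`. -/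
structure VolumeForm where
  form : (x : M) → (TangentSpace (𝓡 (k + 1)) x) [⋀^Fin (k + 1)]→ₗ[ℝ] ℝ
  ne_zero : ∀ x, form x ≠ 0
  smooth : ∀ φ ∈ IsManifold.maximalAtlas (𝓡 (k + 1)) ∞ M,
    ContDiffOn ℝ ∞ (fun y => form (φ.symm y) (coordVec φ y)) φ.target

/-- The coefficient `μ(∂₀, …, ∂ₖ)` of a volume form in a chart. -/
def VolumeForm.coeff (μ : VolumeForm k M) (φ : OpenPartialHomeomorph M (Coord k))
    (y : Coord k) : ℝ :=
  μ.form (φ.symm y) (coordVec φ y)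

/-- The measure `|μ(∂₀, …, ∂ₖ)| dy₀ ⋯ dyₖ` on the domain of the chart `φ`. -/
def VolumeForm.chartMeasure [MeasurableSpace M] (μ : VolumeForm k M)
    (φ : OpenPartialHomeomorph M (Coord k)) : Measure M :=
  ((volume.restrict φ.target).withDensity
    (fun y => ENNReal.ofReal |μ.coeff φ y|)).map φ.symm

/-- The measure on `M` defined by integration of the volume form `μ` (for the orientation given
by `μ`). The coordinate measures agree on overlaps of charts, so that their supremum is the measure
which restricts to each of them on the domain of the chart. -/
def VolumeForm.measure [MeasurableSpace M] (μ : VolumeForm k M) : Measure M :=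
  ⨆ φ ∈ IsManifold.maximalAtlas (𝓡 (k + 1)) ∞ M, μ.chartMeasure φ

/-- The divergence of the vector field `v` with respect to `μ` on the domain `s` (one-sided at
boundary points), `div v = ρ⁻¹ ∑ᵢ ∂ᵢ(ρ vⁱ)` where `μ = ρ dy₀ ∧ ⋯ ∧ dyₖ` in a chart at `x`. -/
def divWithin (μ : VolumeForm k M) (s : Set M) (v : VField k M) (x : M) : ℝ :=
  let φ := chartAt (Coord k) x
  (μ.coeff φ (φ x))⁻¹ * ∑ i : Fin (k + 1),
    fderivWithin ℝ
      (fun y => μ.coeff φ y *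
        (chartDeriv φ (φ.symm y) (v (φ.symm y))) i)
      (φ.target ∩ φ.symm ⁻¹' s) (φ x) (EuclideanSpace.single i (1 : ℝ))

/-- The coordinate expression of a `1`-form in a chart. -/
def OneForm.inChart (m : OneForm k M) (φ : OpenPartialHomeomorph M (Coord k)) (y : Coord k) :
    Coord k →L[ℝ] ℝ :=
  (m (φ.symm y)).comp (mfderiv 𝓘(ℝ, Coord k) (𝓡 (k + 1)) φ.symm y)

/-- The `1`-form `i_v dm` on the domain `s` (one-sided derivatives at boundary points), where
`dm(a, b) = D_a m (b) - D_b m (a)` in a chart at `x`. -/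
def interiorExtDerivWithin (s : Set M) (m : OneForm k M) (v : VField k M) : OneForm k M := fun x =>
  let φ := chartAt (Coord k) x
  let D : Coord k →L[ℝ] Coord k →L[ℝ] ℝ :=
    fderivWithin ℝ (m.inChart φ) (φ.target ∩ φ.symm ⁻¹' s) (φ x)
  let J := chartDeriv φ x
  (D (J (v x)) - D.flip (J (v x))).comp J

/-- The differential of a function on the domain `s` (one-sided at boundary points). -/
def dWithin (s : Set M) (h : M → ℝ) : OneForm k M := fun x =>
  mfderivWithin (𝓡 (k + 1)) 𝓘(ℝ, ℝ) h s x

variable (k M) in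
/-- A hypersurface `Γ` of `M` dividing `M` into two open regions `D⁺` and `D⁻`: near each point
of `Γ` there is a smooth chart in which `D⁺`, `Γ`, `D⁻` are given by `y₀ < 0`, `y₀ = 0`, `y₀ > 0`.
Thus `Γ` is the boundary of `D⁺` and `∂₀` points out of `D⁺`. -/
structure Sheet where
  Γ : Set M
  Dp : Set M
  Dm : Set M
  isOpen_Dp : IsOpen Dp
  isOpen_Dm : IsOpen Dm
  disjoint_Dp_Dm : Disjoint Dp Dm
  disjoint_Dp_Γ : Disjoint Dp Γ
  disjoint_Dm_Γ : Disjoint Dm Γ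
  cover : Dp ∪ Γ ∪ Dm = univ
  exists_chart : ∀ p ∈ Γ, ∃ φ ∈ IsManifold.maximalAtlas (𝓡 (k + 1)) ∞ M, p ∈ φ.source ∧
    ∀ x ∈ φ.source, (x ∈ Dp ↔ φ x 0 < 0) ∧ (x ∈ Γ ↔ φ x 0 = 0) ∧ (x ∈ Dm ↔ 0 < φ x 0)

/-- The inclusion of the hyperplane `y₀ = 0` into the coordinate space. -/
def incl (y : EuclideanSpace ℝ (Fin k)) : Coord k :=
  WithLp.toLp 2 (Fin.cons 0 y.ofLp)

/-- The slice of a chart domain by the hyperplane `y₀ = 0`. -/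
def sliceTarget (φ : OpenPartialHomeomorph M (Coord k)) : Set (EuclideanSpace ℝ (Fin k)) :=
  {y | incl y ∈ φ.target}

namespace Sheet

variable (S : Sheet k M)

/-- The smooth charts of `M` adapted to the hypersurface. -/
def adaptedCharts : Set (OpenPartialHomeomorph M (Coord k)) :=
  {φ | φ ∈ IsManifold.maximalAtlas (𝓡 (k + 1)) ∞ M ∧
    ∀ x ∈ φ.source,
      (x ∈ S.Dp ↔ φ x 0 < 0) ∧ (x ∈ S.Γ ↔ φ x 0 = 0) ∧ (x ∈ S.Dm ↔ 0 < φ x 0)}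

/-- The closed region `D⁺ ∪ Γ`. -/
def Cp : Set M := S.Dp ∪ S.Γ

/-- The closed region `D⁻ ∪ Γ`. -/
def Cm : Set M := S.Dm ∪ S.Γ

/-- The tangent space of `Γ` at a point `x ∈ Γ`: the kernel of `dy₀` in adapted charts. -/
def tangent (x : M) : Submodule ℝ (TangentSpace (𝓡 (k + 1)) x) where
  carrier := {w | ∀ φ ∈ S.adaptedCharts, x ∈ φ.source →
    (chartDeriv φ x w) 0 = 0}
  add_mem' := by
    intro a b ha hb φ hφ hx
    have h1 := ha φ hφ hx
    have h2 := hb φ hφ hx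
    rw [map_add]
    exact (congrArg₂ (· + ·) h1 h2).trans (add_zero 0)
  zero_mem' := by
    intro φ _ _
    rw [map_zero]
    rfl
  smul_mem' := by
    intro c a ha φ hφ hx
    have h1 := ha φ hφ hx
    rw [map_smul]
    exact (congrArg (c * ·) h1).trans (mul_zero c)

/-- In an adapted chart the coordinate vectors `∂₁, …, ∂ₖ` are tangent to `Γ`. -/
theorem coordVec_mem_tangent [IsManifold (𝓡 (k + 1)) ∞ M]
    {φ : OpenPartialHomeomorph M (Coord k)} (hφ : φ ∈ S.adaptedCharts)
    {y : EuclideanSpace ℝ (Fin k)} (hy : y ∈ sliceTarget φ) (j : Fin k) :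
    coordVec φ (incl y) j.succ ∈ S.tangent (φ.symm (incl y)) := by
  rintro ψ ⟨hψ, hψS⟩ hx
  obtain ⟨hφ, hφS⟩ := hφ
  have h1 : MDifferentiableAt (𝓡 (k + 1)) 𝓘(ℝ, Coord k) ψ (φ.symm (incl y)) :=
    (contMDiffAt_of_mem_maximalAtlas hψ hx).mdifferentiableAt (by simp)
  have h2 : MDifferentiableAt 𝓘(ℝ, Coord k) (𝓡 (k + 1)) φ.symm (incl y) :=
    (contMDiffAt_symm_of_mem_maximalAtlas hφ hy).mdifferentiableAt (by simp)
  have h3 := h1.hasMFDerivAt.comp (incl y) h2.hasMFDerivAt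
  have h4 := h3.hasFDerivAt
  let e : Coord k := EuclideanSpace.single j.succ (1 : ℝ)
  have hl : HasDerivAt (fun t : ℝ => incl y + t • e) e 0 := by
    simpa using ((hasDerivAt_id (0 : ℝ)).smul_const e).const_add (incl y)
  have hl0 : incl y + (0 : ℝ) • e = incl y := by simp
  have h5 := h4.comp_hasDerivAt_of_eq (0 : ℝ) hl hl0.symm
  have h6 := (EuclideanSpace.proj (0 : Fin (k + 1)) : Coord k →L[ℝ] ℝ).hasFDerivAt.comp_hasDerivAt
    (0 : ℝ) h5
  have hz : (fun t : ℝ => (ψ (φ.symm (incl y + t • e))) 0) =ᶠ[nhds 0] fun _ => (0 : ℝ) := by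
    have hc : ContinuousAt (fun t : ℝ => incl y + t • e) 0 := hl.continuousAt
    have ht : ∀ᶠ t in nhds (0 : ℝ), incl y + t • e ∈ φ.target :=
      hc.eventually_mem (by rw [hl0]; exact φ.open_target.mem_nhds hy)
    have hs : ∀ᶠ t in nhds (0 : ℝ), φ.symm (incl y + t • e) ∈ ψ.source := by
      refine (ContinuousAt.comp (f := fun t : ℝ => incl y + t • e) (g := φ.symm) ?_ hc).eventually_mem ?_
      · rw [hl0]; exact φ.continuousAt_symm hy
      · simp only [Function.comp, hl0]; exact ψ.open_source.mem_nhds hx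
    filter_upwards [ht, hs] with t ht hs
    have hm := φ.map_target ht
    rw [← (hψS _ hs).2.1, (hφS _ hm).2.1, φ.right_inv ht]
    simp [incl, e]
  exact h6.unique ((hasDerivAt_const (0 : ℝ) (0 : ℝ)).congr_of_eventuallyEq hz)

/-- Discontinuous functions `χ⁺f⁺ + χ⁻f⁻`, encoded by the pair `(f⁺, f⁻)` of functions which are
smooth on the closed regions `D⁺ ∪ Γ`, `D⁻ ∪ Γ` and extended by zero. -/
def DFun : Set ((M → ℝ) × (M → ℝ)) :=
  {f | ContMDiffOn (𝓡 (k + 1)) 𝓘(ℝ, ℝ) ∞ f.1 S.Cp ∧ ContMDiffOn (𝓡 (k + 1)) 𝓘(ℝ, ℝ) ∞ f.2 S.Cm ∧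
    (∀ x ∉ S.Cp, f.1 x = 0) ∧ ∀ x ∉ S.Cm, f.2 x = 0}

/-- The jump `f⁺ - f⁻` across `Γ`, as a function on `Γ` (extended by zero). -/
def jump (f : (M → ℝ) × (M → ℝ)) : M → ℝ :=
  S.Γ.indicator fun x => f.1 x - f.2 x

/-- Smooth functions on `Γ` (extended by zero). This is the cotangent space at `Γ` of the space
of hypersurfaces. -/
def cotangent : Submodule ℝ (M → ℝ) where
  carrier := {n | ContMDiffOn (𝓡 (k + 1)) 𝓘(ℝ, ℝ) ∞ n S.Γ ∧ ∀ x ∉ S.Γ, n x = 0}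
  add_mem' := by
    rintro a b ⟨ha, ha'⟩ ⟨hb, hb'⟩
    exact ⟨ha.add hb, fun x hx => by simp [ha' x hx, hb' x hx]⟩
  zero_mem' := ⟨contMDiffOn_const, fun _ _ => rfl⟩
  smul_mem' := by
    rintro c a ⟨ha, ha'⟩
    exact ⟨(contMDiffOn_const (c := c)).mul ha, fun x hx => by simp [ha' x hx]⟩

/-- (Not necessarily smooth) forms of degree `k` on the `k`-dimensional manifold `Γ`. -/
abbrev GammaForm : Type _ := (x : M) → (S.tangent x) [⋀^Fin k]→ₗ[ℝ] ℝ

section Manifold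

variable [IsManifold (𝓡 (k + 1)) ∞ M]

open Classical in
/-- The coefficient `ξ(∂₁, …, ∂ₖ)` of a `k`-form on `Γ` in an adapted chart. -/
def GammaForm.coeff {S : Sheet k M} (ξ : S.GammaForm) (φ : OpenPartialHomeomorph M (Coord k))
    (y : EuclideanSpace ℝ (Fin k)) : ℝ :=
  if h : φ ∈ S.adaptedCharts ∧ y ∈ sliceTarget φ then
    ξ (φ.symm (incl y)) fun j => ⟨coordVec φ (incl y) j.succ, S.coordVec_mem_tangent h.1 h.2 j⟩
  else 0

/-- Compactly supported smooth `k`-forms on `Γ`. This is the tangent space at `Γ` of the space of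
hypersurfaces. -/
def topForms : Submodule ℝ S.GammaForm where
  carrier := {ξ | (∀ φ ∈ S.adaptedCharts, ContDiffOn ℝ ∞ (GammaForm.coeff ξ φ) (sliceTarget φ)) ∧
    (∀ x ∉ S.Γ, ξ x = 0) ∧ ∃ K : Set M, IsCompact K ∧ ∀ x ∉ K, ξ x = 0}
  add_mem' := by
    rintro a b ⟨ha, ha', K, hK, hKa⟩ ⟨hb, hb', L, hL, hLb⟩
    refine ⟨fun φ hφ => ((ha φ hφ).add (hb φ hφ)).congr fun y hy => ?_,
      fun x hx => ?_, K ∪ L, hK.union hL, fun x hx => ?_⟩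
    · simp [GammaForm.coeff, hφ, hy]
    · simp [ha' x hx, hb' x hx]
    · rw [mem_union, not_or] at hx
      simp [hKa x hx.1, hLb x hx.2]
  zero_mem' := by
    refine ⟨fun φ hφ => contDiffOn_const (c := (0 : ℝ)) |>.congr fun y hy => ?_,
      fun x hx => rfl, ∅, isCompact_empty, fun x hx => rfl⟩
    simp [GammaForm.coeff]
  smul_mem' := by
    rintro c a ⟨ha, ha', K, hK, hKa⟩
    refine ⟨fun φ hφ => ((ha φ hφ).const_smul c).congr fun y hy => ?_,
      fun x hx => ?_, K, hK, fun x hx => ?_⟩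
    · simp [GammaForm.coeff, hφ, hy]
    · simp [ha' x hx]
    · simp [hKa x hx]

/-- The coefficient of a `k`-form on `Γ` in an adapted chart, with the sign given by the boundary
orientation of `Γ = ∂D⁺`: since `∂₀` points out of `D⁺`, the frame `(∂₁, …, ∂ₖ)` is positive if and
only if the frame `(∂₀, ∂₁, …, ∂ₖ)` is. -/
def GammaForm.orientedCoeff {S : Sheet k M} (μ : VolumeForm k M) (ξ : S.GammaForm)
    (φ : OpenPartialHomeomorph M (Coord k)) (y : EuclideanSpace ℝ (Fin k)) : ℝ :=
  Real.sign (μ.coeff φ (incl y)) * GammaForm.coeff ξ φ y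

/-- The measure on `Γ` defined by the positive part of a `k`-form: the measure which in each
adapted chart is `max (ξ(∂₁, …, ∂ₖ), 0) dy₁ ⋯ dyₖ`. -/
def GammaForm.posMeasure {S : Sheet k M} [MeasurableSpace M] (μ : VolumeForm k M)
    (ξ : S.GammaForm) : Measure M :=
  ⨆ φ ∈ S.adaptedCharts,
    ((volume.restrict (sliceTarget φ)).withDensity
      (fun y => ENNReal.ofReal (GammaForm.orientedCoeff μ ξ φ y))).map (fun y => φ.symm (incl y))

/-- The integral `∫_Γ ξ` of a `k`-form over `Γ = ∂D⁺` with its boundary orientation. -/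
def integralΓ [MeasurableSpace M] (μ : VolumeForm k M) (ξ : S.GammaForm) : ℝ :=
  (GammaForm.posMeasure μ ξ univ).toReal - (GammaForm.posMeasure μ (-ξ) univ).toReal

/-- The pairing `⟨n, ξ⟩ = ∫_Γ n ξ` of a function and a `k`-form on `Γ`. -/
def pairingΓ [MeasurableSpace M] (μ : VolumeForm k M) (n : M → ℝ) (ξ : S.GammaForm) : ℝ :=
  S.integralΓ μ fun x => n x • ξ x

/-- The integral `∫_M f μ` of a discontinuous function. -/
def integral [MeasurableSpace M] (μ : VolumeForm k M) (f : (M → ℝ) × (M → ℝ)) : ℝ :=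
  (∫ x in S.Dp, f.1 x ∂μ.measure) + ∫ x in S.Dm, f.2 x ∂μ.measure

/-- Discontinuous `1`-forms `χ⁺m⁺ + χ⁻m⁻`, smooth on the closed regions. -/
def DOneForm : Set (OneForm k M × OneForm k M) :=
  {m | SmoothOneFormOn m.1 S.Cp ∧ SmoothOneFormOn m.2 S.Cm ∧
    (∀ x ∉ S.Cp, m.1 x = 0) ∧ ∀ x ∉ S.Cm, m.2 x = 0}

/-- Compactly supported discontinuous vector fields `χ⁺v⁺ + χ⁻v⁻`, smooth on the closed regions,
with continuous normal component: `v⁺ - v⁻` is tangent to `Γ` along `Γ`. -/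
def DVect : Submodule ℝ (VField k M × VField k M) where
  carrier := {v | SmoothVFieldOn v.1 S.Cp ∧ SmoothVFieldOn v.2 S.Cm ∧
    (∀ x ∉ S.Cp, v.1 x = 0) ∧ (∀ x ∉ S.Cm, v.2 x = 0) ∧
    (∃ K : Set M, IsCompact K ∧ ∀ x ∉ K, v.1 x = 0 ∧ v.2 x = 0) ∧
    ∀ x ∈ S.Γ, v.1 x - v.2 x ∈ S.tangent x}
  add_mem' := by
    rintro a b ⟨a1, a2, a3, a4, ⟨K, hK, hKa⟩, a5⟩ ⟨b1, b2, b3, b4, ⟨L, hL, hLb⟩, b5⟩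
    refine ⟨ContMDiffOn.add_section a1 b1, ContMDiffOn.add_section a2 b2, fun x hx => ?_,
      fun x hx => ?_, ⟨K ∪ L, hK.union hL, fun x hx => ?_⟩, fun x hx => ?_⟩
    · simp [a3 x hx, b3 x hx]
    · simp [a4 x hx, b4 x hx]
    · rw [mem_union, not_or] at hx
      simp [hKa x hx.1, hLb x hx.2]
    · have := add_mem (a5 x hx) (b5 x hx)
      rw [sub_add_sub_comm] at this
      exact this
  zero_mem' := by
    refine ⟨Bundle.contMDiffOn_zeroSection ℝ _, Bundle.contMDiffOn_zeroSection ℝ _,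
      fun x _ => rfl, fun x _ => rfl, ⟨∅, isCompact_empty, fun x _ => ⟨rfl, rfl⟩⟩, fun x _ => ?_⟩
    have : (0 : TangentSpace (𝓡 (k + 1)) x) - 0 ∈ S.tangent x := by
      rw [sub_zero]; exact zero_mem _
    exact this
  smul_mem' := by
    rintro c a ⟨a1, a2, a3, a4, ⟨K, hK, hKa⟩, a5⟩
    refine ⟨ContMDiffOn.const_smul_section a1, ContMDiffOn.const_smul_section a2, fun x hx => ?_,
      fun x hx => ?_, ⟨K, hK, fun x hx => ?_⟩, fun x hx => ?_⟩
    · simp [a3 x hx]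
    · simp [a4 x hx]
    · simp [hKa x hx]
    · have := (S.tangent x).smul_mem c (a5 x hx)
      rw [smul_sub] at this
      exact this

/-- The contraction `i_v m`. -/
def contract (v : VField k M × VField k M) (m : OneForm k M × OneForm k M) :
    (M → ℝ) × (M → ℝ) :=
  (fun x => m.1 x (v.1 x), fun x => m.2 x (v.2 x))

/-- The regularized Lie bracket. -/
def lieBracketR (v w : VField k M × VField k M) : VField k M × VField k M :=
  (VectorField.mlieBracketWithin (𝓡 (k + 1)) v.1 w.1 S.Cp,
    VectorField.mlieBracketWithin (𝓡 (k + 1)) v.2 w.2 S.Cm)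

/-- The regularized divergence. -/
def divR (μ : VolumeForm k M) (v : VField k M × VField k M) : (M → ℝ) × (M → ℝ) :=
  (divWithin μ S.Cp v.1, divWithin μ S.Cm v.2)

/-- The regularized differential of a discontinuous function. -/
def dR (h : (M → ℝ) × (M → ℝ)) : OneForm k M × OneForm k M :=
  (dWithin S.Cp h.1, dWithin S.Cm h.2)

/-- The `1`-form `i_v dm` for the regularized exterior derivative. -/
def interiorExtDerivR (m : OneForm k M × OneForm k M) (v : VField k M × VField k M) :
    OneForm k M × OneForm k M :=
  (interiorExtDerivWithin S.Cp m.1 v.1, interiorExtDerivWithin S.Cm m.2 v.2)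

/-- The product of a discontinuous function and a discontinuous `1`-form. -/
def mulForm (f : (M → ℝ) × (M → ℝ)) (m : OneForm k M × OneForm k M) :
    OneForm k M × OneForm k M :=
  (fun x => f.1 x • m.1 x, fun x => f.2 x • m.2 x)

/-- The `1`-form density `m ⊗ μ` as a functional on discontinuous vector fields,
`⟨m ⊗ μ, u⟩ = ∫_M (i_u m) μ`. -/
def density [MeasurableSpace M] (μ : VolumeForm k M) (m : OneForm k M × OneForm k M)
    (u : S.DVect) : ℝ :=
  S.integral μ (contract u.1 m)

open Classical in
/-- The anchor map, `#v = i_v μ` restricted to `Γ`. -/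
def anchor (μ : VolumeForm k M) (v : S.DVect) : S.GammaForm := fun x =>
  if x ∈ S.Γ then
    ((μ.form x).curryLeft (v.1.1 x)).compLinearMap (S.tangent x).subtype
  else 0

/-- The dual of the anchor map, `⟨#* n, u⟩ = ⟨n, #u⟩`. -/
def dualAnchor [MeasurableSpace M] (μ : VolumeForm k M) (n : S.cotangent) (u : S.DVect) : ℝ :=
  S.pairingΓ μ n (S.anchor μ u)

/-- The functional `T h ⊗ μ`, defined by `⟨T h ⊗ μ, u⟩ = ∫_M div(u) h μ`. -/
def divDual [MeasurableSpace M] (μ : VolumeForm k M) (h : (M → ℝ) × (M → ℝ)) (u : S.DVect) : ℝ :=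
  S.integral μ (S.divR μ u.1 * h)

/-- For a discontinuous `1`-form `m` and `v` in `DVect`, the jump of `i_v m` is smooth on `Γ`. -/
theorem jump_contract_mem {m : OneForm k M × OneForm k M} (hm : m ∈ S.DOneForm) (v : S.DVect) :
    S.jump (contract v.1 m) ∈ S.cotangent := by
  obtain ⟨m1, m2, -, -⟩ := hm
  obtain ⟨⟨v1, v2⟩, hv1, hv2, -⟩ := v
  have h1 : ContMDiffOn (𝓡 (k + 1)) 𝓘(ℝ, ℝ) ∞ (fun x => m.1 x (v1 x)) S.Cp := by
    intro x hx
    have := ContMDiffWithinAt.clm_bundle_apply (m1 x hx) (hv1 x hx)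
    simp only [Bundle.contMDiffWithinAt_totalSpace] at this
    exact this.2
  have h2 : ContMDiffOn (𝓡 (k + 1)) 𝓘(ℝ, ℝ) ∞ (fun x => m.2 x (v2 x)) S.Cm := by
    intro x hx
    have := ContMDiffWithinAt.clm_bundle_apply (m2 x hx) (hv2 x hx)
    simp only [Bundle.contMDiffWithinAt_totalSpace] at this
    exact this.2
  refine ⟨ContMDiffOn.congr ((h1.mono subset_union_right).sub (h2.mono subset_union_right))
    fun x hx => ?_, fun x hx => indicator_of_notMem hx _⟩
  exact indicator_of_mem hx _

/-- The function `jump(i_v m)` as an element of the cotangent space at `Γ`. -/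
def jumpContract {m : OneForm k M × OneForm k M} (hm : m ∈ S.DOneForm) (v : S.DVect) :
    S.cotangent :=
  ⟨S.jump (contract v.1 m), S.jump_contract_mem hm v⟩

/-- The Poisson bracket at `m ⊗ μ`, as a form on the cotangent space `DVect × C^∞(Γ)`:
`P((v₁, n₁), (v₂, n₂)) = ∫_M m([v₁, v₂]) μ + ∫_Γ (n₂ - jump(i_{v₂} m)) i_{v₁} μ
  - ∫_Γ (n₁ - jump(i_{v₁} m)) i_{v₂} μ`. -/
def poisson [MeasurableSpace M] (μ : VolumeForm k M) {m : OneForm k M × OneForm k M}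
    (hm : m ∈ S.DOneForm) (a b : S.DVect × S.cotangent) : ℝ :=
  S.integral μ (contract (S.lieBracketR a.1.1 b.1.1) m)
    + S.pairingΓ μ (b.2 - S.jumpContract hm b.1) (S.anchor μ a.1)
    - S.pairingΓ μ (a.2 - S.jumpContract hm a.1) (S.anchor μ b.1)

/-- The Hamiltonian operator of the Poisson bracket at `m ⊗ μ`: the map `P` from the cotangent
space `DVect × C^∞(Γ)` to the tangent space `DVect* × Ω^k(Γ)` with
`⟨b, P a⟩ = P_m(a, b)` for all covectors `a`, `b`. -/
def IsHamiltonianOperator [MeasurableSpace M] (μ : VolumeForm k M) {m : OneForm k M × OneForm k M}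
    (hm : m ∈ S.DOneForm)
    (P : S.DVect × S.cotangent → Module.Dual ℝ S.DVect × S.topForms) : Prop :=
  ∀ a b : S.DVect × S.cotangent,
    (P a).1 b.1 + S.pairingΓ μ b.2 (P a).2 = S.poisson μ hm a b

end Manifold

end Sheet

end VortexSheet

end

open Set MeasureTheory
open scoped Manifold ContDiff

noncomputable section

namespace VortexSheet

set_option linter.unusedSectionVars false

open Filter Topology

/-! ### Frames of charts and the determinant law for the volume form -/

section Charts

variable {k : ℕ} {M : Type*} [TopologicalSpace M] [ChartedSpace (Coord k) M]

/-! Everything rests on one divergence theorem for discontinuous fields, `Sheet.integral_div_add_d`: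
for `h` smooth up to `Γ` on each side and `v` in `DVect`, the integral of `h div v + dh(v)`, that is
of `div(h v)`, equals `∫_Γ jump(h) i_v μ`. The two sides of `Γ` contribute `h⁺` and `-h⁻` times the
same form `i_v μ`, because `v⁺ - v⁻` is tangent to `Γ`. Read for a function `h` with jump `n`, this
is already the formula for `#* n`.

For the Hamiltonian operator, take `h = i_u m`. Cartan's formula (`oneForm_mlieBracketWithin`) gives
pointwise on each open region `(-i_v dm - div(v) m - d(i_v m))(u) = m([v, u]) - (m(u) div v +
d(m(u))(v))`. Integrating, `Sheet.density_hamiltonianFormR` identifies the density paired with `u`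
as `∫ m([v, u]) μ - ∫_Γ jump(i_u m) i_v μ`. The remaining terms of the Poisson bracket are the
pairing of the second covector with `#v` and the functionals `#* jump(i_v m)` and `#* n` at `u`.
Uniqueness holds because covectors `(u, 0)` determine the functional component, while covectors `(0,
n)` determine the form on `Γ`: the pairing of functions and forms on `Γ` is nondegenerate, by a bump
function argument (`Sheet.eq_zero_of_pairingΓ_eq_zero`).

The divergence theorem is proved in adapted charts on half-spaces and globalized by a partition of
unity. Two facts make this legitimate. The measures on `M` and on `Γ`, defined as suprema of
coordinate measures, restrict to each chart as the coordinate measure, by change of variables; on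
`Γ` the orientation sign turns a determinant into its absolute value. The divergence, defined at
each point in the preferred chart there, does not depend on the chart (`divChart_eq`); this is shown
weakly, by testing against bump functions. -/

/-- The inverse of `chartDeriv φ x`. -/
def chartFrame (φ : OpenPartialHomeomorph M (Coord k)) (x : M) :
    Coord k →L[ℝ] TangentSpace (𝓡 (k + 1)) x :=
  (chartDeriv φ x).inverse

/-- The derivative at `x` of the transition map from the chart `φ` to the chart `ψ`. -/
def transDeriv (φ ψ : OpenPartialHomeomorph M (Coord k)) (x : M) : Coord k →L[ℝ] Coord k :=
  (chartDeriv ψ x).comp (chartFrame φ x)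

variable [IsManifold (𝓡 (k + 1)) ∞ M]

local notation "AT" => IsManifold.maximalAtlas (𝓡 (k + 1)) ∞ M

variable {φ ψ : OpenPartialHomeomorph M (Coord k)}

theorem mdifferentiable_chart_of_mem (hφ : φ ∈ AT) :
    φ.MDifferentiable (𝓡 (k + 1)) 𝓘(ℝ, Coord k) :=
  ⟨fun _ hx => ((contMDiffAt_of_mem_maximalAtlas hφ hx).mdifferentiableAt
      (by simp)).mdifferentiableWithinAt,
    fun _ hx => ((contMDiffAt_symm_of_mem_maximalAtlas hφ hx).mdifferentiableAt
      (by simp)).mdifferentiableWithinAt⟩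

theorem exists_equiv_chartDeriv (hφ : φ ∈ AT) {x : M} (hx : x ∈ φ.source) :
    ∃ e : TangentSpace (𝓡 (k + 1)) x ≃L[ℝ] Coord k, (e : _ →L[ℝ] Coord k) = chartDeriv φ x := by
  refine ⟨(mdifferentiable_chart_of_mem hφ).mfderiv hx, rfl⟩

theorem chartDeriv_chartFrame (hφ : φ ∈ AT) {x : M} (hx : x ∈ φ.source) (w : Coord k) :
    chartDeriv φ x (chartFrame φ x w) = w := by
  obtain ⟨e, he⟩ := exists_equiv_chartDeriv hφ hx
  rw [chartFrame, ← he, ContinuousLinearMap.inverse_equiv]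
  exact e.apply_symm_apply w

theorem chartFrame_chartDeriv (hφ : φ ∈ AT) {x : M} (hx : x ∈ φ.source)
    (w : TangentSpace (𝓡 (k + 1)) x) :
    chartFrame φ x (chartDeriv φ x w) = w := by
  obtain ⟨e, he⟩ := exists_equiv_chartDeriv hφ hx
  rw [chartFrame, ← he, ContinuousLinearMap.inverse_equiv]
  exact e.symm_apply_apply w

/-- Trades derivatives of `φ.symm` at coordinates for a linear map attached to the point of `M`, so
that frames of different charts can be compared at one point. -/
theorem mfderiv_symm_eq_chartFrame (hφ : φ ∈ AT) {y : Coord k} (hy : y ∈ φ.target) :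
    (mfderiv 𝓘(ℝ, Coord k) (𝓡 (k + 1)) φ.symm y : Coord k →L[ℝ] _) = chartFrame φ (φ.symm y) := by
  refine ContinuousLinearMap.ext fun w => ?_
  have h := (mdifferentiable_chart_of_mem hφ).comp_symm_deriv hy
  exact (chartFrame_chartDeriv hφ (φ.map_target hy) _).symm.trans
    (congrArg (chartFrame φ (φ.symm y)) (DFunLike.congr_fun h w))

theorem coordVec_eq_chartFrame (hφ : φ ∈ AT) {y : Coord k} (hy : y ∈ φ.target)
    (i : Fin (k + 1)) :
    coordVec φ y i = chartFrame φ (φ.symm y) (EuclideanSpace.single i 1) :=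
  DFunLike.congr_fun (mfderiv_symm_eq_chartFrame hφ hy) _

theorem hasFDerivAt_transition (hφ : φ ∈ AT) (hψ : ψ ∈ AT) {y : Coord k} (hy : y ∈ φ.target)
    (hy' : φ.symm y ∈ ψ.source) :
    HasFDerivAt (fun z => ψ (φ.symm z)) (transDeriv φ ψ (φ.symm y)) y := by
  have h1 := ((contMDiffAt_of_mem_maximalAtlas hψ hy').mdifferentiableAt (by simp)).hasMFDerivAt
  have h2 := ((contMDiffAt_symm_of_mem_maximalAtlas hφ hy).mdifferentiableAt
    (by simp)).hasMFDerivAt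
  have h3 := (h1.comp y h2).hasFDerivAt
  convert h3 using 1
  rw [transDeriv, ← mfderiv_symm_eq_chartFrame hφ hy]
  rfl

theorem chartFrame_transDeriv (hψ : ψ ∈ AT) {x : M}
    (hx' : x ∈ ψ.source) (w : Coord k) :
    chartFrame ψ x (transDeriv φ ψ x w) = chartFrame φ x w := by
  simp [transDeriv, chartFrame_chartDeriv hψ hx']

theorem transDeriv_transDeriv (hφ : φ ∈ AT) (hψ : ψ ∈ AT) {x : M} (hx : x ∈ φ.source)
    (hx' : x ∈ ψ.source) (w : Coord k) :
    transDeriv ψ φ x (transDeriv φ ψ x w) = w := by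
  rw [transDeriv, ContinuousLinearMap.comp_apply, chartFrame_transDeriv hψ hx',
    chartDeriv_chartFrame hφ hx]

theorem det_transDeriv_ne_zero (hφ : φ ∈ AT) (hψ : ψ ∈ AT) {x : M} (hx : x ∈ φ.source)
    (hx' : x ∈ ψ.source) : (transDeriv φ ψ x).det ≠ 0 := by
  have h : (transDeriv ψ φ x : Coord k →ₗ[ℝ] Coord k) ∘ₗ (transDeriv φ ψ x) = LinearMap.id := by
    ext w : 1
    exact transDeriv_transDeriv hφ hψ hx hx' w
  have h2 := congrArg LinearMap.det h
  rw [LinearMap.det_comp, LinearMap.det_id] at h2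
  exact right_ne_zero_of_mul_eq_one h2

/-- A form of top degree is a multiple of the determinant in the standard basis. This is the source
of both transformation laws below, on `M` and on `Γ`. -/
theorem alternatingMap_comp_eq_det {n : ℕ} (f : EuclideanSpace ℝ (Fin n) [⋀^Fin n]→ₗ[ℝ] ℝ)
    (A : EuclideanSpace ℝ (Fin n) →ₗ[ℝ] EuclideanSpace ℝ (Fin n))
    (w : Fin n → EuclideanSpace ℝ (Fin n)) :
    f (fun i => A (w i)) = LinearMap.det A * f w := by
  have h := f.eq_smul_basis_det (EuclideanSpace.basisFun (Fin n) ℝ).toBasis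
  rw [h]
  simp only [AlternatingMap.smul_apply, smul_eq_mul]
  have := Module.Basis.det_comp (EuclideanSpace.basisFun (Fin n) ℝ).toBasis A w
  rw [show (fun i => A (w i)) = A ∘ w from rfl, this]
  ring

/-- The coefficient of the volume form in the chart `φ`, as a function on `M`. -/
def VolumeForm.coeffAt (μ : VolumeForm k M) (φ : OpenPartialHomeomorph M (Coord k)) (x : M) : ℝ :=
  μ.form x fun i => chartFrame φ x (EuclideanSpace.single i 1)

theorem VolumeForm.coeff_eq (μ : VolumeForm k M) (hφ : φ ∈ AT) {y : Coord k}
    (hy : y ∈ φ.target) : μ.coeff φ y = μ.coeffAt φ (φ.symm y) := by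
  rw [coeff, coeffAt]
  congr 1
  ext i : 1
  exact coordVec_eq_chartFrame hφ hy i

theorem VolumeForm.coeffAt_eq_det_mul (μ : VolumeForm k M) (hψ : ψ ∈ AT)
    {x : M} (hx' : x ∈ ψ.source) :
    μ.coeffAt φ x = (transDeriv φ ψ x).det * μ.coeffAt ψ x := by
  have := alternatingMap_comp_eq_det ((μ.form x).compLinearMap (chartFrame ψ x : Coord k →ₗ[ℝ] _))
    (transDeriv φ ψ x) fun i => EuclideanSpace.single i 1
  rw [coeffAt, coeffAt, ContinuousLinearMap.det]
  refine Eq.trans ?_ this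
  rw [AlternatingMap.compLinearMap_apply]
  congr 1
  ext i : 1
  exact (chartFrame_transDeriv hψ hx' _).symm

/-- The chart frame is a basis, and a form of top degree vanishing on a basis is zero. -/
theorem VolumeForm.coeffAt_ne_zero (μ : VolumeForm k M) (hφ : φ ∈ AT) {x : M}
    (hx : x ∈ φ.source) : μ.coeffAt φ x ≠ 0 := by
  intro h0
  apply μ.ne_zero x
  obtain ⟨e, he⟩ := exists_equiv_chartDeriv hφ hx
  let b := (EuclideanSpace.basisFun (Fin (k + 1)) ℝ).toBasis.map e.symm.toLinearEquiv
  rw [(μ.form x).eq_smul_basis_det b]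
  have : μ.form x b = 0 := by
    rw [← h0, coeffAt]
    congr 1
    ext i : 1
    rw [chartFrame, ← he, ContinuousLinearMap.inverse_equiv]
    simp [b]
  rw [this, zero_smul]

theorem VolumeForm.contDiffOn_coeff (μ : VolumeForm k M) (hφ : φ ∈ AT) :
    ContDiffOn ℝ ∞ (μ.coeff φ) φ.target := μ.smooth φ hφ

theorem VolumeForm.coeff_ne_zero (μ : VolumeForm k M) (hφ : φ ∈ AT) {y : Coord k}
    (hy : y ∈ φ.target) : μ.coeff φ y ≠ 0 := by
  rw [μ.coeff_eq hφ hy]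
  exact μ.coeffAt_ne_zero hφ (φ.map_target hy)

end Charts

/-! ### Charts adapted to the hypersurface, and its two sides -/

section Adapted

variable {k : ℕ} {M : Type*} [TopologicalSpace M] [ChartedSpace (Coord k) M]
  [IsManifold (𝓡 (k + 1)) ∞ M]

local notation "AT" => IsManifold.maximalAtlas (𝓡 (k + 1)) ∞ M

variable {S : Sheet k M} {φ ψ : OpenPartialHomeomorph M (Coord k)}

theorem trans_mem_maximalAtlas (hφ : φ ∈ AT) {τ : OpenPartialHomeomorph (Coord k) (Coord k)}
    (hτ : τ ∈ contDiffGroupoid ∞ (𝓡 (k + 1))) : φ.trans τ ∈ AT := by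
  refine (mem_maximalAtlas_iff (G := contDiffGroupoid ∞ (𝓡 (k + 1)))).2 fun e he => ⟨?_, ?_⟩
  · rw [OpenPartialHomeomorph.trans_symm_eq_symm_trans_symm, OpenPartialHomeomorph.trans_assoc]
    exact (contDiffGroupoid ∞ (𝓡 (k + 1))).trans ((contDiffGroupoid ∞ (𝓡 (k + 1))).symm hτ)
      (((mem_maximalAtlas_iff (G := contDiffGroupoid ∞ (𝓡 (k + 1)))).1 hφ e he).1)
  · rw [← OpenPartialHomeomorph.trans_assoc]
    exact (contDiffGroupoid ∞ (𝓡 (k + 1))).trans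
      (((mem_maximalAtlas_iff (G := contDiffGroupoid ∞ (𝓡 (k + 1)))).1 hφ e he).2) hτ

theorem translation_mem_contDiffGroupoid (c : Coord k) :
    (Homeomorph.addRight c).toOpenPartialHomeomorph ∈ contDiffGroupoid ∞ (𝓡 (k + 1)) := by
  rw [contDiffGroupoid, mem_groupoid_of_pregroupoid]
  constructor
  · refine ContDiff.contDiffOn ?_
    exact contDiff_id.add contDiff_const
  · refine ContDiff.contDiffOn ?_
    exact contDiff_id.add contDiff_const

/-- Every point has a chart with values in a prescribed open half-space. -/
theorem exists_chart_halfSpace {U : Set M} (hU : IsOpen U) {p : M} (hp : p ∈ U) (ε : ℝ)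
    (hε : ε ≠ 0) : ∃ φ : OpenPartialHomeomorph M (Coord k), φ ∈ AT ∧ p ∈ φ.source ∧ φ.source ⊆ U ∧ ∀ x ∈ φ.source, 0 < ε * φ x 0 := by
  -- The translation moves `p` to the point with `y₀ = ε⁻¹` and other coordinates zero. There `ε y₀
  -- = 1`, so the required inequality survives on a neighbourhood, to which the chart is then
  -- restricted.
  have h0 := trans_mem_maximalAtlas
    (IsManifold.chart_mem_maximalAtlas (I := 𝓡 (k + 1)) (n := ∞) (H := Coord k) p)
    (translation_mem_contDiffGroupoid
      (EuclideanSpace.single 0 ε⁻¹ - chartAt (Coord k) p p : Coord k))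
  set φ₀ := (chartAt (Coord k) p).trans (Homeomorph.addRight
    (EuclideanSpace.single 0 ε⁻¹ - chartAt (Coord k) p p : Coord k)).toOpenPartialHomeomorph
    with hφ₀
  have hp0 : p ∈ φ₀.source := by simp [hφ₀]
  have hp1 : φ₀ p = EuclideanSpace.single 0 ε⁻¹ := by simp [hφ₀]
  have hV : IsOpen (U ∩ (φ₀.source ∩ φ₀ ⁻¹' {y | 0 < ε * y 0})) :=
    hU.inter (φ₀.isOpen_inter_preimage (isOpen_lt continuous_const (by fun_prop)))
  refine ⟨φ₀.restr _, restr_mem_maximalAtlas (contDiffGroupoid ∞ (𝓡 (k + 1))) h0 hV, ?_, ?_, ?_⟩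
  · rw [OpenPartialHomeomorph.restr_source' _ _ hV]
    refine ⟨hp0, hp, hp0, ?_⟩
    show 0 < ε * φ₀ p 0
    rw [hp1]
    simp [hε]
  · rw [OpenPartialHomeomorph.restr_source' _ _ hV]
    exact fun x hx => hx.2.1
  · rw [OpenPartialHomeomorph.restr_source' _ _ hV]
    exact fun x hx => hx.2.2.2

theorem Sheet.mem_Dp_or (S : Sheet k M) (x : M) : x ∈ S.Dp ∨ x ∈ S.Γ ∨ x ∈ S.Dm := by
  have : x ∈ S.Dp ∪ S.Γ ∪ S.Dm := S.cover ▸ mem_univ x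
  simpa [or_assoc] using this

/-- Away from `Γ`, being adapted only asks that `y₀` have the constant sign of the region, which a
translated chart provides. Hence adapted charts cover all of `M`, and not only a neighbourhood of
`Γ`. -/
theorem Sheet.exists_adaptedChart (S : Sheet k M) (p : M) :
    ∃ φ : OpenPartialHomeomorph M (Coord k), φ ∈ S.adaptedCharts ∧ p ∈ φ.source := by
  rcases S.mem_Dp_or p with hp | hp | hp
  · obtain ⟨φ, hφ, hpφ, hU, h⟩ := exists_chart_halfSpace (k := k) S.isOpen_Dp hp (-1) (by norm_num)
    refine ⟨φ, ⟨hφ, fun x hx => ?_⟩, hpφ⟩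
    have h1 := h x hx
    have h2 := hU hx
    have h3 := S.disjoint_Dp_Γ.notMem_of_mem_left h2
    have h4 := S.disjoint_Dp_Dm.notMem_of_mem_left h2
    simp only [h2, h3, h4, true_iff, false_iff]
    refine ⟨by linarith, by linarith, by linarith⟩
  · obtain ⟨φ, hφ, hpφ, h⟩ := S.exists_chart p hp
    exact ⟨φ, ⟨hφ, h⟩, hpφ⟩
  · obtain ⟨φ, hφ, hpφ, hU, h⟩ := exists_chart_halfSpace (k := k) S.isOpen_Dm hp 1 (by norm_num)
    refine ⟨φ, ⟨hφ, fun x hx => ?_⟩, hpφ⟩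
    have h1 := h x hx
    have h2 := hU hx
    have h3 := S.disjoint_Dm_Γ.notMem_of_mem_left h2
    have h4 := S.disjoint_Dp_Dm.notMem_of_mem_right h2
    simp only [h2, h3, h4, true_iff, false_iff]
    refine ⟨by linarith, by linarith, by linarith⟩

/-- The two sides of a sheet: `D` and `C` are given by `ε y₀ < 0` and `ε y₀ ≤ 0` in adapted
charts, where `ε = 1` for `D⁺` and `ε = -1` for `D⁻`. -/
structure Sheet.IsSide (S : Sheet k M) (ε : ℝ) (D C : Set M) : Prop where
  sign : ε = 1 ∨ ε = -1
  isOpen : IsOpen D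
  isClosed : IsClosed C
  mem_D : ∀ φ ∈ S.adaptedCharts, ∀ x ∈ φ.source, (x ∈ D ↔ ε * φ x 0 < 0)
  mem_C : ∀ φ ∈ S.adaptedCharts, ∀ x ∈ φ.source, (x ∈ C ↔ ε * φ x 0 ≤ 0)

theorem Sheet.Cp_eq (S : Sheet k M) : S.Cp = S.Dmᶜ := by
  ext x
  have h2 := S.disjoint_Dm_Γ.notMem_of_mem_left (a := x)
  have h3 := S.disjoint_Dp_Dm.notMem_of_mem_left (a := x)
  have := S.mem_Dp_or x
  simp only [Sheet.Cp, mem_union, mem_compl_iff]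
  tauto

theorem Sheet.Cm_eq (S : Sheet k M) : S.Cm = S.Dpᶜ := by
  ext x
  have h2 := S.disjoint_Dp_Γ.notMem_of_mem_left (a := x)
  have h3 := S.disjoint_Dp_Dm.notMem_of_mem_left (a := x)
  have := S.mem_Dp_or x
  simp only [Sheet.Cm, mem_union, mem_compl_iff]
  tauto

theorem Sheet.isSide_pos (S : Sheet k M) : S.IsSide 1 S.Dp S.Cp where
  sign := Or.inl rfl
  isOpen := S.isOpen_Dp
  isClosed := by rw [S.Cp_eq]; exact S.isOpen_Dm.isClosed_compl
  mem_D φ hφ x hx := by rw [(hφ.2 x hx).1, one_mul]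
  mem_C φ hφ x hx := by rw [S.Cp_eq, mem_compl_iff, (hφ.2 x hx).2.2, one_mul, not_lt]

theorem Sheet.isSide_neg (S : Sheet k M) : S.IsSide (-1) S.Dm S.Cm where
  sign := Or.inr rfl
  isOpen := S.isOpen_Dm
  isClosed := by rw [S.Cm_eq]; exact S.isOpen_Dp.isClosed_compl
  mem_D φ hφ x hx := by rw [(hφ.2 x hx).2.2]; constructor <;> intro <;> linarith
  mem_C φ hφ x hx := by
    rw [S.Cm_eq, mem_compl_iff, (hφ.2 x hx).1]; constructor <;> intro <;> linarith

theorem Sheet.IsSide.subset {ε : ℝ} {D C : Set M} (h : S.IsSide ε D C) : D ⊆ C := by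
  intro x hx
  obtain ⟨φ, hφ, hxφ⟩ := S.exists_adaptedChart x
  exact (h.mem_C φ hφ x hxφ).2 ((h.mem_D φ hφ x hxφ).1 hx).le

theorem Sheet.IsSide.Γ_subset {ε : ℝ} {D C : Set M} (h : S.IsSide ε D C) : S.Γ ⊆ C := by
  intro x hx
  obtain ⟨φ, hφ, hxφ⟩ := S.exists_adaptedChart x
  refine (h.mem_C φ hφ x hxφ).2 ?_
  rw [((hφ.2 x hxφ).2.1).1 hx, mul_zero]

theorem uniqueDiffOn_halfSpace {ε : ℝ} (hε : ε = 1 ∨ ε = -1) :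
    UniqueDiffOn ℝ {y : Coord k | ε * y 0 ≤ 0} := by
  refine uniqueDiffOn_convex ?_ ?_
  · intro a ha b hb s t hs ht hst
    simp only [mem_ofPred_eq, PiLp.add_apply, PiLp.smul_apply, smul_eq_mul] at *
    nlinarith
  · refine ⟨EuclideanSpace.single 0 (-ε), ?_⟩
    have ho : IsOpen {y : Coord k | ε * y 0 < 0} := isOpen_lt (by fun_prop) continuous_const
    refine interior_mono (s := {y : Coord k | ε * y 0 < 0}) ?_ ?_
    · exact fun y (hy : ε * y 0 < 0) => le_of_lt hy
    rw [ho.interior_eq]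
    rcases hε with rfl | rfl <;> simp

theorem Sheet.IsSide.uniqueDiffOn {ε : ℝ} {D C : Set M} (h : S.IsSide ε D C) :
    UniqueDiffOn ℝ (φ.target ∩ {y : Coord k | ε * y 0 ≤ 0}) := by
  rw [inter_comm]
  exact (uniqueDiffOn_halfSpace h.sign).inter φ.open_target

/-- In an adapted chart `C` is a closed half-space, which is convex with nonempty interior.
One-sided derivatives along `Γ` are therefore well defined, and smoothness up to `Γ` passes to them.
-/
theorem Sheet.IsSide.uniqueMDiffOn {ε : ℝ} {D C : Set M} (h : S.IsSide ε D C) :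
    UniqueMDiffOn (𝓡 (k + 1)) C := by
  intro x hx
  obtain ⟨φ, hφ, hxφ⟩ := S.exists_adaptedChart x
  have h1 := (uniqueDiffOn_halfSpace (k := k) h.sign).uniqueMDiffOn
  have h2 := h1.uniqueMDiffOn_preimage (mdifferentiable_chart_of_mem hφ.1).symm
  have h3 := h2 x ⟨hxφ, (h.mem_C φ hφ x hxφ).1 hx⟩
  exact h3.mono fun z hz => (h.mem_C φ hφ z hz.1).2 hz.2

/-- The projection along `y₀` onto the hyperplane `y₀ = 0`. -/
def tailL (k : ℕ) : Coord k →L[ℝ] EuclideanSpace ℝ (Fin k) :=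
  LinearMap.toContinuousLinearMap
    { toFun := fun y => WithLp.toLp 2 fun i => y i.succ
      map_add' := fun _ _ => rfl
      map_smul' := fun _ _ => rfl }

/-- The inclusion of the hyperplane `y₀ = 0` as a linear map. -/
def inclL (k : ℕ) : EuclideanSpace ℝ (Fin k) →L[ℝ] Coord k :=
  LinearMap.toContinuousLinearMap
    { toFun := incl
      map_add' := fun a b => by
        ext i; refine Fin.cases ?_ (fun j => ?_) i <;> simp [incl]
      map_smul' := fun c a => by
        ext i; refine Fin.cases ?_ (fun j => ?_) i <;> simp [incl] }

@[simp] theorem inclL_apply (y : EuclideanSpace ℝ (Fin k)) : inclL k y = incl y := rfl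

@[simp] theorem incl_zero_coord (y : EuclideanSpace ℝ (Fin k)) : incl y 0 = 0 := rfl

@[simp] theorem incl_succ (y : EuclideanSpace ℝ (Fin k)) (i : Fin k) : incl y i.succ = y i := rfl

@[simp] theorem tailL_apply (y : Coord k) (i : Fin k) : tailL k y i = y i.succ := rfl

@[simp] theorem tailL_incl (y : EuclideanSpace ℝ (Fin k)) : tailL k (incl y) = y := by
  ext i; simp

theorem incl_tailL {y : Coord k} (h : y 0 = 0) : incl (tailL k y) = y := by
  ext i; refine Fin.cases ?_ (fun j => ?_) i <;> simp [h]

theorem incl_single (i : Fin k) :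
    incl (EuclideanSpace.single i (1 : ℝ)) = EuclideanSpace.single i.succ 1 := by
  ext j; refine Fin.cases ?_ (fun j => ?_) j
  · simp
  · simp

theorem continuous_incl : Continuous (incl (k := k)) := (inclL k).continuous

theorem isOpen_sliceTarget : IsOpen (sliceTarget φ) := φ.open_target.preimage continuous_incl

theorem slice_mem_source {y : EuclideanSpace ℝ (Fin k)} (hy : y ∈ sliceTarget φ) :
    φ.symm (incl y) ∈ φ.source := φ.map_target hy

theorem slice_mem_Γ (hφ : φ ∈ S.adaptedCharts) {y : EuclideanSpace ℝ (Fin k)}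
    (hy : y ∈ sliceTarget φ) : φ.symm (incl y) ∈ S.Γ := by
  rw [(hφ.2 _ (slice_mem_source hy)).2.1, φ.right_inv hy, incl_zero_coord]

theorem incl_tailL_chart (hφ : φ ∈ S.adaptedCharts) {x : M} (hx : x ∈ φ.source) (hΓ : x ∈ S.Γ) :
    incl (tailL k (φ x)) = φ x := incl_tailL (((hφ.2 x hx).2.1).1 hΓ)

theorem tailL_mem_sliceTarget (hφ : φ ∈ S.adaptedCharts) {x : M} (hx : x ∈ φ.source)
    (hΓ : x ∈ S.Γ) : tailL k (φ x) ∈ sliceTarget φ := by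
  rw [sliceTarget, mem_ofPred_eq, incl_tailL_chart hφ hx hΓ]
  exact φ.map_source hx

theorem continuousOn_slice : ContinuousOn (fun y => φ.symm (incl y)) (sliceTarget φ) :=
  φ.continuousOn_symm.comp continuous_incl.continuousOn fun _ hy => hy

/-- Tangent vectors of `Γ` have vanishing component `0` in adapted charts, and conversely. -/
theorem Sheet.mem_tangent_iff (hφ : φ ∈ S.adaptedCharts) {x : M} (hx : x ∈ φ.source)
    (hΓ : x ∈ S.Γ) {w : TangentSpace (𝓡 (k + 1)) x} :
    w ∈ S.tangent x ↔ chartDeriv φ x w 0 = 0 := by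
  refine ⟨fun h => h φ hφ hx, fun h => ?_⟩
  have h1 : w = ∑ j : Fin k, chartDeriv φ x w j.succ •
      chartFrame φ x (EuclideanSpace.single j.succ 1) := by
    rw [← chartFrame_chartDeriv hφ.1 hx w]
    simp_rw [← map_smul, ← map_sum, chartDeriv_chartFrame hφ.1 hx]
    congr 1
    ext i
    refine Fin.cases ?_ (fun j => ?_) i
    · simpa using h
    · simp [Finset.sum_apply, Pi.single_apply]
  rw [h1]
  refine Submodule.sum_mem _ fun j _ => Submodule.smul_mem _ _ ?_
  have h2 := S.coordVec_mem_tangent hφ (tailL_mem_sliceTarget hφ hx hΓ) j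
  rw [coordVec_eq_chartFrame hφ.1 (tailL_mem_sliceTarget hφ hx hΓ)] at h2
  rw [incl_tailL_chart hφ hx hΓ] at h2
  rwa [φ.left_inv hx] at h2

theorem chartFrame_mem_tangent (hφ : φ ∈ S.adaptedCharts) {x : M} (hx : x ∈ φ.source)
    (hΓ : x ∈ S.Γ) (w : EuclideanSpace ℝ (Fin k)) : chartFrame φ x (incl w) ∈ S.tangent x := by
  rw [Sheet.mem_tangent_iff hφ hx hΓ, chartDeriv_chartFrame hφ.1 hx]
  rfl

end Adapted

/-! ### Measures given by a density in a parametrization, and suprema of them -/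

section ParamMeasure

variable {n : ℕ} {M : Type*} [TopologicalSpace M] [MeasurableSpace M] [BorelSpace M]

local notation "E" => EuclideanSpace ℝ (Fin n)

/-- The measure with density `c` in the parametrization `a` on `s`. -/
def paramMeasure (s : Set E) (c : E → ℝ) (a : E → M) : Measure M :=
  ((volume.restrict s).withDensity fun y => ENNReal.ofReal (c y)).map a

theorem measurableSet_inter_preimage_of_continuousOn {s : Set E} (hs : MeasurableSet s) {a : E → M}
    (ha : ContinuousOn a s) {B : Set M} (hB : MeasurableSet B) :
    MeasurableSet (s ∩ a ⁻¹' B) := by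
  have h := (continuousOn_iff_continuous_domRestrict.1 ha).measurable hB
  convert hs.subtype_image h using 1
  ext y
  simp [and_comm]

theorem aemeasurable_param {s : Set E} (hs : MeasurableSet s) {a : E → M} (ha : ContinuousOn a s)
    (c : E → ℝ) :
    AEMeasurable a ((volume.restrict s).withDensity fun y => ENNReal.ofReal (c y)) :=
  (ha.aemeasurable hs).mono_ac (withDensity_absolutelyContinuous _ _)

theorem paramMeasure_apply {s : Set E} (hs : MeasurableSet s) {a : E → M} (ha : ContinuousOn a s)
    (c : E → ℝ) {B : Set M} (hB : MeasurableSet B) :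
    paramMeasure s c a B = ∫⁻ y in s ∩ a ⁻¹' B, ENNReal.ofReal (c y) := by
  rw [paramMeasure, Measure.map_apply_of_aemeasurable (aemeasurable_param hs ha c) hB,
    withDensity_apply', Measure.restrict_restrict' hs, inter_comm]

/-- Change of variables along `t`: the part of the first parametrization lying over `B ∩ U` is
mapped injectively into the part of the second lying over `B`. An inequality suffices, since it will
be available for each ordered pair of charts. -/
theorem paramMeasure_restrict_le {s₁ s₂ : Set E} (hs₁ : MeasurableSet s₁) (hs₂ : MeasurableSet s₂)
    {a₁ a₂ : E → M} (ha₁ : ContinuousOn a₁ s₁) (ha₂ : ContinuousOn a₂ s₂) {c₁ c₂ : E → ℝ}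
    {U : Set M} (hU : MeasurableSet U) (t : E → E) (t' : E → E →L[ℝ] E)
    (ht : ∀ y ∈ s₁, a₁ y ∈ U → HasFDerivAt t (t' y) y ∧ t y ∈ s₂ ∧ a₂ (t y) = a₁ y ∧
      c₁ y = |(t' y).det| * c₂ (t y))
    (hinj : InjOn t (s₁ ∩ a₁ ⁻¹' U)) :
    (paramMeasure s₁ c₁ a₁).restrict U ≤ paramMeasure s₂ c₂ a₂ := by
  refine Measure.le_iff.2 fun B hB => ?_
  have hm := measurableSet_inter_preimage_of_continuousOn hs₁ ha₁ (hB.inter hU)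
  rw [Measure.restrict_apply hB, paramMeasure_apply hs₁ ha₁ _ (hB.inter hU),
    paramMeasure_apply hs₂ ha₂ _ hB]
  have hd : ∀ y ∈ s₁ ∩ a₁ ⁻¹' (B ∩ U),
      HasFDerivWithinAt t (t' y) (s₁ ∩ a₁ ⁻¹' (B ∩ U)) y :=
    fun y hy => (ht y hy.1 hy.2.2).1.hasFDerivWithinAt
  have hi : InjOn t (s₁ ∩ a₁ ⁻¹' (B ∩ U)) := hinj.mono (inter_subset_inter_right _ (preimage_mono inter_subset_right))
  have key := lintegral_image_eq_lintegral_abs_det_fderiv_mul volume hm hd hi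
    fun z => ENNReal.ofReal (c₂ z)
  calc _ = ∫⁻ y in s₁ ∩ a₁ ⁻¹' (B ∩ U), ENNReal.ofReal |(t' y).det| * ENNReal.ofReal (c₂ (t y)) := by
        refine setLIntegral_congr_fun hm fun y hy => ?_
        simp only [(ht y hy.1 hy.2.2).2.2.2, ENNReal.ofReal_mul (abs_nonneg _)]
    _ = _ := key.symm
    _ ≤ _ := by
        refine lintegral_mono_set ?_
        rintro _ ⟨y, hy, rfl⟩
        obtain ⟨-, h2, h3, -⟩ := ht y hy.1 hy.2.2
        exact ⟨h2, by rw [mem_preimage, h3]; exact hy.2.1⟩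

theorem lintegral_paramMeasure {s : Set E} (hs : MeasurableSet s) {a : E → M}
    (ha : ContinuousOn a s) {c : E → ℝ} (hc : ContinuousOn c s) {g : M → ENNReal}
    (hg : Measurable g) :
    ∫⁻ x, g x ∂paramMeasure s c a = ∫⁻ y in s, ENNReal.ofReal (c y) * g (a y) := by
  rw [paramMeasure, lintegral_map' hg.aemeasurable (aemeasurable_param hs ha c),
    lintegral_withDensity_eq_lintegral_mul₀ ?_ ?_]
  · rfl
  · exact (hc.aemeasurable hs).ennreal_ofReal
  · exact hg.comp_aemeasurable (ha.aemeasurable hs)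

/-- A supremum of measures is not computed set by set. Instead a single measure dominating all the
`ν j` is exhibited: `ν i` plus an infinite measure living off `U i`, which disappears on restriction
to `U i`. -/
theorem restrict_iSup_eq_of_restrict_le {ι : Type*} {I : Set ι} {ν : ι → Measure M} {U : ι → Set M}
    (hU : ∀ i, MeasurableSet (U i)) (hν : ∀ i ∈ I, ν i (U i)ᶜ = 0)
    (hle : ∀ i ∈ I, ∀ j ∈ I, (ν j).restrict (U i) ≤ ν i) {i : ι} (hi : i ∈ I) :
    (⨆ j ∈ I, ν j).restrict (U i) = ν i := by
  apply le_antisymm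
  · have h1 : (⨆ j ∈ I, ν j) ≤ ν i + (⊤ : Measure M).restrict (U i)ᶜ := by
      refine iSup₂_le fun j hj => ?_
      rw [← Measure.restrict_add_restrict_compl (μ := ν j) (hU i)]
      exact add_le_add (hle i hi j hj) (Measure.restrict_mono le_rfl le_top)
    refine (Measure.restrict_mono le_rfl h1).trans ?_
    rw [Measure.restrict_add, Measure.restrict_restrict (hU i), inter_compl_self,
      Measure.restrict_empty, add_zero]
    exact Measure.restrict_le_self
  · calc ν i = (ν i).restrict (U i) := by
          rw [Measure.restrict_eq_self_of_ae_mem]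
          exact measure_eq_zero_iff_ae_notMem.1 (hν i hi) |>.mono fun x hx => by simpa using hx
      _ ≤ _ := Measure.restrict_mono le_rfl (le_iSup₂ (f := fun j (_ : j ∈ I) => ν j) i hi)

end ParamMeasure

/-! ### The measures on `M` and `Γ` in a single chart; the boundary orientation -/

section Measures

variable {k : ℕ} {M : Type*} [TopologicalSpace M] [ChartedSpace (Coord k) M]
  [IsManifold (𝓡 (k + 1)) ∞ M] [MeasurableSpace M] [BorelSpace M]

local notation "AT" => IsManifold.maximalAtlas (𝓡 (k + 1)) ∞ M

variable {S : Sheet k M} {φ ψ : OpenPartialHomeomorph M (Coord k)}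

theorem VolumeForm.abs_coeff_eq (μ : VolumeForm k M) (hφ : φ ∈ AT) (hψ : ψ ∈ AT) {y : Coord k}
    (hy : y ∈ φ.target) (hy' : φ.symm y ∈ ψ.source) :
    |μ.coeff φ y| = |(transDeriv φ ψ (φ.symm y)).det| * |μ.coeff ψ (ψ (φ.symm y))| := by
  rw [μ.coeff_eq hφ hy, μ.coeff_eq hψ (ψ.map_source hy'), ψ.left_inv hy',
    μ.coeffAt_eq_det_mul hψ hy', abs_mul]

theorem injOn_transition : InjOn (fun y => ψ (φ.symm y)) (φ.target ∩ φ.symm ⁻¹' ψ.source) := by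
  intro y hy z hz h
  exact φ.symm.injOn hy.1 hz.1 (ψ.injOn hy.2 hz.2 h)

theorem VolumeForm.restrict_measure (μ : VolumeForm k M) (hφ : φ ∈ AT) :
    μ.measure.restrict φ.source = paramMeasure φ.target (fun y => |μ.coeff φ y|) φ.symm := by
  refine restrict_iSup_eq_of_restrict_le (I := AT)
    (ν := fun φ => paramMeasure φ.target (fun y => |μ.coeff φ y|) φ.symm)
    (U := fun φ => φ.source) (fun i => i.open_source.measurableSet) (fun φ _ => ?_)
    (fun ψ hψ φ hφ => ?_) hφ
  · rw [paramMeasure_apply φ.open_target.measurableSet φ.continuousOn_symm _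
      φ.open_source.measurableSet.compl]
    convert setLIntegral_empty _
    ext y
    simpa using fun hy => φ.map_target hy
  · exact paramMeasure_restrict_le φ.open_target.measurableSet ψ.open_target.measurableSet
      φ.continuousOn_symm ψ.continuousOn_symm ψ.open_source.measurableSet
      (fun y => ψ (φ.symm y)) (fun y => transDeriv φ ψ (φ.symm y))
      (fun y hy hy' => ⟨hasFDerivAt_transition hφ hψ hy hy', ψ.map_source hy', ψ.left_inv hy',
        μ.abs_coeff_eq hφ hψ hy hy'⟩) injOn_transition

/-- The transition map between slices. -/
def sliceTrans (φ ψ : OpenPartialHomeomorph M (Coord k)) (x : M) :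
    EuclideanSpace ℝ (Fin k) →L[ℝ] EuclideanSpace ℝ (Fin k) :=
  (tailL k).comp ((transDeriv φ ψ x).comp (inclL k))

theorem transDeriv_incl_zero (hφ : φ ∈ S.adaptedCharts) (hψ : ψ ∈ S.adaptedCharts) {x : M}
    (hx : x ∈ φ.source) (hx' : x ∈ ψ.source) (hΓ : x ∈ S.Γ) (w : EuclideanSpace ℝ (Fin k)) :
    transDeriv φ ψ x (incl w) 0 = 0 :=
  (Sheet.mem_tangent_iff hψ hx' hΓ).1 (chartFrame_mem_tangent hφ hx hΓ w)

theorem incl_sliceTrans (hφ : φ ∈ S.adaptedCharts) (hψ : ψ ∈ S.adaptedCharts) {x : M}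
    (hx : x ∈ φ.source) (hx' : x ∈ ψ.source) (hΓ : x ∈ S.Γ) (w : EuclideanSpace ℝ (Fin k)) :
    incl (sliceTrans φ ψ x w) = transDeriv φ ψ x (incl w) :=
  incl_tailL (transDeriv_incl_zero hφ hψ hx hx' hΓ w)

/-- Transition maps of adapted charts preserve `y₀ = 0`, so at points of `Γ` row `0` of the Jacobian
vanishes except for its first entry. Expand along that row. -/
theorem det_transDeriv_eq (hφ : φ ∈ S.adaptedCharts) (hψ : ψ ∈ S.adaptedCharts) {x : M}
    (hx : x ∈ φ.source) (hx' : x ∈ ψ.source) (hΓ : x ∈ S.Γ) :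
    (transDeriv φ ψ x).det =
      transDeriv φ ψ x (EuclideanSpace.single 0 1) 0 * (sliceTrans φ ψ x).det := by
  rw [ContinuousLinearMap.det, ContinuousLinearMap.det,
    ← LinearMap.det_toMatrix (EuclideanSpace.basisFun (Fin (k + 1)) ℝ).toBasis,
    ← LinearMap.det_toMatrix (EuclideanSpace.basisFun (Fin k) ℝ).toBasis,
    Matrix.det_succ_row_zero, Fin.sum_univ_succ, Finset.sum_eq_zero]
  · simp only [LinearMap.toMatrix_apply]
    simp
    left
    rw [← LinearMap.det_toMatrix (EuclideanSpace.basisFun (Fin k) ℝ).toBasis]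
    congr 1
    ext i j
    simp [LinearMap.toMatrix_apply, sliceTrans, incl_single]
  · intro j _
    have := transDeriv_incl_zero hφ hψ hx hx' hΓ (EuclideanSpace.single j 1)
    rw [incl_single] at this
    simp [LinearMap.toMatrix_apply, this]

/-- The entry is nonzero as a factor of a nonzero determinant. It is nonnegative as a limit of
difference quotients at `t > 0`, because both charts give `D⁻` as the side `y₀ > 0`. -/
theorem transDeriv_zero_pos (hφ : φ ∈ S.adaptedCharts) (hψ : ψ ∈ S.adaptedCharts) {x : M}
    (hx : x ∈ φ.source) (hx' : x ∈ ψ.source) (hΓ : x ∈ S.Γ) :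
    0 < transDeriv φ ψ x (EuclideanSpace.single 0 1) 0 := by
  have hne : transDeriv φ ψ x (EuclideanSpace.single 0 1) 0 ≠ 0 := by
    intro h0
    apply det_transDeriv_ne_zero hφ.1 hψ.1 hx hx'
    rw [det_transDeriv_eq hφ hψ hx hx' hΓ, h0, zero_mul]
  refine lt_of_le_of_ne ?_ hne.symm
  set e : Coord k := EuclideanSpace.single 0 (1 : ℝ)
  have hT : HasFDerivAt (fun z => ψ (φ.symm z)) (transDeriv φ ψ x) (φ x) := by
    have := hasFDerivAt_transition hφ.1 hψ.1 (φ.map_source hx) (by rwa [φ.left_inv hx])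
    rwa [φ.left_inv hx] at this
  have hl : HasDerivAt (fun t : ℝ => φ x + t • e) e 0 := by
    simpa using ((hasDerivAt_id (0 : ℝ)).smul_const e).const_add (φ x)
  have hl0 : φ x + (0 : ℝ) • e = φ x := by simp
  have h5 := hT.comp_hasDerivAt_of_eq (0 : ℝ) hl hl0.symm
  have h6 := (EuclideanSpace.proj (0 : Fin (k + 1)) : Coord k →L[ℝ] ℝ).hasFDerivAt.comp_hasDerivAt
    (0 : ℝ) h5
  have h7 := h6.hasDerivWithinAt (s := Ioi 0)
  rw [hasDerivWithinAt_iff_tendsto_slope' (by simp)] at h7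
  refine ge_of_tendsto h7 ?_
  have hc : ContinuousAt (fun t : ℝ => φ x + t • e) 0 := hl.continuousAt
  have ht : ∀ᶠ t in 𝓝 (0 : ℝ), φ x + t • e ∈ φ.target :=
    hc.eventually_mem (by rw [hl0]; exact φ.open_target.mem_nhds (φ.map_source hx))
  have hs : ∀ᶠ t in 𝓝 (0 : ℝ), φ.symm (φ x + t • e) ∈ ψ.source := by
    refine (ContinuousAt.comp (f := fun t : ℝ => φ x + t • e) (g := φ.symm) ?_ hc).eventually_mem ?_
    · rw [hl0]; exact φ.continuousAt_symm (φ.map_source hx)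
    · simp only [Function.comp, hl0, φ.left_inv hx]; exact ψ.open_source.mem_nhds hx'
  filter_upwards [nhdsWithin_le_nhds ht, nhdsWithin_le_nhds hs, self_mem_nhdsWithin]
    with t ht hs ht0
  have hm := φ.map_target ht
  have hx0 : φ x 0 = 0 := ((hφ.2 x hx).2.1).1 hΓ
  have hx0' : ψ x 0 = 0 := ((hψ.2 x hx').2.1).1 hΓ
  have h8 : 0 < ψ (φ.symm (φ x + t • e)) 0 := by
    rw [← (hψ.2 _ hs).2.2, (hφ.2 _ hm).2.2, φ.right_inv ht]
    simpa [e, hx0] using ht0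
  have h9 : ψ (φ.symm (φ x + (0 : ℝ) • e)) 0 = 0 := by rw [hl0, φ.left_inv hx, hx0']
  rw [slope_def_field]
  show 0 ≤ (ψ (φ.symm (φ x + t • e)) 0 - ψ (φ.symm (φ x + (0 : ℝ) • e)) 0) / (t - 0)
  rw [h9, sub_zero, sub_zero]
  exact div_nonneg h8.le (le_of_lt ht0)

/-- The frame of a chart along the hyperplane `Γ`. -/
def tangentFrame (hφ : φ ∈ S.adaptedCharts) {x : M} (hx : x ∈ φ.source) (hΓ : x ∈ S.Γ) :
    EuclideanSpace ℝ (Fin k) →ₗ[ℝ] S.tangent x :=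
  LinearMap.codRestrict (S.tangent x)
    ((chartFrame φ x : Coord k →ₗ[ℝ] _) ∘ₗ (inclL k : _ →ₗ[ℝ] Coord k))
    fun w => chartFrame_mem_tangent hφ hx hΓ w

theorem Sheet.GammaForm.coeff_eq (ξ : S.GammaForm) (hφ : φ ∈ S.adaptedCharts)
    {y : EuclideanSpace ℝ (Fin k)} (hy : y ∈ sliceTarget φ) :
    Sheet.GammaForm.coeff ξ φ y = ξ (φ.symm (incl y)) fun j =>
      tangentFrame hφ (slice_mem_source hy) (slice_mem_Γ hφ hy) (EuclideanSpace.single j 1) := by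
  rw [Sheet.GammaForm.coeff, dif_pos ⟨hφ, hy⟩]
  congr 1
  ext j : 1
  apply Subtype.ext
  refine (coordVec_eq_chartFrame hφ.1 hy _).trans ?_
  rw [← incl_single]
  rfl

theorem tangentFrame_sliceTrans (hφ : φ ∈ S.adaptedCharts) (hψ : ψ ∈ S.adaptedCharts) {x : M}
    (hx : x ∈ φ.source) (hx' : x ∈ ψ.source) (hΓ : x ∈ S.Γ) (w : EuclideanSpace ℝ (Fin k)) :
    tangentFrame hψ hx' hΓ (sliceTrans φ ψ x w) = tangentFrame hφ hx hΓ w := by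
  apply Subtype.ext
  show chartFrame ψ x (incl (sliceTrans φ ψ x w)) = chartFrame φ x (incl w)
  rw [incl_sliceTrans hφ hψ hx hx' hΓ, chartFrame_transDeriv hψ.1 hx']

theorem incl_slice_transition (hψ : ψ ∈ S.adaptedCharts) (hφ : φ ∈ S.adaptedCharts)
    {y : EuclideanSpace ℝ (Fin k)} (hy : y ∈ sliceTarget φ) (hy' : φ.symm (incl y) ∈ ψ.source) :
    incl (tailL k (ψ (φ.symm (incl y)))) = ψ (φ.symm (incl y)) :=
  incl_tailL_chart hψ hy' (slice_mem_Γ hφ hy)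

/-- The value of `ξ` on the frame changes by the determinant of the slice transition. The sign of
`μ` changes by the sign of the full determinant, which is the sign of the slice determinant since
the normal entry is positive. The product thus changes by an absolute value, as a density must. -/
theorem sign_mul_tangentFrame (μ : VolumeForm k M) (ξ : S.GammaForm)
    (hφ : φ ∈ S.adaptedCharts) (hψ : ψ ∈ S.adaptedCharts) {x : M}
    (hx : x ∈ φ.source) (hx' : x ∈ ψ.source) (hΓ : x ∈ S.Γ) :
    (Real.sign (μ.coeffAt φ x) * ξ x fun j => tangentFrame hφ hx hΓ (EuclideanSpace.single j 1)) =
      |(sliceTrans φ ψ x).det| * (Real.sign (μ.coeffAt ψ x) *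
        ξ x fun j => tangentFrame hψ hx' hΓ (EuclideanSpace.single j 1)) := by
  have h4 := alternatingMap_comp_eq_det ((ξ x).compLinearMap (tangentFrame hψ hx' hΓ))
    (sliceTrans φ ψ x) fun j => EuclideanSpace.single j 1
  simp only [AlternatingMap.compLinearMap_apply] at h4
  have h5 : (ξ x fun j => tangentFrame hφ hx hΓ (EuclideanSpace.single j 1)) =
      (sliceTrans φ ψ x).det *
        ξ x fun j => tangentFrame hψ hx' hΓ (EuclideanSpace.single j 1) := by
    refine Eq.trans ?_ h4
    congr 1
    ext j : 1
    exact (tangentFrame_sliceTrans hφ hψ hx hx' hΓ _).symm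
  have h6 : ∀ a : ℝ, Real.sign a * a = |a| := fun a => by
    rcases lt_trichotomy a 0 with h | rfl | h
    · rw [Real.sign_of_neg h, abs_of_neg h, neg_one_mul]
    · simp
    · rw [Real.sign_of_pos h, abs_of_pos h, one_mul]
  have h7 : ∀ a b : ℝ, Real.sign (a * b) = Real.sign a * Real.sign b := fun a b => by
    rcases lt_trichotomy a 0 with ha | rfl | ha <;> rcases lt_trichotomy b 0 with hb | rfl | hb <;>
      simp [Real.sign_of_neg, Real.sign_of_pos, *, mul_pos_of_neg_of_neg, mul_neg_of_neg_of_pos,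
        mul_neg_of_pos_of_neg]
  rw [h5, μ.coeffAt_eq_det_mul hψ.1 hx', det_transDeriv_eq hφ hψ hx hx' hΓ, h7, h7,
    Real.sign_of_pos (transDeriv_zero_pos hφ hψ hx hx' hΓ), one_mul,
    ← h6 (sliceTrans φ ψ x).det]
  ring

theorem Sheet.GammaForm.orientedCoeff_eq (μ : VolumeForm k M) (ξ : S.GammaForm)
    (hφ : φ ∈ S.adaptedCharts) (hψ : ψ ∈ S.adaptedCharts) {y : EuclideanSpace ℝ (Fin k)}
    (hy : y ∈ sliceTarget φ) (hy' : φ.symm (incl y) ∈ ψ.source) :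
    Sheet.GammaForm.orientedCoeff μ ξ φ y = |(sliceTrans φ ψ (φ.symm (incl y))).det| *
      Sheet.GammaForm.orientedCoeff μ ξ ψ (tailL k (ψ (φ.symm (incl y)))) := by
  have hΓ := slice_mem_Γ hφ hy
  have hx := slice_mem_source hy
  have hy2 := tailL_mem_sliceTarget hψ hy' hΓ
  have e1 := incl_slice_transition hψ hφ hy hy'
  have e2 : ψ.symm (incl (tailL k (ψ (φ.symm (incl y))))) = φ.symm (incl y) := by
    rw [e1, ψ.left_inv hy']
  rw [orientedCoeff, orientedCoeff, coeff_eq ξ hφ hy, coeff_eq ξ hψ hy2, μ.coeff_eq hφ.1 hy,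
    μ.coeff_eq hψ.1 hy2]
  -- The type of the arguments of `ξ` depends on the point, so the equality `e2` is used by
  -- substituting a variable point instead of rewriting.
  have h3 : ∀ (x' : M) (hx' : x' ∈ ψ.source) (hΓ' : x' ∈ S.Γ), x' = φ.symm (incl y) →
      (ξ x' fun j => tangentFrame hψ hx' hΓ' (EuclideanSpace.single j 1)) =
      ξ (φ.symm (incl y)) fun j => tangentFrame hψ hy' hΓ (EuclideanSpace.single j 1) := by
    rintro x' hx' hΓ' rfl; rfl
  rw [h3 _ _ _ e2, e2]
  exact sign_mul_tangentFrame μ ξ hφ hψ hx hy' hΓ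

/-- The analogue on `Γ` of `VolumeForm.restrict_measure`, with slices in place of chart targets and
the oriented coefficient as density. -/
theorem restrict_posMeasure (μ : VolumeForm k M) (ξ : S.GammaForm) (hφ : φ ∈ S.adaptedCharts) :
    (Sheet.GammaForm.posMeasure μ ξ).restrict φ.source = paramMeasure (sliceTarget φ)
      (Sheet.GammaForm.orientedCoeff μ ξ φ) (fun y => φ.symm (incl y)) := by
  refine restrict_iSup_eq_of_restrict_le (I := S.adaptedCharts)
    (ν := fun φ => paramMeasure (sliceTarget φ)
      (Sheet.GammaForm.orientedCoeff μ ξ φ) (fun y => φ.symm (incl y)))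
    (U := fun φ => φ.source) (fun i => i.open_source.measurableSet) (fun φ _ => ?_)
    (fun ψ hψ φ hφ => ?_) hφ
  · rw [paramMeasure_apply isOpen_sliceTarget.measurableSet continuousOn_slice _
      φ.open_source.measurableSet.compl]
    convert setLIntegral_empty _
    ext y
    simpa using fun hy => slice_mem_source hy
  · refine paramMeasure_restrict_le isOpen_sliceTarget.measurableSet
      isOpen_sliceTarget.measurableSet continuousOn_slice continuousOn_slice
      ψ.open_source.measurableSet (fun y => tailL k (ψ (φ.symm (incl y))))
      (fun y => sliceTrans φ ψ (φ.symm (incl y))) (fun y hy hy' => ⟨?_, ?_, ?_, ?_⟩) ?_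
    · exact (tailL k).hasFDerivAt.comp y
        ((hasFDerivAt_transition hφ.1 hψ.1 hy hy').comp y (inclL k).hasFDerivAt)
    · exact tailL_mem_sliceTarget hψ hy' (slice_mem_Γ hφ hy)
    · simp only [incl_slice_transition hψ hφ hy hy', ψ.left_inv hy']
    · exact Sheet.GammaForm.orientedCoeff_eq μ ξ hφ hψ hy hy'
    · intro y hy z hz h
      have h1 := congrArg incl h
      simp only [incl_slice_transition hψ hφ hy.1 hy.2, incl_slice_transition hψ hφ hz.1 hz.2]
        at h1
      have h2 := injOn_transition ⟨hy.1, hy.2⟩ ⟨hz.1, hz.2⟩ h1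
      simpa using congrArg (tailL k) h2

end Measures

/-! ### The divergence theorem on a half-space of the coordinate space -/

section HalfSpace

variable {k : ℕ}

/-- The divergence theorem on a strip `a₀ < y₀ < b₀` for compactly supported fields. -/
theorem integral_divergence_strip {ε : ℝ} (hε : ε = 1 ∨ ε = -1)
    {F : Fin (k + 1) → Coord k → ℝ} (hF : ∀ i, ContDiffOn ℝ 1 (F i) {y | ε * y 0 ≤ 0})
    {K : Set (Coord k)} (hK : IsCompact K) (hFK : ∀ i, ∀ y ∉ K, F i y = 0)
    {R : ℝ} (hR : 0 < R) (hKR : ∀ y ∈ K, ∀ i, |y i| < R) {a₀ b₀ : ℝ} (hab : a₀ ≤ b₀)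
    (h1 : ∀ t ∈ Icc a₀ b₀, ε * t ≤ 0) (h2 : ∀ t ∈ Ioo a₀ b₀, ε * t < 0)
    (h3 : ∀ t, ε * t < 0 → |t| < R → t ∈ Ioo a₀ b₀) :
    (∫ y in {y : Coord k | ε * y 0 < 0},
        ∑ i, fderiv ℝ (F i) y (EuclideanSpace.single i 1)) =
      (∫ z, F 0 (WithLp.toLp 2 (Fin.cons b₀ z : Fin (k + 1) → ℝ))) -
        ∫ z, F 0 (WithLp.toLp 2 (Fin.cons a₀ z : Fin (k + 1) → ℝ)) := by
  set H : Set (Coord k) := {y | ε * y 0 ≤ 0} with hH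
  set g : Coord k → ℝ := fun y => ∑ i, fderiv ℝ (F i) y (EuclideanSpace.single i 1) with hg
  let A : Set (Coord k) := {y | ε * y 0 < 0}
  have hA : IsOpen A := isOpen_lt (by fun_prop) continuous_const
  let T : (Fin (k + 1) → ℝ) ≃L[ℝ] Coord k := (PiLp.continuousLinearEquiv 2 ℝ _).symm
  have hTi : ∀ i, T (Pi.single i 1) = EuclideanSpace.single i 1 := fun i => rfl
  have hTa : ∀ x i, T x i = x i := fun x i => rfl
  have hmp : MeasurePreserving (T : (Fin (k + 1) → ℝ) → Coord k) volume volume :=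
    PiLp.volume_preserving_toLp (Fin (k + 1))
  have hme : MeasurableEmbedding (T : (Fin (k + 1) → ℝ) → Coord k) :=
    T.toHomeomorph.measurableEmbedding
  set a : Fin (k + 1) → ℝ := Fin.cons a₀ fun _ => -R with ha
  set b : Fin (k + 1) → ℝ := Fin.cons b₀ fun _ => R with hb
  have hle : a ≤ b := fun i => by
    refine Fin.cases ?_ (fun j => ?_) i
    · simpa [a, b] using hab
    · simp only [a, b, Fin.cons_succ]; linarith
  have hbox : ∀ x ∈ Icc a b, T x ∈ H := fun x hx => h1 _ ⟨hx.1 0, hx.2 0⟩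
  have hIA : ∀ x ∈ Set.pi univ fun i => Ioo (a i) (b i), T x ∈ A := fun x hx => h2 _ (hx 0 trivial)
  have hzero : ∀ i, ∀ y, (∃ j, R ≤ |y j|) → F i y = 0 := by
    rintro i y ⟨j, hj⟩
    exact hFK i y fun hy => absurd (hKR y hy j) (not_lt.2 hj)
  have hgz : ∀ y, (∃ j, R ≤ |y j|) → g y = 0 := by
    rintro y ⟨j, hj⟩
    have hy : y ∉ K := fun hy => absurd (hKR y hy j) (not_lt.2 hj)
    refine Finset.sum_eq_zero fun i _ => ?_
    have : F i =ᶠ[𝓝 y] fun _ => 0 := by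
      filter_upwards [hK.isClosed.isOpen_compl.mem_nhds hy] with z hz using hFK i z hz
    rw [this.fderiv_eq]
    simp
  have hud : UniqueDiffOn ℝ H := uniqueDiffOn_halfSpace hε
  have hAH : A ⊆ H := fun y (hy : ε * y 0 < 0) => show ε * y 0 ≤ 0 from hy.le
  have hgc : ContinuousOn (fun y => ∑ i, fderivWithin ℝ (F i) H y (EuclideanSpace.single i 1)) H :=
    continuousOn_finsetSum _ fun i _ =>
      ((hF i).continuousOn_fderivWithin hud le_rfl).clm_apply continuousOn_const
  have hgw : ∀ y ∈ A, g y = ∑ i, fderivWithin ℝ (F i) H y (EuclideanSpace.single i 1) := by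
    intro y hy
    refine Finset.sum_congr rfl fun i _ => ?_
    rw [fderivWithin_of_mem_nhds (mem_of_superset (hA.mem_nhds hy) hAH)]
  have hIoo : (Set.pi univ fun i => Ioo (a i) (b i)) =ᵐ[volume] Icc a b :=
    Measure.univ_pi_Ioo_ae_eq_Icc
  have hIm : MeasurableSet (Set.pi univ fun i => Ioo (a i) (b i)) :=
    MeasurableSet.univ_pi fun i => measurableSet_Ioo
  -- The fields need not be differentiable across the face `y₀ = 0`. On the open box, which has full
  -- measure, `g` equals the sum of derivatives within `H`, and that sum is continuous on the
  -- compact box.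
  have hint : IntegrableOn (fun x => g (T x)) (Icc a b) := by
    refine IntegrableOn.congr_set_ae ?_ hIoo.symm
    have : IntegrableOn (fun x => ∑ i, fderivWithin ℝ (F i) H (T x) (EuclideanSpace.single i 1))
        (Icc a b) :=
      (hgc.comp T.continuous.continuousOn hbox).integrableOn_compact isCompact_Icc
    refine ((this.congr_set_ae hIoo).congr_fun ?_ hIm)
    exact fun x hx => (hgw _ (hIA x hx)).symm
  have hdiv := integral_divergence_of_hasFDerivAt_off_countable' a b hle (fun i x => F i (T x))
    (fun i x => (fderiv ℝ (F i) (T x)).comp (T : (Fin (k + 1) → ℝ) →L[ℝ] Coord k)) ∅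
    countable_empty (fun i => (hF i).continuousOn.comp T.continuous.continuousOn hbox)
    (fun x hx i => by
      have hx' := hIA x hx.1
      have hd : DifferentiableAt ℝ (F i) (T x) :=
        ((hF i).contDiffAt (mem_of_superset (hA.mem_nhds hx') hAH)).differentiableAt (by simp)
      exact hd.hasFDerivAt.comp x T.hasFDerivAt)
    hint
  have hlhs : (∫ y in A, g y) = ∫ x in Icc a b, g (T x) := by
    rw [← hmp.setIntegral_preimage_emb hme, setIntegral_congr_set hIoo.symm]
    refine setIntegral_eq_of_subset_of_forall_sdiff_eq_zero (hme.measurable hA.measurableSet)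
      hIA ?_
    rintro x ⟨hx, hx'⟩
    apply hgz
    by_contra! hcon
    apply hx'
    intro i _
    refine Fin.cases ?_ (fun j => ?_) i
    · exact h3 _ hx (hcon 0)
    · exact abs_lt.1 (hcon j.succ)
  rw [hlhs]
  refine hdiv.trans ?_
  -- Only the faces orthogonal to direction `0` contribute: on the others some coordinate has
  -- absolute value `R`, so the fields vanish.
  rw [Fin.sum_univ_succ, Finset.sum_eq_zero, add_zero]
  · have hface : ∀ t : ℝ, (∫ x in Icc (a ∘ (0 : Fin (k + 1)).succAbove)
          (b ∘ (0 : Fin (k + 1)).succAbove), F 0 (T ((0 : Fin (k + 1)).insertNth t x))) =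
        ∫ z, F 0 (WithLp.toLp 2 (Fin.cons t z : Fin (k + 1) → ℝ)) := by
      intro t
      rw [setIntegral_eq_integral_of_forall_compl_eq_zero]
      · simp only [Fin.insertNth_zero']
        rfl
      · intro x hx
        apply hzero
        by_contra! hcon
        apply hx
        have hj : ∀ j : Fin k, |x j| < R := fun j => by
          have := hcon j.succ
          simpa [hTa] using this
        refine ⟨fun j => ?_, fun j => ?_⟩
        · simpa [a] using (abs_lt.1 (hj j)).1.le
        · simpa [b] using (abs_lt.1 (hj j)).2.le
    rw [hface, hface]
    rfl
  · intro j _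
    have hz : ∀ t : ℝ, R ≤ |t| → ∀ x, F j.succ (T (j.succ.insertNth t x)) = 0 := by
      intro t ht x
      exact hzero _ _ ⟨j.succ, by simpa [hTa] using ht⟩
    have h5 : ∀ x, F j.succ (T (j.succ.insertNth (b j.succ) x)) = 0 :=
      hz _ (by simp [b, abs_of_pos hR])
    have h6 : ∀ x, F j.succ (T (j.succ.insertNth (a j.succ) x)) = 0 :=
      hz _ (by simp [a, abs_of_pos hR])
    simp only [h5, h6, integral_zero, sub_self]

theorem exists_coord_bound {K : Set (Coord k)} (hK : IsCompact K) :
    ∃ R : ℝ, 0 < R ∧ ∀ y ∈ K, ∀ i, |y i| < R := by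
  obtain ⟨R, hR, h⟩ := hK.isBounded.exists_pos_norm_lt
  exact ⟨R, hR, fun y hy i => (PiLp.norm_apply_le y i).trans_lt (h y hy)⟩

theorem integral_slice_ofLp (f : Coord k → ℝ) :
    (∫ z : Fin k → ℝ, f (WithLp.toLp 2 (Fin.cons 0 z : Fin (k + 1) → ℝ))) =
      ∫ z : EuclideanSpace ℝ (Fin k), f (incl z) := by
  have := (PiLp.volume_preserving_toLp (Fin k)).integral_comp
    (MeasurableEquiv.toLp 2 (Fin k → ℝ)).measurableEmbedding fun z => f (incl z)
  exact this

/-- The divergence theorem on a half-space for compactly supported fields. -/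
theorem integral_divergence_halfSpace {ε : ℝ} (hε : ε = 1 ∨ ε = -1)
    {F : Fin (k + 1) → Coord k → ℝ} (hF : ∀ i, ContDiffOn ℝ 1 (F i) {y | ε * y 0 ≤ 0})
    {K : Set (Coord k)} (hK : IsCompact K) (hFK : ∀ i, ∀ y ∉ K, F i y = 0) :
    (∫ y in {y : Coord k | ε * y 0 < 0},
        ∑ i, fderiv ℝ (F i) y (EuclideanSpace.single i 1)) = ε * ∫ z, F 0 (incl z) := by
  obtain ⟨R, hR, hKR⟩ := exists_coord_bound hK
  have hz : ∀ t : ℝ, |t| = R →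
      (∫ z, F 0 (WithLp.toLp 2 (Fin.cons t z : Fin (k + 1) → ℝ))) = 0 := by
    intro t ht
    refine integral_eq_zero_of_ae (Eventually.of_forall fun z => ?_)
    exact hFK _ _ fun hy => absurd (hKR _ hy 0) (by simp [ht])
  -- The half-space is truncated to `-R < y₀ < 0` or to `0 < y₀ < R`. The far face misses `K`, and
  -- `y₀ = 0` is the upper or the lower face, whence the sign `ε`.
  rcases hε with rfl | rfl
  · rw [integral_divergence_strip (Or.inl rfl) hF hK hFK hR hKR (a₀ := -R) (b₀ := 0) (by linarith)
      (fun t ht => by linarith [ht.2]) (fun t ht => by linarith [ht.2])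
      (fun t ht ht' => ⟨(abs_lt.1 ht').1, by linarith⟩), hz (-R) (by simp [abs_of_pos hR]),
      integral_slice_ofLp]
    ring
  · rw [integral_divergence_strip (Or.inr rfl) hF hK hFK hR hKR (a₀ := 0) (b₀ := R) (by linarith)
      (fun t ht => by linarith [ht.1]) (fun t ht => by linarith [ht.1])
      (fun t ht ht' => ⟨by linarith, (abs_lt.1 ht').2⟩), hz R (by simp [abs_of_pos hR]),
      integral_slice_ofLp]
    ring

end HalfSpace

/-! ### Integration against the volume measure in charts -/

section VolumeMeasure

variable {k : ℕ} {M : Type*} [TopologicalSpace M] [ChartedSpace (Coord k) M]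
  [IsManifold (𝓡 (k + 1)) ∞ M] [MeasurableSpace M] [BorelSpace M]

local notation "AT" => IsManifold.maximalAtlas (𝓡 (k + 1)) ∞ M

variable {S : Sheet k M} {φ ψ : OpenPartialHomeomorph M (Coord k)}

theorem VolumeForm.continuousOn_abs_coeff (μ : VolumeForm k M) (hφ : φ ∈ AT) :
    ContinuousOn (fun y => |μ.coeff φ y|) φ.target :=
  (μ.contDiffOn_coeff hφ).continuousOn.abs

theorem VolumeForm.measure_inter_source (μ : VolumeForm k M) (hφ : φ ∈ AT) {B : Set M}
    (hB : MeasurableSet B) : μ.measure (B ∩ φ.source) =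
      ∫⁻ y in φ.target ∩ φ.symm ⁻¹' B, ENNReal.ofReal |μ.coeff φ y| := by
  rw [← Measure.restrict_apply hB, μ.restrict_measure hφ, paramMeasure_apply
    φ.open_target.measurableSet φ.continuousOn_symm _ hB]

theorem VolumeForm.setIntegral_source (μ : VolumeForm k M) (hφ : φ ∈ AT) {G : M → ℝ}
    (hG : ContinuousOn G φ.source) :
    ∫ x in φ.source, G x ∂μ.measure = ∫ y in φ.target, |μ.coeff φ y| * G (φ.symm y) := by
  have hm := hG.aestronglyMeasurable (μ := μ.measure) φ.open_source.measurableSet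
  rw [μ.restrict_measure hφ] at hm ⊢
  have ht := φ.open_target.measurableSet
  rw [paramMeasure, integral_map (aemeasurable_param ht φ.continuousOn_symm _) hm,
    integral_withDensity_eq_integral_toReal_smul₀]
  · simp [ENNReal.toReal_ofReal]
  · exact ((μ.continuousOn_abs_coeff hφ).aemeasurable ht).ennreal_ofReal
  · exact Eventually.of_forall fun _ => ENNReal.ofReal_lt_top

theorem restr_mem (hφ : φ ∈ AT) {D : Set M} (hD : IsOpen D) : φ.restr D ∈ AT :=
  restr_mem_maximalAtlas (contDiffGroupoid ∞ (𝓡 (k + 1))) hφ hD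

theorem restr_target {D : Set M} (hD : IsOpen D) :
    (φ.restr D).target = φ.target ∩ φ.symm ⁻¹' D := by
  simp [hD.interior_eq]

/-- This is the formula for a full chart domain, applied to `φ.restr D`, which again belongs to the
maximal atlas. -/
theorem VolumeForm.setIntegral_chart (μ : VolumeForm k M) (hφ : φ ∈ AT) {D : Set M}
    (hD : IsOpen D) {G : M → ℝ} (hG : ContinuousOn G (φ.source ∩ D))
    (h0 : ∀ x ∈ D, x ∉ φ.source → G x = 0) :
    ∫ x in D, G x ∂μ.measure =
      ∫ y in φ.target ∩ φ.symm ⁻¹' D, |μ.coeff φ y| * G (φ.symm y) := by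
  have h1 : ∫ x in D, G x ∂μ.measure = ∫ x in φ.source ∩ D, G x ∂μ.measure :=
    setIntegral_eq_of_subset_of_forall_sdiff_eq_zero hD.measurableSet inter_subset_right
      fun x hx => h0 x hx.1 fun h => hx.2 ⟨h, hx.1⟩
  rw [h1]
  have h2 := μ.setIntegral_source (restr_mem hφ hD) (G := G)
    (by rwa [OpenPartialHomeomorph.restr_source' _ _ hD])
  rwa [OpenPartialHomeomorph.restr_source' _ _ hD, restr_target hD] at h2

/-- The density is bounded on a compact neighbourhood in a chart. This gives integrability of
compactly supported continuous functions. -/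
instance VolumeForm.isLocallyFiniteMeasure (μ : VolumeForm k M) :
    IsLocallyFiniteMeasure μ.measure where
  finiteAtNhds x := by
    let φ := chartAt (Coord k) x
    have hφ : φ ∈ AT := IsManifold.chart_mem_maximalAtlas x
    have hx : x ∈ φ.source := mem_chart_source _ x
    obtain ⟨L, hL, hxL, hLφ⟩ := exists_compact_subset φ.open_target (φ.map_source hx)
    have hU : IsOpen (φ.source ∩ φ ⁻¹' interior L) := φ.isOpen_inter_preimage isOpen_interior
    refine ⟨φ.source ∩ φ ⁻¹' interior L, hU.mem_nhds ⟨hx, hxL⟩, ?_⟩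
    have h1 := μ.measure_inter_source hφ hU.measurableSet
    rw [inter_eq_left.2 inter_subset_left] at h1
    rw [h1]
    have hc := ((μ.continuousOn_abs_coeff hφ).mono hLφ).integrableOn_compact (μ := volume) hL
    refine lt_of_le_of_lt (lintegral_mono_set (t := L) ?_) (Integrable.lintegral_lt_top hc)
    rintro y ⟨hy, hy'⟩
    have := interior_subset hy'.2
    rwa [φ.right_inv hy] at this

/-- The density vanishes nowhere. This lets the chart independence of the divergence be deduced from
integral identities. -/
instance VolumeForm.isOpenPosMeasure (μ : VolumeForm k M) : Measure.IsOpenPosMeasure μ.measure where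
  open_pos U hU := by
    rintro ⟨x, hx⟩ h0
    let φ := chartAt (Coord k) x
    have hφ : φ ∈ AT := IsManifold.chart_mem_maximalAtlas x
    have hxφ : x ∈ φ.source := mem_chart_source _ x
    have h1 := μ.measure_inter_source hφ hU.measurableSet
    rw [measure_mono_null inter_subset_left h0] at h1
    have hO : IsOpen (φ.target ∩ φ.symm ⁻¹' U) := φ.symm.isOpen_inter_preimage hU
    have h2 := (lintegral_eq_zero_iff' (((μ.continuousOn_abs_coeff hφ).mono
      inter_subset_left).aemeasurable hO.measurableSet).ennreal_ofReal).1 h1.symm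
    have h3 : ∀ᵐ y ∂volume.restrict (φ.target ∩ φ.symm ⁻¹' U), False := by
      filter_upwards [h2, ae_restrict_mem hO.measurableSet] with y hy hy'
      rw [Pi.zero_apply, ENNReal.ofReal_eq_zero] at hy
      exact μ.coeff_ne_zero hφ hy'.1 (abs_eq_zero.1 (le_antisymm hy (abs_nonneg _)))
    rw [ae_iff] at h3
    simp only [not_false_eq_true] at h3
    have h4 : volume (φ.target ∩ φ.symm ⁻¹' U) = 0 := by simpa using h3
    refine (hO.measure_pos volume ⟨φ x, φ.map_source hxφ, ?_⟩).ne' h4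
    rwa [mem_preimage, φ.left_inv hxφ]

end VolumeMeasure

/-! ### Components of vector fields and differentials in a chart -/

section FieldsInCharts

variable {k : ℕ} {M : Type*} [TopologicalSpace M] [ChartedSpace (Coord k) M]
  [IsManifold (𝓡 (k + 1)) ∞ M]

local notation "AT" => IsManifold.maximalAtlas (𝓡 (k + 1)) ∞ M

variable {S : Sheet k M} {φ ψ : OpenPartialHomeomorph M (Coord k)}

/-- The components of a vector field in the chart `φ`, as a function of the coordinates. -/
def fieldInChart (φ : OpenPartialHomeomorph M (Coord k)) (v : VField k M) (y : Coord k) : Coord k :=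
  chartDeriv φ (φ.symm y) (v (φ.symm y))

/-- The components are the fibre part of the tangent map of `φ` composed with the section `v`, and
the tangent map of a smooth map is smooth. -/
theorem contMDiffOn_chartDeriv (hφ : φ ∈ AT) {v : VField k M} {s : Set M}
    (hv : SmoothVFieldOn v s) :
    ContMDiffOn (𝓡 (k + 1)) 𝓘(ℝ, Coord k) ∞ (fun x => chartDeriv φ x (v x)) (φ.source ∩ s) := by
  have h1 : ContMDiffOn (𝓡 (k + 1)) 𝓘(ℝ, Coord k) ∞ φ φ.source :=
    contMDiffOn_of_mem_maximalAtlas hφ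
  have h2 := h1.contMDiffOn_tangentMapWithin (m := ∞) (by simp) φ.open_source.uniqueMDiffOn
  have h3 : ContMDiffOn (𝓡 (k + 1)) (𝓘(ℝ, Coord k).tangent) ∞
      (fun x => tangentMapWithin (𝓡 (k + 1)) 𝓘(ℝ, Coord k) φ φ.source
        (⟨x, v x⟩ : TangentBundle (𝓡 (k + 1)) M)) (φ.source ∩ s) :=
    h2.comp (hv.mono inter_subset_right) fun x hx => hx.1
  intro x hx
  have h4 := (Bundle.contMDiffWithinAt_totalSpace.1 (h3 x hx)).2
  refine h4.congr (fun z hz => ?_) ?_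
  · simp [tangentMapWithin, chartDeriv, mfderivWithin_of_isOpen φ.open_source hz.1]
    rfl
  · simp [tangentMapWithin, chartDeriv, mfderivWithin_of_isOpen φ.open_source hx.1]
    rfl

theorem contDiffOn_comp_symm (hφ : φ ∈ AT) {F : Type*} [NormedAddCommGroup F] [NormedSpace ℝ F]
    {f : M → F} {s : Set M} (hf : ContMDiffOn (𝓡 (k + 1)) 𝓘(ℝ, F) ∞ f (φ.source ∩ s)) :
    ContDiffOn ℝ ∞ (fun y => f (φ.symm y)) (φ.target ∩ φ.symm ⁻¹' s) := by
  rw [← contMDiffOn_iff_contDiffOn]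
  exact hf.comp ((contMDiffOn_symm_of_mem_maximalAtlas hφ).mono inter_subset_left)
    fun y hy => ⟨φ.map_target hy.1, hy.2⟩

theorem contDiffOn_fieldInChart (hφ : φ ∈ AT) {v : VField k M} {s : Set M}
    (hv : SmoothVFieldOn v s) :
    ContDiffOn ℝ ∞ (fieldInChart φ v) (φ.target ∩ φ.symm ⁻¹' s) :=
  contDiffOn_comp_symm hφ (contMDiffOn_chartDeriv hφ hv)

theorem Sheet.IsSide.preimage_C {ε : ℝ} {D C : Set M} (h : S.IsSide ε D C)
    (hφ : φ ∈ S.adaptedCharts) :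
    φ.target ∩ φ.symm ⁻¹' C = φ.target ∩ {y | ε * y 0 ≤ 0} := by
  ext y
  refine and_congr_right fun hy => ?_
  rw [mem_preimage, h.mem_C φ hφ _ (φ.map_target hy), φ.right_inv hy]
  rfl

theorem Sheet.IsSide.preimage_D {ε : ℝ} {D C : Set M} (h : S.IsSide ε D C)
    (hφ : φ ∈ S.adaptedCharts) :
    φ.target ∩ φ.symm ⁻¹' D = φ.target ∩ {y | ε * y 0 < 0} := by
  ext y
  refine and_congr_right fun hy => ?_
  rw [mem_preimage, h.mem_D φ hφ _ (φ.map_target hy), φ.right_inv hy]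
  rfl

theorem hasFDerivAt_comp_symm (hφ : φ ∈ AT) {f : M → ℝ} {y : Coord k} (hy : y ∈ φ.target)
    (hf : MDifferentiableAt (𝓡 (k + 1)) 𝓘(ℝ, ℝ) f (φ.symm y)) {s : Set M} (hs : s ∈ 𝓝 (φ.symm y)) :
    HasFDerivAt (fun z => f (φ.symm z))
      ((dWithin s f (φ.symm y)).comp (chartFrame φ (φ.symm y))) y := by
  have h2 := ((contMDiffAt_symm_of_mem_maximalAtlas hφ hy).mdifferentiableAt
    (by simp)).hasMFDerivAt
  have h3 := (hf.hasMFDerivAt.comp y h2).hasFDerivAt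
  convert h3 using 1
  rw [← mfderiv_symm_eq_chartFrame hφ hy, dWithin, mfderivWithin_of_mem_nhds hs]
  rfl

theorem fderiv_comp_symm_fieldInChart (hφ : φ ∈ AT) {f : M → ℝ} {y : Coord k} (hy : y ∈ φ.target)
    (hf : MDifferentiableAt (𝓡 (k + 1)) 𝓘(ℝ, ℝ) f (φ.symm y)) {s : Set M} (hs : s ∈ 𝓝 (φ.symm y))
    (v : VField k M) :
    fderiv ℝ (fun z => f (φ.symm z)) y (fieldInChart φ v y) =
      dWithin s f (φ.symm y) (v (φ.symm y)) := by
  rw [(hasFDerivAt_comp_symm hφ hy hf hs).fderiv]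
  exact congrArg (dWithin s f (φ.symm y)) (chartFrame_chartDeriv hφ (φ.map_target hy) _)

end FieldsInCharts

/-! ### The divergence in a chart and the flux of a field supported there -/

section Divergence

variable {k : ℕ} {M : Type*} [TopologicalSpace M] [ChartedSpace (Coord k) M]
  [IsManifold (𝓡 (k + 1)) ∞ M]

local notation "AT" => IsManifold.maximalAtlas (𝓡 (k + 1)) ∞ M

variable {S : Sheet k M} {φ ψ : OpenPartialHomeomorph M (Coord k)}

/-- The divergence of a vector field computed in the chart `φ`. -/
def divChart (μ : VolumeForm k M) (φ : OpenPartialHomeomorph M (Coord k)) (v : VField k M)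
    (x : M) : ℝ :=
  (μ.coeff φ (φ x))⁻¹ * ∑ i : Fin (k + 1),
    fderiv ℝ (fun y => μ.coeff φ y * fieldInChart φ v y i) (φ x) (EuclideanSpace.single i 1)

theorem divWithin_eq_divChart_chartAt (μ : VolumeForm k M) {s : Set M} {x : M} (hs : s ∈ 𝓝 x)
    (v : VField k M) : divWithin μ s v x = divChart μ (chartAt (Coord k) x) v x := by
  have hx : x ∈ (chartAt (Coord k) x).source := mem_chart_source _ x
  have h1 : (chartAt (Coord k) x).target ∩ (chartAt (Coord k) x).symm ⁻¹' s ∈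
      𝓝 (chartAt (Coord k) x x) := by
    refine inter_mem ((chartAt (Coord k) x).open_target.mem_nhds (mem_chart_target _ x)) ?_
    refine ((chartAt (Coord k) x).continuousAt_symm (mem_chart_target _ x)).preimage_mem_nhds ?_
    rwa [(chartAt (Coord k) x).left_inv hx]
  simp only [divWithin, divChart, fieldInChart, fderivWithin_of_mem_nhds h1]

/-- The field `P v` in a chart, multiplied with the density of the volume form. -/
def chartFlux (μ : VolumeForm k M) (φ : OpenPartialHomeomorph M (Coord k)) (P : M → ℝ)
    (v : VField k M) (i : Fin (k + 1)) : Coord k → ℝ :=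
  φ.target.indicator fun y => |μ.coeff φ y| * (P (φ.symm y) * fieldInChart φ v y i)

variable {P : M → ℝ} {v : VField k M} {H : Set (Coord k)} {K : Set M}

theorem isCompact_image_chart (hK : IsCompact K) (hKφ : K ⊆ φ.source) : IsCompact (φ '' K) :=
  hK.image_of_continuousOn (φ.continuousOn.mono hKφ)

theorem chartFlux_eq_zero (μ : VolumeForm k M) (hP0 : ∀ x ∉ K, P x = 0) (i : Fin (k + 1)) {y : Coord k}
    (hy : y ∉ φ '' K) : chartFlux μ φ P v i y = 0 := by
  by_cases hyt : y ∈ φ.target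
  · rw [chartFlux, indicator_of_mem hyt, hP0 (φ.symm y), zero_mul, mul_zero]
    exact fun h => hy ⟨_, h, φ.right_inv hyt⟩
  · exact indicator_of_notMem hyt _

/-- Extension by zero loses no smoothness, since `P` has compact support inside the chart. The
absolute value is harmless because the coefficient of `μ` never vanishes. -/
theorem contDiffOn_chartFlux (μ : VolumeForm k M) (hφ : φ ∈ AT)
    (hK : IsCompact K) (hKφ : K ⊆ φ.source) (hP0 : ∀ x ∉ K, P x = 0)
    (hP : ContDiffOn ℝ ∞ (fun y => P (φ.symm y)) (φ.target ∩ H))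
    (hv : ContDiffOn ℝ ∞ (fieldInChart φ v) (φ.target ∩ H)) (i : Fin (k + 1)) :
    ContDiffOn ℝ 1 (chartFlux μ φ P v i) H := by
  intro y hy
  by_cases hyt : y ∈ φ.target
  · have h1 : ContDiffWithinAt ℝ ∞ (fun y => |μ.coeff φ y| *
        (P (φ.symm y) * fieldInChart φ v y i)) (φ.target ∩ H) y := by
      refine ContDiffWithinAt.mul ?_ ((hP y ⟨hyt, hy⟩).mul ?_)
      · exact (((μ.contDiffOn_coeff hφ).contDiffAt (φ.open_target.mem_nhds hyt)).abs
          (μ.coeff_ne_zero hφ hyt)).contDiffWithinAt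
      · exact (contDiffWithinAt_euclidean.1 (hv y ⟨hyt, hy⟩)) i
    have h2 : ContDiffWithinAt ℝ ∞ (chartFlux μ φ P v i) (φ.target ∩ H) y :=
      h1.congr (fun z hz => indicator_of_mem hz.1 _) (indicator_of_mem hyt _)
    have h3 : φ.target ∩ H ∈ 𝓝[H] y :=
      inter_mem (mem_nhdsWithin_of_mem_nhds (φ.open_target.mem_nhds hyt)) self_mem_nhdsWithin
    exact (h2.mono_of_mem_nhdsWithin h3).of_le (by simp)
  · have hyK : y ∉ φ '' K := by
      rintro ⟨x, hx, rfl⟩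
      exact hyt (φ.map_source (hKφ hx))
    have h4 : chartFlux μ φ P v i =ᶠ[𝓝 y] fun _ => 0 := by
      filter_upwards [(isCompact_image_chart hK hKφ).isClosed.isOpen_compl.mem_nhds hyK]
        with z hz using chartFlux_eq_zero μ hP0 i hz
    exact (contDiffAt_const.congr_of_eventuallyEq h4).contDiffWithinAt

theorem sum_fderiv_chartFlux (μ : VolumeForm k M) (hφ : φ ∈ AT)
    {y : Coord k} (hy : y ∈ φ.target)
    (hP : DifferentiableAt ℝ (fun y => P (φ.symm y)) y)
    (hv : DifferentiableAt ℝ (fieldInChart φ v) y) :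
    ∑ i, fderiv ℝ (chartFlux μ φ P v i) y (EuclideanSpace.single i 1) =
      |μ.coeff φ y| * (P (φ.symm y) * divChart μ φ v (φ.symm y) +
        fderiv ℝ (fun y => P (φ.symm y)) y (fieldInChart φ v y)) := by
  have hne := μ.coeff_ne_zero hφ hy
  have hdc : DifferentiableAt ℝ (μ.coeff φ) y :=
    ((μ.contDiffOn_coeff hφ).contDiffAt (φ.open_target.mem_nhds hy)).differentiableAt (by simp)
  -- The sign of the coefficient is locally constant, so the absolute value is replaced by a
  -- constant factor before differentiating.
  obtain ⟨s, hs⟩ : ∃ s : ℝ, ∀ᶠ z in 𝓝 y, |μ.coeff φ z| = s * μ.coeff φ z := by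
    rcases lt_or_gt_of_ne hne with h | h
    · refine ⟨-1, ?_⟩
      filter_upwards [hdc.continuousAt.eventually_lt_const h] with z hz
      rw [abs_of_neg hz, neg_one_mul]
    · refine ⟨1, ?_⟩
      filter_upwards [hdc.continuousAt.eventually_const_lt h] with z hz
      rw [abs_of_pos hz, one_mul]
  have hdv : ∀ i, DifferentiableAt ℝ (fun z => fieldInChart φ v z i) y := fun i =>
    (differentiableAt_euclidean.1 hv) i
  have h1 : ∀ i, fderiv ℝ (chartFlux μ φ P v i) y (EuclideanSpace.single i 1) =
      s * (P (φ.symm y) * fderiv ℝ (fun z => μ.coeff φ z * fieldInChart φ v z i) y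
          (EuclideanSpace.single i 1) +
        μ.coeff φ y * (fieldInChart φ v y i *
          fderiv ℝ (fun z => P (φ.symm z)) y (EuclideanSpace.single i 1))) := by
    intro i
    have h2 : chartFlux μ φ P v i =ᶠ[𝓝 y]
        fun z => s * (P (φ.symm z) * (μ.coeff φ z * fieldInChart φ v z i)) := by
      filter_upwards [hs, φ.open_target.mem_nhds hy] with z hz hzt
      rw [chartFlux, indicator_of_mem hzt, hz]
      ring
    have hq : DifferentiableAt ℝ (fun z => μ.coeff φ z * fieldInChart φ v z i) y :=
      hdc.mul (hdv i)
    have h5 : HasFDerivAt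
        (fun z => s * (P (φ.symm z) * (μ.coeff φ z * fieldInChart φ v z i))) _ y :=
      (hP.hasFDerivAt.mul hq.hasFDerivAt).const_mul s
    rw [h2.fderiv_eq, h5.fderiv]
    simp only [smul_apply, add_apply, smul_eq_mul]
    ring
  have h3 : fderiv ℝ (fun y => P (φ.symm y)) y (fieldInChart φ v y) =
      ∑ i, fieldInChart φ v y i *
        fderiv ℝ (fun z => P (φ.symm z)) y (EuclideanSpace.single i 1) := by
    have h4 : fieldInChart φ v y =
        ∑ i, fieldInChart φ v y i • (EuclideanSpace.single i 1 : Coord k) := by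
      have := (EuclideanSpace.basisFun (Fin (k + 1)) ℝ).sum_repr (fieldInChart φ v y)
      simpa using this.symm
    conv_lhs => rw [h4]
    rw [map_sum]
    simp
  rw [Finset.sum_congr rfl fun i _ => h1 i, h3, ← Finset.mul_sum, Finset.sum_add_distrib,
    ← Finset.mul_sum, ← Finset.mul_sum, hs.self_of_nhds, divChart, φ.right_inv hy]
  field_simp

theorem continuousOn_divChart (μ : VolumeForm k M) (hφ : φ ∈ AT) {v : VField k M} {U : Set M}
    (hU : IsOpen U) (hv : SmoothVFieldOn v U) :
    ContinuousOn (divChart μ φ v) (φ.source ∩ U) := by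
  have hO : IsOpen (φ.target ∩ φ.symm ⁻¹' U) := φ.symm.isOpen_inter_preimage hU
  have hm : MapsTo φ (φ.source ∩ U) (φ.target ∩ φ.symm ⁻¹' U) := fun x hx =>
    ⟨φ.map_source hx.1, by rw [mem_preimage, φ.left_inv hx.1]; exact hx.2⟩
  have hφc : ContinuousOn φ (φ.source ∩ U) := φ.continuousOn.mono inter_subset_left
  have hV := contDiffOn_fieldInChart hφ hv
  refine ContinuousOn.mul ?_ (continuousOn_finsetSum _ fun i _ => ?_)
  · refine (((μ.contDiffOn_coeff hφ).continuousOn.mono inter_subset_left).comp hφc hm).inv₀ ?_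
    exact fun x hx => μ.coeff_ne_zero hφ (φ.map_source hx.1)
  · have h1 : ContDiffOn ℝ ∞ (fun y => μ.coeff φ y * fieldInChart φ v y i)
        (φ.target ∩ φ.symm ⁻¹' U) :=
      ((μ.contDiffOn_coeff hφ).mono inter_subset_left).mul ((contDiffOn_euclidean.1 hV) i)
    exact (((h1.continuousOn_fderiv_of_isOpen hO (by simp)).comp hφc hm).clm_apply
      continuousOn_const)

variable [T2Space M] [MeasurableSpace M] [BorelSpace M]

theorem continuousOn_dWithin_apply (hφ : φ ∈ AT) {D C : Set M} (hD : IsOpen D) (hDC : D ⊆ C)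
    {P : M → ℝ} {v : VField k M} (hP : ContMDiffOn (𝓡 (k + 1)) 𝓘(ℝ, ℝ) ∞ P (φ.source ∩ C))
    (hv : SmoothVFieldOn v (φ.source ∩ D)) :
    ContinuousOn (fun x => dWithin C P x (v x)) (φ.source ∩ D) := by
  have hCn : ∀ x ∈ D, C ∈ 𝓝 x := fun x hx => mem_of_superset (hD.mem_nhds hx) hDC
  have hPd : ∀ x ∈ φ.source ∩ D, MDifferentiableAt (𝓡 (k + 1)) 𝓘(ℝ, ℝ) P x := fun x hx =>
    (hP.contMDiffAt (inter_mem (φ.open_source.mem_nhds hx.1) (hCn x hx.2))).mdifferentiableAt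
      (by simp)
  have hO : IsOpen (φ.target ∩ φ.symm ⁻¹' D) := φ.symm.isOpen_inter_preimage hD
  have hPc : ContDiffOn ℝ ∞ (fun y => P (φ.symm y)) (φ.target ∩ φ.symm ⁻¹' D) :=
    contDiffOn_comp_symm hφ (hP.mono (inter_subset_inter_right _ hDC))
  have hvc : ContDiffOn ℝ ∞ (fieldInChart φ v) (φ.target ∩ φ.symm ⁻¹' D) := by
    refine (contDiffOn_fieldInChart hφ hv).mono fun y hy => ⟨hy.1, φ.map_target hy.1, hy.2⟩
  have hm : MapsTo φ (φ.source ∩ D) (φ.target ∩ φ.symm ⁻¹' D) := fun x hx =>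
    ⟨φ.map_source hx.1, by rw [mem_preimage, φ.left_inv hx.1]; exact hx.2⟩
  have hφc : ContinuousOn φ (φ.source ∩ D) := φ.continuousOn.mono inter_subset_left
  have h5 : ContinuousOn (fun y => fderiv ℝ (fun z => P (φ.symm z)) y (fieldInChart φ v y))
      (φ.target ∩ φ.symm ⁻¹' D) :=
    (hPc.continuousOn_fderiv_of_isOpen hO (by simp)).clm_apply hvc.continuousOn
  refine (h5.comp hφc hm).congr fun x hx => ?_
  have := fderiv_comp_symm_fieldInChart hφ (φ.map_source hx.1)
    (f := P) (by rw [φ.left_inv hx.1]; exact hPd x hx) (s := C)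
    (by rw [φ.left_inv hx.1]; exact hCn x hx.2) v
  rw [φ.left_inv hx.1] at this
  exact this.symm

theorem continuousOn_div_add_d (μ : VolumeForm k M) (hφ : φ ∈ AT) {D C : Set M} (hD : IsOpen D)
    (hDC : D ⊆ C) {P : M → ℝ} {v : VField k M}
    (hP : ContMDiffOn (𝓡 (k + 1)) 𝓘(ℝ, ℝ) ∞ P (φ.source ∩ C))
    (hv : SmoothVFieldOn v (φ.source ∩ D)) :
    ContinuousOn (fun x => P x * divChart μ φ v x + dWithin C P x (v x)) (φ.source ∩ D) := by
  refine ContinuousOn.add (ContinuousOn.mul (hP.continuousOn.mono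
    (inter_subset_inter_right _ hDC)) ?_) (continuousOn_dWithin_apply hφ hD hDC hP hv)
  have := continuousOn_divChart μ hφ (φ.open_source.inter hD) hv
  rwa [← inter_assoc, inter_self] at this

theorem dWithin_eq_zero {C : Set M} {P : M → ℝ} {x : M} (hC : C ∈ 𝓝 x)
    (hP : P =ᶠ[𝓝 x] fun _ => 0) : dWithin C P x = (0 : TangentSpace (𝓡 (k + 1)) x →L[ℝ] ℝ) := by
  rw [dWithin, mfderivWithin_of_mem_nhds hC, hP.mfderiv_eq, mfderiv_const]
  rfl

/-- Transfer of an integral of `P div v + dP(v)` to a chart. -/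
theorem setIntegral_div_add_d (μ : VolumeForm k M) (hφ : φ ∈ AT) {D C : Set M}
    {Ho : Set (Coord k)} (hD : IsOpen D) (hDC : D ⊆ C)
    (hHo : IsOpen Ho)
    (hDo : φ.target ∩ φ.symm ⁻¹' D = φ.target ∩ Ho)
    {P : M → ℝ} {v : VField k M}
    (hP : ContMDiffOn (𝓡 (k + 1)) 𝓘(ℝ, ℝ) ∞ P (φ.source ∩ C))
    (hv : SmoothVFieldOn v (φ.source ∩ D)) {K : Set M} (hK : IsCompact K) (hKφ : K ⊆ φ.source)
    (hP0 : ∀ x ∉ K, P x = 0) :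
    ∫ x in D, (P x * divChart μ φ v x + dWithin C P x (v x)) ∂μ.measure =
      ∫ y in Ho, ∑ i, fderiv ℝ (chartFlux μ φ P v i) y (EuclideanSpace.single i 1) := by
  have hCn : ∀ x ∈ D, C ∈ 𝓝 x := fun x hx => mem_of_superset (hD.mem_nhds hx) hDC
  have hPd : ∀ x ∈ φ.source ∩ D, MDifferentiableAt (𝓡 (k + 1)) 𝓘(ℝ, ℝ) P x := fun x hx =>
    (hP.contMDiffAt (inter_mem (φ.open_source.mem_nhds hx.1) (hCn x hx.2))).mdifferentiableAt
      (by simp)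
  have hO : IsOpen (φ.target ∩ φ.symm ⁻¹' D) := φ.symm.isOpen_inter_preimage hD
  have hPc : ContDiffOn ℝ ∞ (fun y => P (φ.symm y)) (φ.target ∩ φ.symm ⁻¹' D) :=
    contDiffOn_comp_symm hφ (hP.mono (inter_subset_inter_right _ hDC))
  have hvc : ContDiffOn ℝ ∞ (fieldInChart φ v) (φ.target ∩ φ.symm ⁻¹' D) := by
    refine (contDiffOn_fieldInChart hφ hv).mono fun y hy => ⟨hy.1, φ.map_target hy.1, hy.2⟩
  have hpt : ∀ y ∈ φ.target ∩ φ.symm ⁻¹' D,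
      ∑ i, fderiv ℝ (chartFlux μ φ P v i) y (EuclideanSpace.single i 1) =
        |μ.coeff φ y| * (P (φ.symm y) * divChart μ φ v (φ.symm y) +
          dWithin C P (φ.symm y) (v (φ.symm y))) := by
    intro y hy
    rw [sum_fderiv_chartFlux μ hφ hy.1
      ((hPc.contDiffAt (hO.mem_nhds hy)).differentiableAt (by simp))
      ((hvc.contDiffAt (hO.mem_nhds hy)).differentiableAt (by simp)),
      fderiv_comp_symm_fieldInChart hφ hy.1 (hPd _ ⟨φ.map_target hy.1, hy.2⟩) (hCn _ hy.2)]
  rw [μ.setIntegral_chart hφ hD]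
  · rw [hDo, setIntegral_eq_of_subset_of_forall_sdiff_eq_zero hHo.measurableSet
      (inter_subset_right (s := φ.target))]
    · refine setIntegral_congr_fun (φ.open_target.inter hHo).measurableSet fun y hy => ?_
      rw [← hDo] at hy
      exact (hpt y hy).symm
    · rintro y ⟨hy, hy'⟩
      have hyK : y ∉ φ '' K := by
        rintro ⟨x, hx, rfl⟩
        exact hy' ⟨φ.map_source (hKφ hx), hy⟩
      refine Finset.sum_eq_zero fun i _ => ?_
      have h4 : chartFlux μ φ P v i =ᶠ[𝓝 y] fun _ => 0 := by
        filter_upwards [(isCompact_image_chart hK hKφ).isClosed.isOpen_compl.mem_nhds hyK]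
          with z hz using chartFlux_eq_zero μ hP0 i hz
      rw [h4.fderiv_eq]
      simp
  · exact continuousOn_div_add_d μ hφ hD hDC hP hv
  · intro x hxD hx
    have hxK : x ∉ K := fun h => hx (hKφ h)
    have h6 : P =ᶠ[𝓝 x] fun _ => 0 := by
      filter_upwards [hK.isClosed.isOpen_compl.mem_nhds hxK] with z hz using hP0 z hz
    rw [hP0 x hxK, zero_mul, zero_add, dWithin_eq_zero (hCn x hxD) h6]
    rfl

end Divergence

/-! ### Chart independence of the divergence, and Stokes in one adapted chart -/

section Invariance

theorem continuous_of_continuousOn_of_eq_zero {X : Type*} [TopologicalSpace X] [T2Space X]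
    {W K : Set X} (hW : IsOpen W) (hK : IsCompact K) (hKW : K ⊆ W) {g : X → ℝ}
    (hg : ContinuousOn g W) (h0 : ∀ x ∉ K, g x = 0) : Continuous g ∧ HasCompactSupport g := by
  refine ⟨continuous_iff_continuousAt.2 fun x => ?_, HasCompactSupport.intro hK h0⟩
  by_cases hx : x ∈ W
  · exact hg.continuousAt (hW.mem_nhds hx)
  · have : g =ᶠ[𝓝 x] fun _ => 0 := by
      filter_upwards [hK.isClosed.isOpen_compl.mem_nhds fun h => hx (hKW h)] with z hz using h0 z hz
    exact continuousAt_const.congr this.symm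

variable {k : ℕ}

theorem integral_divergence_eq_zero {F : Fin (k + 1) → Coord k → ℝ}
    (hF : ∀ i, ContDiffOn ℝ 1 (F i) univ) {K : Set (Coord k)} (hK : IsCompact K)
    (hFK : ∀ i, ∀ y ∉ K, F i y = 0) :
    (∫ y, ∑ i, fderiv ℝ (F i) y (EuclideanSpace.single i 1)) = 0 := by
  have hF' : ∀ i, ContDiff ℝ 1 (F i) := fun i => contDiffOn_univ.1 (hF i)
  have hs : ∀ i, HasCompactSupport (F i) := fun i => HasCompactSupport.intro hK (hFK i)
  have hi : ∀ i, Integrable fun y => fderiv ℝ (F i) y (EuclideanSpace.single i 1) := fun i =>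
    (((hF' i).continuous_fderiv (by simp)).clm_apply continuous_const).integrable_of_hasCompactSupport
      ((hs i).fderiv_apply ℝ _)
  rw [integral_finsetSum _ fun i _ => hi i]
  refine Finset.sum_eq_zero fun i _ => ?_
  -- Integration by parts against the constant function `1`.
  have h := integral_mul_fderiv_eq_neg_fderiv_mul_of_integrable (μ := volume)
    (f := fun _ : Coord k => (1 : ℝ)) (g := F i) (v := EuclideanSpace.single i 1)
    (by simp) (by simpa using hi i)
    (by simpa using (hF' i).continuous.integrable_of_hasCompactSupport (hs i))
    (fun _ _ => differentiableAt_const _) (fun x _ => ((hF' i).differentiable (by simp)) x)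
  simpa using h

variable {M : Type*} [TopologicalSpace M] [ChartedSpace (Coord k) M]
  [IsManifold (𝓡 (k + 1)) ∞ M]

local notation "AT" => IsManifold.maximalAtlas (𝓡 (k + 1)) ∞ M

variable {S : Sheet k M} {φ ψ : OpenPartialHomeomorph M (Coord k)}
variable [T2Space M] [MeasurableSpace M] [BorelSpace M]

theorem integral_div_add_d_eq_zero (μ : VolumeForm k M) (hφ : φ ∈ AT) {f : M → ℝ}
    (hf : ContMDiff (𝓡 (k + 1)) 𝓘(ℝ, ℝ) ∞ f) {v : VField k M} (hv : SmoothVFieldOn v φ.source)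
    {K : Set M} (hK : IsCompact K) (hKφ : K ⊆ φ.source) (hf0 : ∀ x ∉ K, f x = 0) :
    ∫ x, (f x * divChart μ φ v x + dWithin univ f x (v x)) ∂μ.measure = 0 := by
  have h1 := setIntegral_div_add_d μ hφ (D := univ) (C := univ) (Ho := univ) isOpen_univ
    Subset.rfl isOpen_univ (by simp) hf.contMDiffOn (by simpa using hv) hK hKφ hf0
  rw [setIntegral_univ, setIntegral_univ] at h1
  rw [h1]
  refine integral_divergence_eq_zero (fun i => ?_) (isCompact_image_chart hK hKφ)
    fun i y hy => chartFlux_eq_zero μ hf0 i hy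
  refine contDiffOn_chartFlux μ hφ hK hKφ hf0 ?_ ?_ i
  · simpa using contDiffOn_comp_symm hφ (s := univ) hf.contMDiffOn
  · have := contDiffOn_fieldInChart hφ hv
    exact this.mono fun y hy => ⟨hy.1, φ.map_target hy.1⟩

/-- In every chart the divergence satisfies `∫ (f div v + df(v)) μ = 0` for test functions `f`,
where `df(v)` and the measure involve no chart. The difference of two chart expressions is
continuous and integrates to zero against every test function, hence vanishes. No second derivatives
of transition maps are needed. -/
theorem divChart_eq (μ : VolumeForm k M) (hφ : φ ∈ AT) (hψ : ψ ∈ AT) {U : Set M} (hU : IsOpen U)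
    {v : VField k M} (hv : SmoothVFieldOn v U) {x : M} (hxφ : x ∈ φ.source) (hxψ : x ∈ ψ.source)
    (hxU : x ∈ U) : divChart μ φ v x = divChart μ ψ v x := by
  by_contra hne
  set δ : M → ℝ := fun z => divChart μ φ v z - divChart μ ψ v z with hδ
  have hδx : δ x ≠ 0 := sub_ne_zero.2 hne
  set W : Set M := φ.source ∩ ψ.source ∩ U with hW
  have hWo : IsOpen W := (φ.open_source.inter ψ.open_source).inter hU
  have hδc : ContinuousOn δ W :=
    ((continuousOn_divChart μ hφ hU hv).mono fun z hz => ⟨hz.1.1, hz.2⟩).sub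
      ((continuousOn_divChart μ hψ hU hv).mono fun z hz => ⟨hz.1.2, hz.2⟩)
  have hWo' : IsOpen (W ∩ (fun z => δ z * δ x) ⁻¹' Ioi 0) :=
    (hδc.mul continuousOn_const).isOpen_inter_preimage hWo isOpen_Ioi
  have hxW' : x ∈ W ∩ (fun z => δ z * δ x) ⁻¹' Ioi 0 :=
    ⟨⟨⟨hxφ, hxψ⟩, hxU⟩, mul_self_pos.2 hδx⟩
  -- The bump function is supported where `δ` keeps the sign it has at `x`, so `f δ δ(x)` is
  -- nonnegative, and it is positive at `x`.
  obtain ⟨f, hf⟩ := (SmoothBumpFunction.nhds_basis_tsupport (I := 𝓡 (k + 1)) x).mem_iff.1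
    (hWo'.mem_nhds hxW')
  obtain ⟨-, hf⟩ := hf
  set K : Set M := tsupport f with hKdef
  have hK : IsCompact K := f.hasCompactSupport
  have hf0 : ∀ z ∉ K, f z = 0 := fun z hz => image_eq_zero_of_notMem_tsupport hz
  have hKW : K ⊆ W := fun z hz => (hf hz).1
  have hsm : ContMDiff (𝓡 (k + 1)) 𝓘(ℝ, ℝ) ∞ f := f.contMDiff
  have key : ∀ χ : OpenPartialHomeomorph M (Coord k), χ ∈ AT → W ⊆ χ.source →
      ∫ z, (f z * divChart μ χ v z + dWithin univ f z (v z)) ∂μ.measure = 0 ∧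
      Integrable (fun z => f z * divChart μ χ v z + dWithin univ f z (v z)) μ.measure := by
    intro χ hχ hWχ
    have hs : (χ.restr W).source = W := by
      rw [OpenPartialHomeomorph.restr_source' _ _ hWo, inter_eq_right.2 hWχ]
    refine ⟨integral_div_add_d_eq_zero μ (restr_mem hχ hWo) hsm ?_ hK ?_ hf0, ?_⟩
    · rw [hs]; exact hv.mono fun z hz => hz.2
    · rw [hs]; exact hKW
    · have hc := continuousOn_div_add_d μ hχ (D := W) (C := univ) hWo (subset_univ _)
        (P := f) (v := v) hsm.contMDiffOn (hv.mono fun z hz => hz.2.2)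
      rw [inter_eq_right.2 hWχ] at hc
      obtain ⟨h1, h2⟩ := continuous_of_continuousOn_of_eq_zero hWo hK hKW hc (by
        intro z hz
        have h6 : (f : M → ℝ) =ᶠ[𝓝 z] fun _ => 0 := by
          filter_upwards [hK.isClosed.isOpen_compl.mem_nhds hz] with z hz using hf0 z hz
        rw [hf0 z hz, zero_mul, zero_add, dWithin_eq_zero univ_mem h6]
        rfl)
      exact h1.integrable_of_hasCompactSupport h2
  obtain ⟨a1, a2⟩ := key φ hφ fun z hz => hz.1.1
  obtain ⟨b1, b2⟩ := key ψ hψ fun z hz => hz.1.2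
  have h3 : ∫ z, f z * δ z * δ x ∂μ.measure = 0 := by
    have h4 := integral_sub a2 b2
    rw [a1, b1, sub_zero] at h4
    rw [integral_mul_const]
    have h5 : ∀ z, f z * δ z = f z * divChart μ φ v z + dWithin univ f z (v z) -
        (f z * divChart μ ψ v z + dWithin univ f z (v z)) := fun z => by
      simp only [hδ]; ring
    simp only [h5]
    rw [h4, zero_mul]
  have hfc : Continuous (f : M → ℝ) := hsm.continuous
  obtain ⟨c1, c2⟩ := continuous_of_continuousOn_of_eq_zero (g := fun z => f z * δ z * δ x)
    hWo hK hKW ((hfc.continuousOn.mul hδc).mul continuousOn_const)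
    (fun z hz => by simp [hf0 z hz])
  refine (c1.integral_pos_of_hasCompactSupport_nonneg_nonzero (μ := μ.measure) (x := x) c2
    ?_ ?_).ne' h3
  · intro z
    by_cases hz : z ∈ K
    · have := (hf hz).2
      rw [mem_preimage, mem_Ioi] at this
      show 0 ≤ f z * δ z * δ x
      rw [mul_assoc]
      exact mul_nonneg f.nonneg this.le
    · simp [hf0 z hz]
  · rw [f.eq_one, one_mul]
    exact mul_ne_zero hδx hδx

theorem divWithin_eq_divChart (μ : VolumeForm k M) (hφ : φ ∈ AT) {D C : Set M} (hD : IsOpen D)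
    (hDC : D ⊆ C) {v : VField k M} (hv : SmoothVFieldOn v D) {x : M} (hxD : x ∈ D)
    (hx : x ∈ φ.source) : divWithin μ C v x = divChart μ φ v x := by
  rw [divWithin_eq_divChart_chartAt μ (mem_of_superset (hD.mem_nhds hxD) hDC)]
  exact divChart_eq μ (IsManifold.chart_mem_maximalAtlas x) hφ hD hv (mem_chart_source _ x) hx hxD

/-- The divergence theorem on one side of `Γ`, for fields supported in an adapted chart. -/
theorem Sheet.IsSide.setIntegral_div_add_d {ε : ℝ} {D C : Set M} (hS : S.IsSide ε D C)
    (μ : VolumeForm k M) (hφ : φ ∈ S.adaptedCharts) {P : M → ℝ} {v : VField k M}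
    (hP : ContMDiffOn (𝓡 (k + 1)) 𝓘(ℝ, ℝ) ∞ P C) (hv : SmoothVFieldOn v C) {K : Set M}
    (hK : IsCompact K) (hKφ : K ⊆ φ.source) (hP0 : ∀ x ∉ K, P x = 0) :
    ∫ x in D, (P x * divWithin μ C v x + dWithin C P x (v x)) ∂μ.measure =
      ε * ∫ z, chartFlux μ φ P v 0 (incl z) := by
  have h1 := VortexSheet.setIntegral_div_add_d μ hφ.1 (D := D) (C := C)
    (Ho := {y | ε * y 0 < 0}) hS.isOpen hS.subset
    (isOpen_lt (by fun_prop) continuous_const) (hS.preimage_D hφ)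
    (hP.mono inter_subset_right) (v := v)
    (hv.mono (inter_subset_right.trans hS.subset)) hK hKφ hP0
  rw [← integral_divergence_halfSpace hS.sign (F := chartFlux μ φ P v) (fun i => ?_)
    (isCompact_image_chart hK hKφ) (fun i y hy => chartFlux_eq_zero μ hP0 i hy), ← h1]
  · refine setIntegral_congr_fun hS.isOpen.measurableSet fun x hx => ?_
    by_cases hxφ : x ∈ φ.source
    · simp only [divWithin_eq_divChart μ hφ.1 hS.isOpen hS.subset (hv.mono hS.subset) hx hxφ]
    · simp only [hP0 x fun h => hxφ (hKφ h), zero_mul]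
  · refine contDiffOn_chartFlux μ hφ.1 hK hKφ hP0 ?_ ?_ i
    · rw [← hS.preimage_C hφ]
      exact contDiffOn_comp_symm hφ.1 (hP.mono inter_subset_right)
    · rw [← hS.preimage_C hφ]
      exact contDiffOn_fieldInChart hφ.1 hv

end Invariance

/-! ### Integrability on an open region of functions continuous up to its boundary -/

section Integrability

/-- `g` is on `D` locally the restriction of functions which are continuous on `C`. -/
def ExtendsContinuously {X : Type*} [TopologicalSpace X] (D C : Set X) (g : X → ℝ) : Prop :=
  ∀ p, ∃ U ∈ 𝓝 p, ∃ e : X → ℝ, ContinuousOn e (U ∩ C) ∧ EqOn g e (U ∩ D)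

namespace ExtendsContinuously

variable {X : Type*} [TopologicalSpace X] {D C : Set X} {f g : X → ℝ}

theorem of_continuousOn (hg : ContinuousOn g C) : ExtendsContinuously D C g := fun _ =>
  ⟨univ, univ_mem, g, hg.mono inter_subset_right, fun _ _ => rfl⟩

theorem add (hf : ExtendsContinuously D C f) (hg : ExtendsContinuously D C g) :
    ExtendsContinuously D C fun x => f x + g x := by
  intro p
  obtain ⟨U, hU, a, ha, hfa⟩ := hf p
  obtain ⟨V, hV, b, hb, hgb⟩ := hg p
  refine ⟨U ∩ V, inter_mem hU hV, fun x => a x + b x, ?_, fun x hx => ?_⟩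
  · exact (ha.mono (inter_subset_inter_left _ inter_subset_left)).add
      (hb.mono (inter_subset_inter_left _ inter_subset_right))
  · show f x + g x = a x + b x
    rw [hfa ⟨hx.1.1, hx.2⟩, hgb ⟨hx.1.2, hx.2⟩]

theorem mul (hf : ExtendsContinuously D C f) (hg : ExtendsContinuously D C g) :
    ExtendsContinuously D C fun x => f x * g x := by
  intro p
  obtain ⟨U, hU, a, ha, hfa⟩ := hf p
  obtain ⟨V, hV, b, hb, hgb⟩ := hg p
  refine ⟨U ∩ V, inter_mem hU hV, fun x => a x * b x, ?_, fun x hx => ?_⟩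
  · exact (ha.mono (inter_subset_inter_left _ inter_subset_left)).mul
      (hb.mono (inter_subset_inter_left _ inter_subset_right))
  · show f x * g x = a x * b x
    rw [hfa ⟨hx.1.1, hx.2⟩, hgb ⟨hx.1.2, hx.2⟩]

/-- Each local extension is continuous on the compact set `N ∩ C`, hence integrable there. Finitely
many such neighbourhoods cover `K`. -/
theorem integrableOn [T2Space X] [LocallyCompactSpace X] [MeasurableSpace X] [BorelSpace X]
    {ν : Measure X} [IsLocallyFiniteMeasure ν] (hg : ExtendsContinuously D C g)
    (hD : MeasurableSet D) (hC : IsClosed C) (hDC : D ⊆ C) {K : Set X} (hK : IsCompact K)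
    (h0 : ∀ x ∈ D, x ∉ K → g x = 0) : IntegrableOn g D ν := by
  have h1 : IntegrableOn g (K ∩ D) ν := by
    refine hK.induction_on (p := fun s => IntegrableOn g (s ∩ D) ν) (by simp)
      (fun s t hst ht => ht.mono_set (inter_subset_inter_left _ hst))
      (fun s t hs ht => by rw [union_inter_distrib_right]; exact hs.union ht) fun x _ => ?_
    obtain ⟨U, hU, e, he, hge⟩ := hg x
    obtain ⟨N, hN, hNU, hNc⟩ := local_compact_nhds hU
    refine ⟨N, mem_nhdsWithin_of_mem_nhds hN, ?_⟩
    have h2 : IntegrableOn e (N ∩ C) ν :=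
      (he.mono (inter_subset_inter_left _ hNU)).integrableOn_compact (hNc.inter_right hC)
    exact (h2.mono_set (inter_subset_inter_right _ hDC)).congr_fun
      (fun z hz => (hge ⟨hNU hz.1, hz.2⟩).symm) (hNc.measurableSet.inter hD)
  refine h1.of_forall_sdiff_eq_zero hD fun x hx => h0 x hx.1 fun h => hx.2 ⟨h, hx.1⟩

end ExtendsContinuously

end Integrability

/-! ### Smoothness up to `Γ`, one-forms in charts, and the Lie bracket in charts -/

section Fields

variable {k : ℕ} {M : Type*} [TopologicalSpace M] [ChartedSpace (Coord k) M]
  [IsManifold (𝓡 (k + 1)) ∞ M]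

local notation "AT" => IsManifold.maximalAtlas (𝓡 (k + 1)) ∞ M

variable {S : Sheet k M} {φ ψ : OpenPartialHomeomorph M (Coord k)} {D C : Set M} {ε : ℝ}

theorem contMDiffOn_oneForm_apply {m : OneForm k M} {v : VField k M} {s : Set M}
    (hm : SmoothOneFormOn m s) (hv : SmoothVFieldOn v s) :
    ContMDiffOn (𝓡 (k + 1)) 𝓘(ℝ, ℝ) ∞ (fun x => m x (v x)) s := by
  intro x hx
  have := ContMDiffWithinAt.clm_bundle_apply (hm x hx) (hv x hx)
  simp only [Bundle.contMDiffWithinAt_totalSpace] at this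
  exact this.2

theorem contMDiffOn_dWithin_apply {h : M → ℝ} {v : VField k M} {s : Set M}
    (hs : UniqueMDiffOn (𝓡 (k + 1)) s)
    (hh : ContMDiffOn (𝓡 (k + 1)) 𝓘(ℝ, ℝ) ∞ h s) (hv : SmoothVFieldOn v s) :
    ContMDiffOn (𝓡 (k + 1)) 𝓘(ℝ, ℝ) ∞ (fun x => dWithin s h x (v x)) s := by
  have h2 := hh.contMDiffOn_tangentMapWithin (m := ∞) (by simp) hs
  have h3 : ContMDiffOn (𝓡 (k + 1)) (𝓘(ℝ, ℝ).tangent) ∞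
      (fun x => tangentMapWithin (𝓡 (k + 1)) 𝓘(ℝ, ℝ) h s
        (⟨x, v x⟩ : TangentBundle (𝓡 (k + 1)) M)) s :=
    h2.comp hv fun x hx => hx
  intro x hx
  have h4 := (Bundle.contMDiffWithinAt_totalSpace.1 (h3 x hx)).2
  refine h4.congr (fun z hz => ?_) ?_
  · simp [tangentMapWithin, dWithin]
    rfl
  · simp [tangentMapWithin, dWithin]
    rfl

/-- The definition of `divWithin` uses a chart that jumps with the point. On `D` chart independence
replaces it by one fixed adapted chart, where the one-sided derivatives are continuous up to `Γ`.
Nothing is claimed at the points of `Γ` themselves. -/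
theorem Sheet.IsSide.extendsContinuously_divWithin [T2Space M] [MeasurableSpace M] [BorelSpace M]
    (hS : S.IsSide ε D C) (μ : VolumeForm k M)
    {v : VField k M} (hv : SmoothVFieldOn v C) :
    ExtendsContinuously D C (divWithin μ C v) := by
  intro p
  obtain ⟨φ, hφ, hp⟩ := S.exists_adaptedChart p
  have hud : UniqueDiffOn ℝ (φ.target ∩ φ.symm ⁻¹' C) := by
    rw [hS.preimage_C hφ]; exact hS.uniqueDiffOn
  have hm : MapsTo φ (φ.source ∩ C) (φ.target ∩ φ.symm ⁻¹' C) := fun x hx =>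
    ⟨φ.map_source hx.1, by rw [mem_preimage, φ.left_inv hx.1]; exact hx.2⟩
  have hφc : ContinuousOn φ (φ.source ∩ C) := φ.continuousOn.mono inter_subset_left
  have hV := contDiffOn_fieldInChart hφ.1 hv
  refine ⟨φ.source, φ.open_source.mem_nhds hp, fun x => (μ.coeff φ (φ x))⁻¹ * ∑ i : Fin (k + 1),
    fderivWithin ℝ (fun y => μ.coeff φ y * fieldInChart φ v y i) (φ.target ∩ φ.symm ⁻¹' C) (φ x)
      (EuclideanSpace.single i 1), ?_, fun x hx => ?_⟩
  · refine ContinuousOn.mul ?_ (continuousOn_finsetSum _ fun i _ => ?_)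
    · refine (((μ.contDiffOn_coeff hφ.1).continuousOn.mono inter_subset_left).comp hφc hm).inv₀ ?_
      exact fun x hx => μ.coeff_ne_zero hφ.1 (φ.map_source hx.1)
    · have h1 : ContDiffOn ℝ ∞ (fun y => μ.coeff φ y * fieldInChart φ v y i)
          (φ.target ∩ φ.symm ⁻¹' C) :=
        ((μ.contDiffOn_coeff hφ.1).mono inter_subset_left).mul ((contDiffOn_euclidean.1 hV) i)
      exact (((h1.continuousOn_fderivWithin hud (by simp)).comp hφc hm).clm_apply
        continuousOn_const)
  · rw [divWithin_eq_divChart μ hφ.1 hS.isOpen hS.subset (hv.mono hS.subset) hx.2 hx.1, divChart]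
    have hO : φ.target ∩ φ.symm ⁻¹' D ∈ 𝓝 (φ x) :=
      (φ.symm.isOpen_inter_preimage hS.isOpen).mem_nhds
        ⟨φ.map_source hx.1, by rw [mem_preimage, φ.left_inv hx.1]; exact hx.2⟩
    have hO' : φ.target ∩ φ.symm ⁻¹' C ∈ 𝓝 (φ x) :=
      mem_of_superset hO (inter_subset_inter_right _ (preimage_mono hS.subset))
    simp only [fderivWithin_of_mem_nhds hO']

theorem inChart_eq (m : OneForm k M) (hφ : φ ∈ AT) {y : Coord k} (hy : y ∈ φ.target) :
    m.inChart φ y = (m (φ.symm y)).comp (chartFrame φ (φ.symm y)) := by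
  rw [OneForm.inChart, ← mfderiv_symm_eq_chartFrame hφ hy]

theorem inChart_fieldInChart (m : OneForm k M) (hφ : φ ∈ AT) {y : Coord k} (hy : y ∈ φ.target)
    (v : VField k M) : m.inChart φ y (fieldInChart φ v y) = m (φ.symm y) (v (φ.symm y)) := by
  rw [inChart_eq m hφ hy]
  exact congrArg (m (φ.symm y)) (chartFrame_chartDeriv hφ (φ.map_target hy) _)

/-- Smoothness of a section of the cotangent bundle is tested in the trivialization at `x`, which is
the one induced by `chartAt`. There the section reads as `m.inChart`. -/
theorem differentiableAt_inChart {m : OneForm k M} {s : Set M} (hm : SmoothOneFormOn m s) {x : M}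
    (hs : s ∈ 𝓝 x) :
    DifferentiableAt ℝ (m.inChart (chartAt (Coord k) x)) (chartAt (Coord k) x x) := by
  have h1 := (contMDiffWithinAt_hom_bundle _).1 (hm x (mem_of_mem_nhds hs))
  have h2 := h1.2.contMDiffAt hs
  set φ := chartAt (Coord k) x with hφd
  have hφ : φ ∈ AT := IsManifold.chart_mem_maximalAtlas x
  have hx : x ∈ φ.source := mem_chart_source _ x
  have h3 := (contMDiffAt_symm_of_mem_maximalAtlas hφ (φ.map_source hx))
  have h4 := ContMDiffAt.comp (φ x) (by rwa [φ.left_inv hx]) h3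
  have h5 := (contMDiffAt_iff_contDiffAt.1 h4).differentiableAt (by simp)
  refine h5.congr_of_eventuallyEq ?_
  filter_upwards [φ.open_target.mem_nhds (φ.map_source hx)] with y hy
  have hys := φ.map_target hy
  rw [inChart_eq m hφ hy, ← mfderiv_symm_eq_chartFrame hφ hy]
  ext w
  simp only [Function.comp, ContinuousLinearMap.inCoordinates]
  have e1 : (trivializationAt (Coord k) (TangentSpace (𝓡 (k + 1))) x).symmL ℝ (φ.symm y) =
      (mfderiv 𝓘(ℝ, Coord k) (𝓡 (k + 1)) φ.symm y : Coord k →L[ℝ] _) := by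
    rw [TangentBundle.symmL_trivializationAt hys]
    simp only [modelWithCornersSelf_coe, range_id, mfderivWithin_univ, extChartAt_coe,
      extChartAt_coe_symm, modelWithCornersSelf_coe_symm, Function.comp_id, Function.id_comp]
    have e2 : ∀ z, z = y → (mfderiv 𝓘(ℝ, Coord k) (𝓡 (k + 1)) φ.symm z : Coord k →L[ℝ] Coord k) =
        mfderiv 𝓘(ℝ, Coord k) (𝓡 (k + 1)) φ.symm y := by rintro z rfl; rfl
    exact e2 _ (φ.right_inv hy)
  rw [e1]
  simp

theorem mlieBracketWithin_eq {v w : VField k M} {x : M} {s : Set M} (hs : s ∈ 𝓝 x) :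
    VectorField.mlieBracketWithin (𝓡 (k + 1)) v w s x =
      chartFrame (chartAt (Coord k) x) x
        (fderiv ℝ (fieldInChart (chartAt (Coord k) x) w) (chartAt (Coord k) x x)
            (fieldInChart (chartAt (Coord k) x) v (chartAt (Coord k) x x)) -
          fderiv ℝ (fieldInChart (chartAt (Coord k) x) v) (chartAt (Coord k) x x)
            (fieldInChart (chartAt (Coord k) x) w (chartAt (Coord k) x x))) := by
  rw [VectorField.mlieBracketWithin_of_mem_nhds hs, ← VectorField.mlieBracketWithin_univ,
    VectorField.mlieBracketWithin_apply]
  have hev : ∀ u : VField k M, VectorField.mpullback (𝓡 (k + 1)) (𝓡 (k + 1))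
      (chartAt (Coord k) x).symm u =ᶠ[𝓝 (chartAt (Coord k) x x)]
        fieldInChart (chartAt (Coord k) x) u := by
    intro u
    have hφ : chartAt (Coord k) x ∈ AT := IsManifold.chart_mem_maximalAtlas x
    filter_upwards [(chartAt (Coord k) x).open_target.mem_nhds (mem_chart_target _ x)] with y hy
    obtain ⟨e, he⟩ := exists_equiv_chartDeriv hφ ((chartAt (Coord k) x).map_target hy)
    have h1 := mfderiv_symm_eq_chartFrame hφ hy
    rw [chartFrame, ← he, ContinuousLinearMap.inverse_equiv] at h1
    rw [VectorField.mpullback_apply, fieldInChart, ← he]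
    have h2 := (congrArg ContinuousLinearMap.inverse h1).trans
      (ContinuousLinearMap.inverse_equiv e.symm)
    exact DFunLike.congr_fun h2 _
  have h3 := ((hev v).lieBracket_vectorField_eq (𝕜 := ℝ) (hev w))
  have h4 := (congrFun (VectorField.lieBracketWithin_univ (𝕜 := ℝ)) _).trans h3
  simp
  rw [← map_sub]
  exact congrArg (chartFrame (chartAt (Coord k) x) x) h4

end Fields

/-! ### Cartan's formula and linearity of the differential operators -/

section Sides

variable {k : ℕ} {M : Type*} [TopologicalSpace M] [ChartedSpace (Coord k) M]
  [IsManifold (𝓡 (k + 1)) ∞ M]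

local notation "AT" => IsManifold.maximalAtlas (𝓡 (k + 1)) ∞ M

variable {S : Sheet k M} {φ ψ : OpenPartialHomeomorph M (Coord k)} {D C : Set M} {ε : ℝ}

theorem preimage_mem_nhds_chart {x : M} (hx : x ∈ φ.source) {s : Set M} (hs : s ∈ 𝓝 x) :
    φ.target ∩ φ.symm ⁻¹' s ∈ 𝓝 (φ x) := by
  refine inter_mem (φ.open_target.mem_nhds (φ.map_source hx)) ?_
  refine (φ.continuousAt_symm (φ.map_source hx)).preimage_mem_nhds ?_
  rwa [φ.left_inv hx]

theorem fieldInChart_apply {x : M} (hx : x ∈ φ.source) (v : VField k M) :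
    fieldInChart φ v (φ x) = chartDeriv φ x (v x) := by
  rw [fieldInChart, φ.left_inv hx]

theorem differentiableAt_fieldInChart (hφ : φ ∈ AT) {x : M} (hx : x ∈ φ.source) {s : Set M}
    (hs : s ∈ 𝓝 x) {v : VField k M} (hv : SmoothVFieldOn v s) :
    DifferentiableAt ℝ (fieldInChart φ v) (φ x) :=
  ((contDiffOn_fieldInChart hφ hv).contDiffAt (preimage_mem_nhds_chart hx hs)).differentiableAt
    (by simp)

/-- Cartan's formula `dm(v, u) = v(m(u)) - u(m(v)) - m([v, u])`. -/
theorem oneForm_mlieBracketWithin {m : OneForm k M} {v u : VField k M} {x : M} {s : Set M}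
    (hs : s ∈ 𝓝 x) (hm : SmoothOneFormOn m s) (hv : SmoothVFieldOn v s)
    (hu : SmoothVFieldOn u s) :
    m x (VectorField.mlieBracketWithin (𝓡 (k + 1)) v u s x) =
      dWithin s (fun z => m z (u z)) x (v x) - dWithin s (fun z => m z (v z)) x (u x) -
        interiorExtDerivWithin s m v x (u x) := by
  have hφ : chartAt (Coord k) x ∈ AT := IsManifold.chart_mem_maximalAtlas x
  have hx : x ∈ (chartAt (Coord k) x).source := mem_chart_source _ x
  have hdm := differentiableAt_inChart hm hs
  rw [mlieBracketWithin_eq hs]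
  -- The product rule in the chart, `d(m(w))(w') = (D_{w'} m)(w) + m(D_{w'} w)`. Antisymmetrizing,
  -- the first terms make up `dm` and the second the bracket.
  have hd : ∀ w w' : VField k M, SmoothVFieldOn w s → SmoothVFieldOn w' s →
      dWithin s (fun z => m z (w z)) x (w' x) =
        fderiv ℝ (m.inChart (chartAt (Coord k) x)) (chartAt (Coord k) x x)
          (chartDeriv (chartAt (Coord k) x) x (w' x)) (chartDeriv (chartAt (Coord k) x) x (w x)) +
        m x (chartFrame (chartAt (Coord k) x) x
          (fderiv ℝ (fieldInChart (chartAt (Coord k) x) w) (chartAt (Coord k) x x)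
            (chartDeriv (chartAt (Coord k) x) x (w' x)))) := by
    intro w w' hw hw'
    generalize chartAt (Coord k) x = φ at *
    have h1 : MDifferentiableAt (𝓡 (k + 1)) 𝓘(ℝ, ℝ) (fun z => m z (w z)) (φ.symm (φ x)) := by
      rw [φ.left_inv hx]
      exact ((contMDiffOn_oneForm_apply hm hw).contMDiffAt hs).mdifferentiableAt (by simp)
    have h2 := fderiv_comp_symm_fieldInChart hφ (φ.map_source hx) h1 (s := s)
      (by rwa [φ.left_inv hx]) w'
    rw [φ.left_inv hx, fieldInChart_apply hx] at h2
    rw [← h2]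
    have h3 : (fun z => m (φ.symm z) (w (φ.symm z))) =ᶠ[𝓝 (φ x)]
        fun z => m.inChart φ z (fieldInChart φ w z) := by
      filter_upwards [φ.open_target.mem_nhds (φ.map_source hx)] with z hz
      exact (inChart_fieldInChart m hφ hz w).symm
    have hdw := differentiableAt_fieldInChart hφ hx hs hw
    rw [h3.fderiv_eq, (hdm.hasFDerivAt.clm_apply hdw.hasFDerivAt).fderiv]
    have h4 : ∀ c, m.inChart φ (φ x) c = m x (chartFrame φ x c) := by
      intro c
      rw [inChart_eq m hφ (φ.map_source hx), φ.left_inv hx]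
      rfl
    simp only [add_apply, ContinuousLinearMap.comp_apply, ContinuousLinearMap.flip_apply, h4,
      fieldInChart_apply hx]
    ring
  rw [hd u v hu hv, hd v u hv hu, interiorExtDerivWithin]
  simp only [fderivWithin_of_mem_nhds (preimage_mem_nhds_chart hx hs), fieldInChart_apply hx]
  rw [map_sub, map_sub]
  simp only [ContinuousLinearMap.comp_apply, sub_apply, ContinuousLinearMap.flip_apply]
  ring

/-- Smoothness up to `Γ` is what is wanted here: it makes the bracket term integrable over the open
side. -/
theorem contMDiffOn_oneForm_mlieBracketWithin {m : OneForm k M} {v u : VField k M} {s : Set M}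
    (hs : UniqueMDiffOn (𝓡 (k + 1)) s) (hm : SmoothOneFormOn m s) (hv : SmoothVFieldOn v s)
    (hu : SmoothVFieldOn u s) :
    ContMDiffOn (𝓡 (k + 1)) 𝓘(ℝ, ℝ) ∞
      (fun x => m x (VectorField.mlieBracketWithin (𝓡 (k + 1)) v u s x)) s := by
  have : IsManifold (𝓡 (k + 1)) (minSmoothness ℝ 2) M := by
    rw [minSmoothness_of_isRCLikeNormedField]
    exact IsManifold.of_le (n := ∞) (show ((2 : ℕ∞) : ℕ∞ω) ≤ ∞ from WithTop.coe_le_coe.2 le_top)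
  have : IsManifold (𝓡 (k + 1)) (((⊤ : ℕ∞) : ℕ∞ω) + 1) M := ‹IsManifold (𝓡 (k + 1)) ∞ M›
  refine contMDiffOn_oneForm_apply hm ?_
  exact ContMDiffOn.mlieBracketWithin_vectorField (m := ⊤) (n := ⊤) hv hu hs
    (by rw [minSmoothness_of_isRCLikeNormedField]; exact le_rfl)

variable [T2Space M] [MeasurableSpace M] [BorelSpace M]

theorem divWithin_eq_zero (μ : VolumeForm k M) {v : VField k M} {x : M} {s : Set M} (hs : s ∈ 𝓝 x)
    (hv : ∀ᶠ z in 𝓝 x, v z = 0) : divWithin μ s v x = 0 := by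
  rw [divWithin_eq_divChart_chartAt μ hs, divChart, Finset.sum_eq_zero, mul_zero]
  intro i _
  have hx := mem_chart_source (Coord k) x
  have h1 : (fun y => μ.coeff (chartAt (Coord k) x) y * fieldInChart (chartAt (Coord k) x) v y i)
      =ᶠ[𝓝 (chartAt (Coord k) x x)] fun _ => 0 := by
    filter_upwards [preimage_mem_nhds_chart hx hv] with y hy
    have : v ((chartAt (Coord k) x).symm y) = 0 := hy.2
    simp [fieldInChart, this]
  rw [h1.fderiv_eq]
  simp

theorem divWithin_add (μ : VolumeForm k M) {v w : VField k M} {x : M} {s : Set M} (hs : s ∈ 𝓝 x)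
    (hv : SmoothVFieldOn v s) (hw : SmoothVFieldOn w s) :
    divWithin μ s (v + w) x = divWithin μ s v x + divWithin μ s w x := by
  simp only [divWithin_eq_divChart_chartAt μ hs]
  have hx := mem_chart_source (Coord k) x
  have hφ : chartAt (Coord k) x ∈ AT := IsManifold.chart_mem_maximalAtlas x
  have h1 := differentiableAt_fieldInChart hφ hx hs hv
  have h2 := differentiableAt_fieldInChart hφ hx hs hw
  have h3 : DifferentiableAt ℝ (μ.coeff (chartAt (Coord k) x)) (chartAt (Coord k) x x) :=
    ((μ.contDiffOn_coeff hφ).contDiffAt ((chartAt (Coord k) x).open_target.mem_nhds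
      (mem_chart_target _ x))).differentiableAt (by simp)
  generalize chartAt (Coord k) x = φ at *
  rw [divChart, divChart, divChart, ← mul_add, ← Finset.sum_add_distrib]
  congr 1
  refine Finset.sum_congr rfl fun i _ => ?_
  have h4 : (fun y => μ.coeff φ y * fieldInChart φ (v + w) y i) =
      fun y => μ.coeff φ y * fieldInChart φ v y i + μ.coeff φ y * fieldInChart φ w y i := by
    ext y
    have : fieldInChart φ (v + w) y = fieldInChart φ v y + fieldInChart φ w y :=
      (chartDeriv φ (φ.symm y)).map_add _ _
    rw [this, PiLp.add_apply, mul_add]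
  have h5 : HasFDerivAt (fun y => μ.coeff φ y * fieldInChart φ v y i +
      μ.coeff φ y * fieldInChart φ w y i) _ (φ x) :=
    (h3.mul ((differentiableAt_euclidean.1 h1) i)).hasFDerivAt.add
      (h3.mul ((differentiableAt_euclidean.1 h2) i)).hasFDerivAt
  rw [h4, h5.fderiv]
  rfl

theorem divWithin_smul (μ : VolumeForm k M) (c : ℝ) {v : VField k M} {x : M} {s : Set M}
    (hs : s ∈ 𝓝 x) (hv : SmoothVFieldOn v s) :
    divWithin μ s (c • v) x = c * divWithin μ s v x := by
  simp only [divWithin_eq_divChart_chartAt μ hs]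
  have hx := mem_chart_source (Coord k) x
  have hφ : chartAt (Coord k) x ∈ AT := IsManifold.chart_mem_maximalAtlas x
  have h1 := differentiableAt_fieldInChart hφ hx hs hv
  have h3 : DifferentiableAt ℝ (μ.coeff (chartAt (Coord k) x)) (chartAt (Coord k) x x) :=
    ((μ.contDiffOn_coeff hφ).contDiffAt ((chartAt (Coord k) x).open_target.mem_nhds
      (mem_chart_target _ x))).differentiableAt (by simp)
  generalize chartAt (Coord k) x = φ at *
  rw [divChart, divChart, mul_left_comm]
  congr 1
  rw [Finset.mul_sum]
  refine Finset.sum_congr rfl fun i _ => ?_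
  have h4 : (fun y => μ.coeff φ y * fieldInChart φ (c • v) y i) =
      fun y => c * (μ.coeff φ y * fieldInChart φ v y i) := by
    ext y
    have : fieldInChart φ (c • v) y = c • fieldInChart φ v y :=
      (chartDeriv φ (φ.symm y)).map_smul _ _
    rw [this, PiLp.smul_apply, smul_eq_mul]
    ring
  have h5 : HasFDerivAt (fun y => c * (μ.coeff φ y * fieldInChart φ v y i)) _ (φ x) :=
    (h3.mul ((differentiableAt_euclidean.1 h1) i)).hasFDerivAt.const_mul c
  rw [h4, h5.fderiv]
  rfl

theorem dWithin_add {f g : M → ℝ} {x : M} {s : Set M} (hs : s ∈ 𝓝 x)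
    (hf : ContMDiffOn (𝓡 (k + 1)) 𝓘(ℝ, ℝ) ∞ f s) (hg : ContMDiffOn (𝓡 (k + 1)) 𝓘(ℝ, ℝ) ∞ g s)
    (w : TangentSpace (𝓡 (k + 1)) x) :
    dWithin s (fun z => f z + g z) x w = dWithin s f x w + dWithin s g x w := by
  have h1 := ((hf.contMDiffAt hs).mdifferentiableAt (by simp)).hasMFDerivAt
  have h2 := ((hg.contMDiffAt hs).mdifferentiableAt (by simp)).hasMFDerivAt
  simp only [dWithin, mfderivWithin_of_mem_nhds hs]
  exact DFunLike.congr_fun (h1.add h2).mfderiv w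

theorem dWithin_const_mul (c : ℝ) {f : M → ℝ} {x : M} {s : Set M} (hs : s ∈ 𝓝 x)
    (hf : ContMDiffOn (𝓡 (k + 1)) 𝓘(ℝ, ℝ) ∞ f s) (w : TangentSpace (𝓡 (k + 1)) x) :
    dWithin s (fun z => c * f z) x w = c * dWithin s f x w := by
  have h1 := ((hf.contMDiffAt hs).mdifferentiableAt (by simp)).hasMFDerivAt
  simp only [dWithin, mfderivWithin_of_mem_nhds hs]
  exact DFunLike.congr_fun (h1.const_smul c).mfderiv w

theorem dWithin_mul {f g : M → ℝ} {x : M} {s : Set M} (hs : s ∈ 𝓝 x)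
    (hf : ContMDiffOn (𝓡 (k + 1)) 𝓘(ℝ, ℝ) ∞ f s) (hg : ContMDiffOn (𝓡 (k + 1)) 𝓘(ℝ, ℝ) ∞ g s)
    (w : TangentSpace (𝓡 (k + 1)) x) :
    dWithin s (fun z => f z * g z) x w = f x * dWithin s g x w + g x * dWithin s f x w := by
  have h1 := ((hf.contMDiffAt hs).mdifferentiableAt (by simp)).hasMFDerivAt
  have h2 := ((hg.contMDiffAt hs).mdifferentiableAt (by simp)).hasMFDerivAt
  simp only [dWithin, mfderivWithin_of_mem_nhds hs]
  exact DFunLike.congr_fun (h1.mul h2).mfderiv w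

end Sides

/-! ### Finite partitions of unity subordinate to adapted charts -/

section Partition

variable {k : ℕ} {M : Type*} [TopologicalSpace M] [ChartedSpace (Coord k) M]
  [IsManifold (𝓡 (k + 1)) ∞ M]

/-- A finite smooth partition of unity near `K`, subordinate to adapted charts. -/
structure Sheet.ChartPartition (S : Sheet k M) (K : Set M) where
  index : Finset M
  chart : M → OpenPartialHomeomorph M (Coord k)
  fn : M → M → ℝ
  chart_mem : ∀ i, chart i ∈ S.adaptedCharts
  contMDiff : ∀ i, ContMDiff (𝓡 (k + 1)) 𝓘(ℝ, ℝ) ∞ (fn i)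
  isCompact : ∀ i, IsCompact (tsupport (fn i))
  tsupport_subset : ∀ i, tsupport (fn i) ⊆ (chart i).source
  nonneg : ∀ i x, 0 ≤ fn i x
  sum_eq_one : ∀ x ∈ K, ∀ᶠ z in 𝓝 x, ∑ i ∈ index, fn i z = 1

/-- The partition is taken on a compact `K'` whose interior contains `K`. The sum is then `1` on a
neighbourhood of each point of `K`, so its differential vanishes there; local finiteness leaves
finitely many indices. -/
theorem Sheet.nonempty_chartPartition [T2Space M] [SigmaCompactSpace M] (S : Sheet k M) {K : Set M}
    (hK : IsCompact K) : Nonempty (S.ChartPartition K) := by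
  have : LocallyCompactSpace M := ChartedSpace.locallyCompactSpace (Coord k) M
  choose chart hchart hmem using S.exists_adaptedChart
  have h1 : ∀ p, ∃ L : Set M, IsCompact L ∧ p ∈ interior L ∧ L ⊆ (chart p).source := fun p =>
    exists_compact_subset (chart p).open_source (hmem p)
  choose L hL hpL hLs using h1
  obtain ⟨K', hK', hKK'⟩ := exists_compact_superset hK
  obtain ⟨f, hf⟩ := SmoothPartitionOfUnity.exists_isSubordinate (𝓡 (k + 1)) hK'.isClosed
    (fun p => interior (L p)) (fun p => isOpen_interior) fun x _ => mem_iUnion.2 ⟨x, hpL x⟩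
  have hfin := f.locallyFinite.finite_nonempty_inter_compact hK'
  refine ⟨⟨hfin.toFinset, chart, fun i => f i, hchart, fun i => (f i).contMDiff, fun i => ?_,
    fun i => ?_, fun i x => f.nonneg i x, fun x hx => ?_⟩⟩
  · exact (hL i).of_isClosed_subset (isClosed_tsupport _) ((hf i).trans interior_subset)
  · exact ((hf i).trans interior_subset).trans (hLs i)
  · filter_upwards [isOpen_interior.mem_nhds (hKK' hx)] with z hz
    rw [← f.sum_eq_one (interior_subset hz)]
    refine (finsum_eq_sum_of_support_subset _ fun i hi => ?_).symm
    rw [Finset.mem_coe, Finite.mem_toFinset]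
    exact ⟨z, hi, interior_subset hz⟩

theorem Sheet.ChartPartition.eq_zero {S : Sheet k M} {K : Set M} (π : S.ChartPartition K) (i : M)
    {x : M} (hx : x ∉ tsupport (π.fn i)) : π.fn i x = 0 :=
  image_eq_zero_of_notMem_tsupport hx

end Partition

/-! ### The integral over `Γ` through a partition of unity, and its linearity -/

section IntegralΓ

variable {k : ℕ} {M : Type*} [TopologicalSpace M] [ChartedSpace (Coord k) M]
  [IsManifold (𝓡 (k + 1)) ∞ M]

variable {S : Sheet k M} {φ : OpenPartialHomeomorph M (Coord k)}

/-- Compactly supported continuous `k`-forms on `Γ`. -/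
def Sheet.GammaForm.IsContinuous (ξ : S.GammaForm) : Prop :=
  (∀ φ ∈ S.adaptedCharts, ContinuousOn (Sheet.GammaForm.coeff ξ φ) (sliceTarget φ)) ∧
    ∃ K : Set M, IsCompact K ∧ ∀ x ∉ K, ξ x = 0

theorem Sheet.GammaForm.coeff_add (ξ η : S.GammaForm) (φ : OpenPartialHomeomorph M (Coord k)) :
    coeff (ξ + η) φ = coeff ξ φ + coeff η φ := by
  ext y
  by_cases h : φ ∈ S.adaptedCharts ∧ y ∈ sliceTarget φ <;> simp [coeff, h]

theorem Sheet.GammaForm.coeff_smul (c : ℝ) (ξ : S.GammaForm)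
    (φ : OpenPartialHomeomorph M (Coord k)) : coeff (c • ξ) φ = c • coeff ξ φ := by
  ext y
  by_cases h : φ ∈ S.adaptedCharts ∧ y ∈ sliceTarget φ <;> simp [coeff, h]

theorem Sheet.GammaForm.coeff_fun_smul (n : M → ℝ) (ξ : S.GammaForm)
    (φ : OpenPartialHomeomorph M (Coord k)) (y : EuclideanSpace ℝ (Fin k)) :
    coeff (fun x => n x • ξ x : S.GammaForm) φ y = n (φ.symm (incl y)) * coeff ξ φ y := by
  by_cases h : φ ∈ S.adaptedCharts ∧ y ∈ sliceTarget φ <;> simp [coeff, h]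

theorem Sheet.GammaForm.IsContinuous.add {ξ η : S.GammaForm} (hξ : ξ.IsContinuous)
    (hη : η.IsContinuous) : Sheet.GammaForm.IsContinuous (ξ + η) := by
  obtain ⟨h1, K, hK, hξ0⟩ := hξ
  obtain ⟨h2, L, hL, hη0⟩ := hη
  refine ⟨fun φ hφ => ?_, K ∪ L, hK.union hL, fun x hx => ?_⟩
  · rw [coeff_add]; exact (h1 φ hφ).add (h2 φ hφ)
  · rw [mem_union, not_or] at hx
    simp [hξ0 x hx.1, hη0 x hx.2]

theorem Sheet.GammaForm.IsContinuous.smul (c : ℝ) {ξ : S.GammaForm} (hξ : ξ.IsContinuous) :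
    Sheet.GammaForm.IsContinuous (c • ξ) := by
  obtain ⟨h1, K, hK, hξ0⟩ := hξ
  refine ⟨fun φ hφ => ?_, K, hK, fun x hx => by simp [hξ0 x hx]⟩
  rw [coeff_smul]; exact (h1 φ hφ).const_smul c

theorem real_sign_eq_div {r : ℝ} (hr : r ≠ 0) : Real.sign r = r / |r| := by
  rcases lt_or_gt_of_ne hr with h | h
  · rw [Real.sign_of_neg h, abs_of_neg h, div_neg, div_self hr]
  · rw [Real.sign_of_pos h, abs_of_pos h, div_self hr]

/-- The sign of the nonvanishing coefficient `ρ` is `ρ / |ρ|`, which is continuous. -/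
theorem Sheet.GammaForm.continuousOn_orientedCoeff (μ : VolumeForm k M) {ξ : S.GammaForm}
    (hξ : ξ.IsContinuous) (hφ : φ ∈ S.adaptedCharts) :
    ContinuousOn (orientedCoeff μ ξ φ) (sliceTarget φ) := by
  have h1 : ContinuousOn (fun y => μ.coeff φ (incl y)) (sliceTarget φ) :=
    (μ.contDiffOn_coeff hφ.1).continuousOn.comp continuous_incl.continuousOn fun _ hy => hy
  refine ContinuousOn.mul ?_ (hξ.1 φ hφ)
  refine (h1.div h1.abs fun y hy => abs_ne_zero.2 (μ.coeff_ne_zero hφ.1 hy)).congr fun y hy => ?_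
  exact real_sign_eq_div (μ.coeff_ne_zero hφ.1 hy)

theorem Sheet.GammaForm.orientedCoeff_add (μ : VolumeForm k M) (ξ η : S.GammaForm)
    (φ : OpenPartialHomeomorph M (Coord k)) (y : EuclideanSpace ℝ (Fin k)) :
    orientedCoeff μ (ξ + η) φ y = orientedCoeff μ ξ φ y + orientedCoeff μ η φ y := by
  simp [orientedCoeff, coeff_add, mul_add]

theorem Sheet.GammaForm.orientedCoeff_smul (μ : VolumeForm k M) (c : ℝ) (ξ : S.GammaForm)
    (φ : OpenPartialHomeomorph M (Coord k)) (y : EuclideanSpace ℝ (Fin k)) :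
    orientedCoeff μ (c • ξ) φ y = c * orientedCoeff μ ξ φ y := by
  simp only [orientedCoeff, coeff_smul, Pi.smul_apply, smul_eq_mul]
  ring

theorem Sheet.GammaForm.orientedCoeff_neg (μ : VolumeForm k M) (ξ : S.GammaForm)
    (φ : OpenPartialHomeomorph M (Coord k)) (y : EuclideanSpace ℝ (Fin k)) :
    orientedCoeff μ (-ξ) φ y = -orientedCoeff μ ξ φ y := by
  rw [← neg_one_smul ℝ ξ, orientedCoeff_smul, neg_one_mul]

variable [T2Space M]

theorem integrableOn_slice {f : M → ℝ} (hf : Continuous f)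
    (hfK : IsCompact (tsupport f)) (hfφ : tsupport f ⊆ φ.source) {c : EuclideanSpace ℝ (Fin k) → ℝ}
    (hc : ContinuousOn c (sliceTarget φ)) :
    IntegrableOn (fun y => f (φ.symm (incl y)) * c y) (sliceTarget φ) := by
  -- `Q` is the trace of the support of `f` on `Γ` in slice coordinates. It is compact because it is
  -- an image of a compact set, cut by a closed condition.
  set Q : Set (EuclideanSpace ℝ (Fin k)) := tailL k '' (φ '' tsupport f ∩ {y | y 0 = 0}) with hQ
  have hQc : IsCompact Q :=
    (((hfK.image_of_continuousOn (φ.continuousOn.mono hfφ)).inter_right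
      (isClosed_eq (by fun_prop) continuous_const))).image (tailL k).continuous
  have hQs : Q ⊆ sliceTarget φ := by
    rintro _ ⟨_, ⟨⟨x, hx, rfl⟩, h0⟩, rfl⟩
    rw [sliceTarget, mem_ofPred_eq, incl_tailL h0]
    exact φ.map_source (hfφ hx)
  have hcont : ContinuousOn (fun y => f (φ.symm (incl y)) * c y) (sliceTarget φ) :=
    (hf.comp_continuousOn continuousOn_slice).mul hc
  refine ((hcont.mono hQs).integrableOn_compact hQc).of_forall_sdiff_eq_zero
    isOpen_sliceTarget.measurableSet fun y hy => ?_
  have : φ.symm (incl y) ∉ tsupport f := fun h => hy.2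
    ⟨incl y, ⟨⟨_, h, φ.right_inv hy.1⟩, rfl⟩, tailL_incl y⟩
  simp [image_eq_zero_of_notMem_tsupport this]

variable [MeasurableSpace M] [BorelSpace M]

/-- Each coordinate measure is carried by `K`, hence lies below the infinite measure restricted to
`K`; the supremum then does too. -/
theorem posMeasure_compl_eq_zero (μ : VolumeForm k M) {ξ : S.GammaForm} {K : Set M}
    (hK : IsCompact K) (h0 : ∀ x ∉ K, ξ x = 0) : Sheet.GammaForm.posMeasure μ ξ Kᶜ = 0 := by
  have hKm : MeasurableSet K := hK.isClosed.measurableSet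
  have h1 : Sheet.GammaForm.posMeasure μ ξ ≤ (⊤ : Measure M).restrict K := by
    refine iSup₂_le fun φ hφ => ?_
    change paramMeasure (sliceTarget φ) (Sheet.GammaForm.orientedCoeff μ ξ φ)
      (fun y => φ.symm (incl y)) ≤ _
    have h2 : paramMeasure (sliceTarget φ) (Sheet.GammaForm.orientedCoeff μ ξ φ)
        (fun y => φ.symm (incl y)) Kᶜ = 0 := by
      have hm := measurableSet_inter_preimage_of_continuousOn
        (isOpen_sliceTarget (φ := φ)).measurableSet continuousOn_slice hKm.compl
      rw [paramMeasure_apply isOpen_sliceTarget.measurableSet continuousOn_slice _ hKm.compl,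
        setLIntegral_congr_fun (g := fun _ => 0) hm]
      · simp
      · intro y hy
        simp [Sheet.GammaForm.orientedCoeff, Sheet.GammaForm.coeff_eq ξ hφ hy.1, h0 _ hy.2]
    rw [← Measure.restrict_eq_self_of_ae_mem (s := K) (μ := paramMeasure (sliceTarget φ)
      (Sheet.GammaForm.orientedCoeff μ ξ φ) (fun y => φ.symm (incl y)))]
    · exact Measure.restrict_mono le_rfl le_top
    · exact (measure_eq_zero_iff_ae_notMem.1 h2).mono fun x hx => by simpa using hx
  refine le_antisymm ((h1 _).trans ?_) bot_le
  rw [Measure.restrict_apply hKm.compl, compl_inter_self, measure_empty]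

theorem posMeasure_univ (μ : VolumeForm k M) {ξ : S.GammaForm} (hξ : ξ.IsContinuous) {K : Set M}
    (hK : IsCompact K) (h0 : ∀ x ∉ K, ξ x = 0) (π : S.ChartPartition K) :
    Sheet.GammaForm.posMeasure μ ξ univ = ∑ i ∈ π.index, ∫⁻ y in sliceTarget (π.chart i),
      ENNReal.ofReal (π.fn i ((π.chart i).symm (incl y)) *
        Sheet.GammaForm.orientedCoeff μ ξ (π.chart i) y) := by
  have hm : ∀ i, Measurable fun x => ENNReal.ofReal (π.fn i x) := fun i =>
    (π.contMDiff i).continuous.measurable.ennreal_ofReal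
  have h1 : Sheet.GammaForm.posMeasure μ ξ univ =
      ∫⁻ x, ∑ i ∈ π.index, ENNReal.ofReal (π.fn i x) ∂Sheet.GammaForm.posMeasure μ ξ := by
    rw [← lintegral_one]
    refine lintegral_congr_ae ?_
    filter_upwards [measure_eq_zero_iff_ae_notMem.1 (posMeasure_compl_eq_zero μ hK h0)] with x hx
    rw [← ENNReal.ofReal_sum_of_nonneg fun i _ => π.nonneg i x,
      (π.sum_eq_one x (by simpa using hx)).self_of_nhds, ENNReal.ofReal_one]
  rw [h1, lintegral_finsetSum _ fun i _ => hm i]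
  refine Finset.sum_congr rfl fun i _ => ?_
  have hs := (π.chart i).open_source.measurableSet
  have h2 : ∫⁻ x, ENNReal.ofReal (π.fn i x) ∂Sheet.GammaForm.posMeasure μ ξ =
      ∫⁻ x in (π.chart i).source, ENNReal.ofReal (π.fn i x) ∂Sheet.GammaForm.posMeasure μ ξ := by
    rw [← lintegral_indicator hs]
    refine lintegral_congr fun x => ?_
    by_cases hx : x ∈ (π.chart i).source
    · rw [indicator_of_mem hx]
    · rw [indicator_of_notMem hx, π.eq_zero i fun h => hx (π.tsupport_subset i h),
        ENNReal.ofReal_zero]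
  rw [h2, restrict_posMeasure μ ξ (π.chart_mem i), lintegral_paramMeasure
    isOpen_sliceTarget.measurableSet continuousOn_slice
    (Sheet.GammaForm.continuousOn_orientedCoeff μ hξ (π.chart_mem i)) (hm i)]
  refine lintegral_congr fun y => ?_
  rw [mul_comm, ENNReal.ofReal_mul (π.nonneg i _)]

/-- The definition by positive parts is not visibly linear in `ξ`, while the right-hand side is. In
each chart the two masses are the integrals of the positive and negative parts of one integrable
function. -/
theorem Sheet.GammaForm.IsContinuous.integralΓ_eq (μ : VolumeForm k M) {ξ : S.GammaForm}
    (hξ : ξ.IsContinuous) {K : Set M} (hK : IsCompact K) (h0 : ∀ x ∉ K, ξ x = 0)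
    (π : S.ChartPartition K) :
    S.integralΓ μ ξ = ∑ i ∈ π.index, ∫ y in sliceTarget (π.chart i),
      π.fn i ((π.chart i).symm (incl y)) * orientedCoeff μ ξ (π.chart i) y := by
  have hξ' : IsContinuous (-ξ) := by
    rw [← neg_one_smul ℝ ξ]; exact hξ.smul (-1)
  have hi : ∀ i, IntegrableOn (fun y => π.fn i ((π.chart i).symm (incl y)) *
      orientedCoeff μ ξ (π.chart i) y) (sliceTarget (π.chart i)) := fun i =>
    integrableOn_slice (π.contMDiff i).continuous (π.isCompact i)
      (π.tsupport_subset i) (continuousOn_orientedCoeff μ hξ (π.chart_mem i))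
  rw [Sheet.integralΓ, posMeasure_univ μ hξ hK h0 π,
    posMeasure_univ μ hξ' hK (fun x hx => by simp [h0 x hx]) π]
  simp only [orientedCoeff_neg, mul_neg]
  have hn : ∀ i ∈ π.index, (∫⁻ y in sliceTarget (π.chart i), ENNReal.ofReal
      (-(π.fn i ((π.chart i).symm (incl y)) * orientedCoeff μ ξ (π.chart i) y))) ≠ ⊤ :=
    fun i _ => (Integrable.lintegral_lt_top (hi i).neg).ne
  rw [ENNReal.toReal_sum fun i _ => (Integrable.lintegral_lt_top (hi i)).ne,
    ENNReal.toReal_sum hn, ← Finset.sum_sub_distrib]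
  refine Finset.sum_congr rfl fun i _ => ?_
  rw [integral_eq_lintegral_pos_part_sub_lintegral_neg_part (hi i)]

variable [SigmaCompactSpace M]

theorem Sheet.integralΓ_add (μ : VolumeForm k M) {ξ η : S.GammaForm} (hξ : ξ.IsContinuous)
    (hη : η.IsContinuous) : S.integralΓ μ (ξ + η) = S.integralΓ μ ξ + S.integralΓ μ η := by
  obtain ⟨K, hK, hξ0⟩ := hξ.2
  obtain ⟨L, hL, hη0⟩ := hη.2
  have hξ1 : ∀ x ∉ K ∪ L, ξ x = 0 := fun x hx => hξ0 x fun h => hx (Or.inl h)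
  have hη1 : ∀ x ∉ K ∪ L, η x = 0 := fun x hx => hη0 x fun h => hx (Or.inr h)
  obtain ⟨π⟩ := S.nonempty_chartPartition (hK.union hL)
  rw [hξ.integralΓ_eq μ (hK.union hL) hξ1 π, hη.integralΓ_eq μ (hK.union hL) hη1 π,
    (hξ.add hη).integralΓ_eq μ (hK.union hL) (fun x hx => by simp [hξ1 x hx, hη1 x hx]) π,
    ← Finset.sum_add_distrib]
  refine Finset.sum_congr rfl fun i _ => ?_
  simp only [GammaForm.orientedCoeff_add, mul_add]
  exact integral_add
    (integrableOn_slice (π.contMDiff i).continuous (π.isCompact i)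
      (π.tsupport_subset i) (GammaForm.continuousOn_orientedCoeff μ hξ (π.chart_mem i)))
    (integrableOn_slice (π.contMDiff i).continuous (π.isCompact i)
      (π.tsupport_subset i) (GammaForm.continuousOn_orientedCoeff μ hη (π.chart_mem i)))

theorem Sheet.integralΓ_smul (μ : VolumeForm k M) (c : ℝ) {ξ : S.GammaForm}
    (hξ : ξ.IsContinuous) : S.integralΓ μ (c • ξ) = c * S.integralΓ μ ξ := by
  obtain ⟨K, hK, hξ0⟩ := hξ.2
  obtain ⟨π⟩ := S.nonempty_chartPartition hK
  rw [hξ.integralΓ_eq μ hK hξ0 π,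
    (hξ.smul c).integralΓ_eq μ hK (fun x hx => by simp [hξ0 x hx]) π, Finset.mul_sum]
  refine Finset.sum_congr rfl fun i _ => ?_
  rw [← integral_const_mul]
  simp only [GammaForm.orientedCoeff_smul, mul_left_comm]

end IntegralΓ

/-! ### The divergence theorem on one side of `Γ` -/

section SideStokes

variable {k : ℕ} {M : Type*} [TopologicalSpace M] [ChartedSpace (Coord k) M]
  [IsManifold (𝓡 (k + 1)) ∞ M]

variable {S : Sheet k M} {D C K : Set M} {ε : ℝ}

variable [T2Space M] [MeasurableSpace M] [BorelSpace M]

theorem dWithin_sum {ι : Type*} (I : Finset ι) {f : ι → M → ℝ} {x : M} {s : Set M} (hs : s ∈ 𝓝 x)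
    (hf : ∀ i, ContMDiffOn (𝓡 (k + 1)) 𝓘(ℝ, ℝ) ∞ (f i) s) (w : TangentSpace (𝓡 (k + 1)) x) :
    dWithin s (fun z => ∑ i ∈ I, f i z) x w = ∑ i ∈ I, dWithin s (f i) x w := by
  classical
  induction I using Finset.induction_on with
  | empty =>
    simp only [Finset.sum_empty]
    rw [dWithin_eq_zero hs EventuallyEq.rfl]
    rfl
  | insert a I ha ih =>
    simp only [Finset.sum_insert ha]
    rw [dWithin_add hs (hf a) (contMDiffOn_finsetSum fun i _ => hf i), ih]

theorem dWithin_const (c : ℝ) {f : M → ℝ} {x : M} {s : Set M} (hs : s ∈ 𝓝 x)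
    (hf : f =ᶠ[𝓝 x] fun _ => c) (w : TangentSpace (𝓡 (k + 1)) x) : dWithin s f x w = 0 := by
  have h1 : mfderiv (𝓡 (k + 1)) 𝓘(ℝ, ℝ) f x = mfderiv (𝓡 (k + 1)) 𝓘(ℝ, ℝ) (fun _ : M => c) x :=
    hf.mfderiv_eq
  have h2 := (hasMFDerivAt_const (I := 𝓡 (k + 1)) (I' := 𝓘(ℝ, ℝ)) c x).mfderiv
  rw [dWithin, mfderivWithin_of_mem_nhds hs]
  exact DFunLike.congr_fun (h1.trans h2) w

theorem Sheet.IsSide.integrableOn (hS : S.IsSide ε D C) (μ : VolumeForm k M) {g : M → ℝ}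
    (hg : ExtendsContinuously D C g) (hK : IsCompact K) (h0 : ∀ x ∈ D, x ∉ K → g x = 0) :
    IntegrableOn g D μ.measure := by
  have : LocallyCompactSpace M := ChartedSpace.locallyCompactSpace (Coord k) M
  exact hg.integrableOn hS.isOpen.measurableSet hS.isClosed hS.subset hK h0

/-- A field vanishing off `K` also has vanishing divergence there. -/
theorem Sheet.IsSide.divWithin_eq_zero (hS : S.IsSide ε D C) (μ : VolumeForm k M) {v : VField k M}
    (hK : IsCompact K) (h0 : ∀ x ∉ K, v x = 0) {x : M} (hx : x ∈ D) (hxK : x ∉ K) :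
    divWithin μ C v x = 0 := by
  refine VortexSheet.divWithin_eq_zero μ (mem_of_superset (hS.isOpen.mem_nhds hx) hS.subset) ?_
  filter_upwards [hK.isClosed.isOpen_compl.mem_nhds hxK] with z hz using h0 z hz

/-- The divergence theorem on one side of `Γ`. -/
theorem Sheet.IsSide.setIntegral_div_add_d_eq_sum (hS : S.IsSide ε D C) (μ : VolumeForm k M)
    {h : M → ℝ} (hh : ContMDiffOn (𝓡 (k + 1)) 𝓘(ℝ, ℝ) ∞ h C) {v : VField k M}
    (hv : SmoothVFieldOn v C) (hK : IsCompact K) (h0 : ∀ x ∉ K, v x = 0)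
    (π : S.ChartPartition K) :
    ∫ x in D, (h x * divWithin μ C v x + dWithin C h x (v x)) ∂μ.measure =
      ε * ∑ i ∈ π.index, ∫ z, chartFlux μ (π.chart i) (fun x => π.fn i x * h x) v 0 (incl z) := by
  have hP : ∀ i, ContMDiffOn (𝓡 (k + 1)) 𝓘(ℝ, ℝ) ∞ (fun x => π.fn i x * h x) C := fun i =>
    (π.contMDiff i).contMDiffOn.mul hh
  have hC : ∀ x ∈ D, C ∈ 𝓝 x := fun x hx => mem_of_superset (hS.isOpen.mem_nhds hx) hS.subset
  have hdiv := fun {x} => hS.divWithin_eq_zero μ hK h0 (x := x)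
  have hi : ∀ i, IntegrableOn (fun x => π.fn i x * h x * divWithin μ C v x +
      dWithin C (fun x => π.fn i x * h x) x (v x)) D μ.measure := by
    intro i
    refine hS.integrableOn μ (((ExtendsContinuously.of_continuousOn (hP i).continuousOn).mul
      (hS.extendsContinuously_divWithin μ hv)).add (.of_continuousOn
        (contMDiffOn_dWithin_apply hS.uniqueMDiffOn (hP i) hv).continuousOn)) hK fun x hx hxK => ?_
    rw [hdiv hx hxK, h0 x hxK, map_zero, mul_zero, add_zero]
  rw [Finset.mul_sum]
  simp_rw [← fun i => hS.setIntegral_div_add_d μ (π.chart_mem i) (hP i) hv (π.isCompact i)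
    (π.tsupport_subset i) fun x hx => by rw [π.eq_zero i hx, zero_mul]]
  rw [← integral_finsetSum _ fun i _ => hi i]
  refine setIntegral_congr_fun hS.isOpen.measurableSet fun x hx => ?_
  have hprod : ∀ i, dWithin C (fun x => π.fn i x * h x) x (v x) =
      π.fn i x * dWithin C h x (v x) + h x * dWithin C (π.fn i) x (v x) := fun i =>
    dWithin_mul (hC x hx) (π.contMDiff i).contMDiffOn hh (v x)
  by_cases hxK : x ∈ K
  -- The partition functions add up to `1` near `x`, so the terms created by differentiating them
  -- cancel.
  · have h1 : ∑ i ∈ π.index, dWithin C (π.fn i) x (v x) = 0 := by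
      rw [← dWithin_sum π.index (hC x hx) (fun i => (π.contMDiff i).contMDiffOn) (v x)]
      exact dWithin_const 1 (hC x hx) (π.sum_eq_one x hxK) (v x)
    have h2 : ∀ i ∈ π.index, π.fn i x * h x * divWithin μ C v x +
        dWithin C (fun x => π.fn i x * h x) x (v x) =
        π.fn i x * (h x * divWithin μ C v x + dWithin C h x (v x)) +
          h x * dWithin C (π.fn i) x (v x) := fun i _ => by rw [hprod i]; ring
    rw [Finset.sum_congr rfl h2, Finset.sum_add_distrib, ← Finset.sum_mul, ← Finset.mul_sum, h1,
      (π.sum_eq_one x hxK).self_of_nhds, one_mul, mul_zero, add_zero]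
  · have h1 : v x = 0 := h0 x hxK
    simp only [h1, map_zero, hdiv hx hxK, mul_zero, add_zero, Finset.sum_const_zero]

end SideStokes

/-! ### The anchor map as boundary flux, and the discontinuous divergence theorem -/

section Anchor

/-- Expand `V` in the standard basis: every basis vector but the one of index `0` repeats a later
argument and contributes nothing. -/
theorem alternatingMap_vecCons_single {k : ℕ} (g : Coord k [⋀^Fin (k + 1)]→ₗ[ℝ] ℝ) (V : Coord k) :
    g (Matrix.vecCons V fun j : Fin k => EuclideanSpace.single j.succ 1) =
      V 0 * g fun i => EuclideanSpace.single i 1 := by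
  have h1 : ∀ i : Fin (k + 1), g (Matrix.vecCons (EuclideanSpace.single i 1)
      fun j : Fin k => EuclideanSpace.single j.succ 1) =
        if i = 0 then g fun i => EuclideanSpace.single i 1 else 0 := by
    intro i
    refine Fin.cases ?_ (fun j => ?_) i
    · rw [if_pos rfl]
      congr 1
      ext j : 1
      refine Fin.cases rfl (fun j => rfl) j
    · rw [if_neg (Fin.succ_ne_zero j)]
      exact g.map_eq_zero_of_eq _ (i := 0) (j := j.succ) rfl (Fin.succ_ne_zero j).symm
  have h2 : V = ∑ i, V i • (EuclideanSpace.single i 1 : Coord k) := by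
    simpa using ((EuclideanSpace.basisFun (Fin (k + 1)) ℝ).sum_repr V).symm
  let L : Coord k →ₗ[ℝ] ℝ :=
    { toFun W := g (Matrix.vecCons W fun j : Fin k => EuclideanSpace.single j.succ 1)
      map_add' a b := DFunLike.congr_fun (g.curryLeft.map_add a b) _
      map_smul' c a := DFunLike.congr_fun (g.curryLeft.map_smul c a) _ }
  change L V = _
  have h3 : ∀ i, L (EuclideanSpace.single i 1) =
      if i = 0 then g fun i => EuclideanSpace.single i 1 else 0 := h1
  conv_lhs => rw [h2, map_sum]
  simp only [map_smul, h3, smul_eq_mul]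
  simp

variable {k : ℕ} {M : Type*} [TopologicalSpace M] [ChartedSpace (Coord k) M]
  [IsManifold (𝓡 (k + 1)) ∞ M]

variable {S : Sheet k M} {φ : OpenPartialHomeomorph M (Coord k)} {D C K : Set M} {ε : ℝ}

theorem Sheet.anchor_of_mem (μ : VolumeForm k M) (v : S.DVect) {x : M} (hx : x ∈ S.Γ) :
    S.anchor μ v x = ((μ.form x).curryLeft (v.1.1 x)).compLinearMap (S.tangent x).subtype :=
  if_pos hx

theorem Sheet.anchor_of_notMem (μ : VolumeForm k M) (v : S.DVect) {x : M} (hx : x ∉ S.Γ) :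
    S.anchor μ v x = 0 :=
  if_neg hx

/-- Only the normal component of `v` survives in `μ(v, ∂₁, …, ∂ₖ)`. This links `#v` to the boundary
term of the half-space divergence theorem. -/
theorem Sheet.coeff_anchor (μ : VolumeForm k M) (v : S.DVect) (hφ : φ ∈ S.adaptedCharts)
    {y : EuclideanSpace ℝ (Fin k)} (hy : y ∈ sliceTarget φ) :
    GammaForm.coeff (S.anchor μ v) φ y = fieldInChart φ v.1.1 (incl y) 0 * μ.coeff φ (incl y) := by
  have hx := slice_mem_source hy
  rw [GammaForm.coeff, dif_pos ⟨hφ, hy⟩, S.anchor_of_mem μ v (slice_mem_Γ hφ hy)]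
  have h1 := alternatingMap_vecCons_single ((μ.form (φ.symm (incl y))).compLinearMap
    (chartFrame φ (φ.symm (incl y))).toLinearMap) (fieldInChart φ v.1.1 (incl y))
  have h2 : (μ.form (φ.symm (incl y)) fun i => chartFrame φ (φ.symm (incl y))
      (EuclideanSpace.single i 1)) = μ.coeff φ (incl y) := by
    rw [VolumeForm.coeff]
    congr 1
    ext i : 1
    exact (coordVec_eq_chartFrame hφ.1 hy i).symm
  have h3 : (μ.form (φ.symm (incl y))) (fun i => chartFrame φ (φ.symm (incl y))
      ((Matrix.vecCons (fieldInChart φ v.1.1 (incl y))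
        fun j : Fin k => EuclideanSpace.single j.succ 1 : Fin (k + 1) → Coord k) i)) =
      fieldInChart φ v.1.1 (incl y) 0 * μ.coeff φ (incl y) := by
    rw [← h2]; exact h1
  rw [← h3]
  change μ.form (φ.symm (incl y)) (Matrix.vecCons (v.1.1 (φ.symm (incl y)))
    fun j => coordVec φ (incl y) j.succ) = _
  congr 1
  ext i : 1
  refine Fin.cases ?_ (fun j => ?_) i
  · exact (chartFrame_chartDeriv hφ.1 hx _).symm
  · exact coordVec_eq_chartFrame hφ.1 hy j.succ

/-- The matching condition of `DVect` in coordinates. It makes the flux through `Γ` the same from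
both sides, although `anchor` is written with the field on `D⁺`. -/
theorem Sheet.fieldInChart_zero_eq (v : S.DVect) (hφ : φ ∈ S.adaptedCharts)
    {y : EuclideanSpace ℝ (Fin k)} (hy : y ∈ sliceTarget φ) :
    fieldInChart φ v.1.2 (incl y) 0 = fieldInChart φ v.1.1 (incl y) 0 := by
  have h1 := v.2.2.2.2.2.2 _ (slice_mem_Γ hφ hy) φ hφ (slice_mem_source hy)
  rw [map_sub] at h1
  exact (sub_eq_zero.1 h1).symm

theorem Sheet.anchor_mem_topForms (μ : VolumeForm k M) (v : S.DVect) :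
    S.anchor μ v ∈ S.topForms := by
  obtain ⟨K, hK, h0⟩ := v.2.2.2.2.2.1
  refine ⟨fun φ hφ => ?_, fun x hx => S.anchor_of_notMem μ v hx, K, hK, fun x hx => ?_⟩
  · have h1 : ContDiffOn ℝ ∞ (fun y => fieldInChart φ v.1.1 (incl y) 0 * μ.coeff φ (incl y))
        (sliceTarget φ) := by
      refine ContDiffOn.mul ?_ ((μ.contDiffOn_coeff hφ.1).comp (inclL k).contDiff.contDiffOn
        fun _ hy => hy)
      refine ((contDiffOn_euclidean.1 (contDiffOn_fieldInChart hφ.1 v.2.1)) 0).comp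
        (inclL k).contDiff.contDiffOn fun y hy => ⟨hy, ?_⟩
      exact S.isSide_pos.Γ_subset (slice_mem_Γ hφ hy)
    exact h1.congr fun y hy => S.coeff_anchor μ v hφ hy
  · by_cases hΓ : x ∈ S.Γ
    · rw [S.anchor_of_mem μ v hΓ, (h0 x hx).1, map_zero]
      rfl
    · exact S.anchor_of_notMem μ v hΓ

theorem Sheet.GammaForm.IsContinuous.of_mem_topForms {ξ : S.GammaForm} (hξ : ξ ∈ S.topForms)
    {n : M → ℝ} (hn : ContinuousOn n S.Γ) :
    Sheet.GammaForm.IsContinuous (fun x => n x • ξ x : S.GammaForm) := by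
  obtain ⟨h1, -, K, hK, h0⟩ := hξ
  refine ⟨fun φ hφ => ?_, K, hK, fun x hx => by simp [h0 x hx]⟩
  refine ((hn.comp continuousOn_slice fun y hy => slice_mem_Γ hφ hy).mul
    (h1 φ hφ).continuousOn).congr fun y hy => ?_
  exact coeff_fun_smul n ξ φ y

theorem real_sign_mul_self (r : ℝ) : Real.sign r * r = |r| := by
  rcases lt_trichotomy r 0 with h | h | h
  · rw [Real.sign_of_neg h, abs_of_neg h, neg_one_mul]
  · simp [h]
  · rw [Real.sign_of_pos h, abs_of_pos h, one_mul]

variable [T2Space M] [SigmaCompactSpace M] [MeasurableSpace M] [BorelSpace M]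

/-- The divergence theorem on one side of `Γ`: the boundary term is the pairing with `i_v μ`. -/
theorem Sheet.IsSide.setIntegral_div_add_d_eq_pairing (hS : S.IsSide ε D C) (μ : VolumeForm k M)
    {h : M → ℝ} (hh : ContMDiffOn (𝓡 (k + 1)) 𝓘(ℝ, ℝ) ∞ h C) (v : S.DVect) {w : VField k M}
    (hw : SmoothVFieldOn w C) (hK : IsCompact K) (h0 : ∀ x ∉ K, w x = 0)
    (hv0 : ∀ x ∉ K, v.1.1 x = 0)
    (hvw : ∀ φ ∈ S.adaptedCharts, ∀ y ∈ sliceTarget φ,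
      fieldInChart φ w (incl y) 0 = fieldInChart φ v.1.1 (incl y) 0) :
    ∫ x in D, (h x * divWithin μ C w x + dWithin C h x (w x)) ∂μ.measure =
      ε * S.pairingΓ μ h (S.anchor μ v) := by
  obtain ⟨π⟩ := S.nonempty_chartPartition hK
  have hc := GammaForm.IsContinuous.of_mem_topForms (S.anchor_mem_topForms μ v)
    (hh.continuousOn.mono hS.Γ_subset)
  have ha : ∀ x ∉ K, S.anchor μ v x = 0 := by
    intro x hx
    by_cases hΓ : x ∈ S.Γ
    · rw [S.anchor_of_mem μ v hΓ, hv0 x hx, map_zero]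
      rfl
    · exact S.anchor_of_notMem μ v hΓ
  rw [hS.setIntegral_div_add_d_eq_sum μ hh hw hK h0 π, pairingΓ,
    hc.integralΓ_eq μ hK (fun x hx => by rw [ha x hx, smul_zero]) π]
  congr 1
  refine Finset.sum_congr rfl fun i _ => ?_
  rw [← integral_indicator isOpen_sliceTarget.measurableSet]
  refine integral_congr_ae (.of_forall fun y => ?_)
  have hφ := π.chart_mem i
  by_cases hy : y ∈ sliceTarget (π.chart i)
  · simp only [indicator_of_mem hy]
    -- With `ρ` the coefficient of `μ`, the flux density `|ρ| v⁰` is `sign(ρ) · (v⁰ ρ)`, the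
    -- oriented coefficient of `#v`.
    rw [chartFlux, indicator_of_mem (s := (π.chart i).target) hy, GammaForm.orientedCoeff, GammaForm.coeff_fun_smul,
      S.coeff_anchor μ v hφ hy, hvw _ hφ y hy, ← real_sign_mul_self]
    ring
  · simp only [indicator_of_notMem hy]
    exact indicator_of_notMem (s := (π.chart i).target) hy _

theorem Sheet.pairingΓ_add (μ : VolumeForm k M) {n n' : M → ℝ} (hn : ContinuousOn n S.Γ)
    (hn' : ContinuousOn n' S.Γ) {ξ : S.GammaForm} (hξ : ξ ∈ S.topForms) :
    S.pairingΓ μ (n + n') ξ = S.pairingΓ μ n ξ + S.pairingΓ μ n' ξ := by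
  rw [pairingΓ, pairingΓ, pairingΓ, ← S.integralΓ_add μ (.of_mem_topForms hξ hn)
    (.of_mem_topForms hξ hn')]
  congr 1
  ext x : 1
  exact add_smul _ _ _

theorem Sheet.pairingΓ_smul (μ : VolumeForm k M) (c : ℝ) {n : M → ℝ} (hn : ContinuousOn n S.Γ)
    {ξ : S.GammaForm} (hξ : ξ ∈ S.topForms) :
    S.pairingΓ μ (c • n) ξ = c * S.pairingΓ μ n ξ := by
  rw [pairingΓ, pairingΓ, ← S.integralΓ_smul μ c (.of_mem_topForms hξ hn)]
  congr 1
  ext x : 1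
  exact mul_smul _ _ _

theorem Sheet.pairingΓ_sub (μ : VolumeForm k M) {n n' : M → ℝ} (hn : ContinuousOn n S.Γ)
    (hn' : ContinuousOn n' S.Γ) {ξ : S.GammaForm} (hξ : ξ ∈ S.topForms) :
    S.pairingΓ μ (n - n') ξ = S.pairingΓ μ n ξ - S.pairingΓ μ n' ξ := by
  have h1 : n - n' = n + (-1 : ℝ) • n' := by rw [neg_one_smul, sub_eq_add_neg]
  rw [h1, S.pairingΓ_add μ hn (hn'.const_smul (-1 : ℝ)) hξ, S.pairingΓ_smul μ _ hn' hξ]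
  ring

theorem Sheet.pairingΓ_add_right (μ : VolumeForm k M) {n : M → ℝ} (hn : ContinuousOn n S.Γ)
    {ξ η : S.GammaForm} (hξ : ξ ∈ S.topForms) (hη : η ∈ S.topForms) :
    S.pairingΓ μ n (ξ + η) = S.pairingΓ μ n ξ + S.pairingΓ μ n η := by
  rw [pairingΓ, pairingΓ, pairingΓ, ← S.integralΓ_add μ (.of_mem_topForms hξ hn)
    (.of_mem_topForms hη hn)]
  congr 1
  ext x : 1
  exact smul_add _ _ _

theorem Sheet.pairingΓ_smul_right (μ : VolumeForm k M) (c : ℝ) {n : M → ℝ}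
    (hn : ContinuousOn n S.Γ) {ξ : S.GammaForm} (hξ : ξ ∈ S.topForms) :
    S.pairingΓ μ n (c • ξ) = c * S.pairingΓ μ n ξ := by
  rw [pairingΓ, pairingΓ, ← S.integralΓ_smul μ c (.of_mem_topForms hξ hn)]
  congr 1
  ext x : 1
  exact smul_comm (n x) c (ξ x)

theorem Sheet.pairingΓ_congr (μ : VolumeForm k M) {n n' : M → ℝ} {ξ : S.GammaForm}
    (hξ : ξ ∈ S.topForms) (h : EqOn n n' S.Γ) : S.pairingΓ μ n ξ = S.pairingΓ μ n' ξ := by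
  rw [pairingΓ, pairingΓ]
  congr 1
  ext x : 1
  by_cases hx : x ∈ S.Γ
  · rw [h hx]
  · rw [hξ.2.1 x hx, smul_zero, smul_zero]

/-- The divergence theorem for discontinuous fields: the boundary term is the pairing of `#v` with
the jump. -/
theorem Sheet.integral_div_add_d (μ : VolumeForm k M) {h : (M → ℝ) × (M → ℝ)}
    (h1 : ContMDiffOn (𝓡 (k + 1)) 𝓘(ℝ, ℝ) ∞ h.1 S.Cp)
    (h2 : ContMDiffOn (𝓡 (k + 1)) 𝓘(ℝ, ℝ) ∞ h.2 S.Cm) (v : S.DVect) :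
    S.integral μ (h * S.divR μ v.1 + contract v.1 (S.dR h)) =
      S.pairingΓ μ (S.jump h) (S.anchor μ v) := by
  obtain ⟨K, hK, h0⟩ := v.2.2.2.2.2.1
  have e1 := S.isSide_pos.setIntegral_div_add_d_eq_pairing μ h1 v v.2.1 hK (fun x hx => (h0 x hx).1)
    (fun x hx => (h0 x hx).1) fun _ _ _ _ => rfl
  have e2 := S.isSide_neg.setIntegral_div_add_d_eq_pairing μ h2 v v.2.2.1 hK
    (fun x hx => (h0 x hx).2) (fun x hx => (h0 x hx).1) fun φ hφ y hy => S.fieldInChart_zero_eq v hφ hy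
  have e3 : EqOn (S.jump h) (h.1 - h.2) S.Γ := fun x hx => indicator_of_mem hx _
  rw [S.pairingΓ_congr μ (S.anchor_mem_topForms μ v) e3,
    S.pairingΓ_sub μ (h1.continuousOn.mono S.isSide_pos.Γ_subset)
      (h2.continuousOn.mono S.isSide_neg.Γ_subset) (S.anchor_mem_topForms μ v)]
  rw [one_mul] at e1
  rw [neg_one_mul] at e2
  rw [sub_eq_add_neg, ← e1, ← e2]
  rfl

end Anchor

/-! ### The one-form of the Hamiltonian operator on one side -/

section HamiltonianForm

variable {k : ℕ} {M : Type*} [TopologicalSpace M] [ChartedSpace (Coord k) M]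
  [IsManifold (𝓡 (k + 1)) ∞ M]

/-- The `1`-form `-i_v dm - div(v) m - d(i_v m)` on the domain `s`. -/
def hamiltonianForm (μ : VolumeForm k M) (s : Set M) (m : OneForm k M) (v : VField k M) :
    OneForm k M := fun x =>
  -interiorExtDerivWithin s m v x - divWithin μ s v x • m x - dWithin s (fun z => m z (v z)) x

variable {S : Sheet k M} {D C K s : Set M} {ε : ℝ} {m : OneForm k M} {v u : VField k M}

variable [T2Space M] [MeasurableSpace M] [BorelSpace M]

theorem hamiltonianForm_apply (μ : VolumeForm k M) (x : M) (w : TangentSpace (𝓡 (k + 1)) x) :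
    hamiltonianForm μ s m v x w = -interiorExtDerivWithin s m v x w - divWithin μ s v x * m x w -
      dWithin s (fun z => m z (v z)) x w := rfl

/-- By Cartan's formula the term `d(m(v))(u)` cancels. What is subtracted from `m([v, u])` is the
divergence of the field `m(u) v`, ready for Stokes. -/
theorem hamiltonianForm_apply_eq (μ : VolumeForm k M) {x : M} (hs : s ∈ 𝓝 x)
    (hm : SmoothOneFormOn m s) (hv : SmoothVFieldOn v s) (hu : SmoothVFieldOn u s) :
    hamiltonianForm μ s m v x (u x) =
      m x (VectorField.mlieBracketWithin (𝓡 (k + 1)) v u s x) -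
        (m x (u x) * divWithin μ s v x + dWithin s (fun z => m z (u z)) x (v x)) := by
  rw [hamiltonianForm_apply, oneForm_mlieBracketWithin hs hm hv hu]
  ring

theorem interiorExtDerivWithin_add (v v' : VField k M) (x : M) (w : TangentSpace (𝓡 (k + 1)) x) :
    interiorExtDerivWithin s m (v + v') x w =
      interiorExtDerivWithin s m v x w + interiorExtDerivWithin s m v' x w := by
  have h : chartDeriv (chartAt (Coord k) x) x ((v + v') x) =
      chartDeriv (chartAt (Coord k) x) x (v x) + chartDeriv (chartAt (Coord k) x) x (v' x) :=
    map_add _ _ _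
  simp only [interiorExtDerivWithin, h, map_add, ContinuousLinearMap.comp_apply, sub_apply,
    add_apply]
  ring

theorem interiorExtDerivWithin_smul (c : ℝ) (v : VField k M) (x : M)
    (w : TangentSpace (𝓡 (k + 1)) x) :
    interiorExtDerivWithin s m (c • v) x w = c * interiorExtDerivWithin s m v x w := by
  have h : chartDeriv (chartAt (Coord k) x) x ((c • v) x) =
      c • chartDeriv (chartAt (Coord k) x) x (v x) :=
    (chartDeriv (chartAt (Coord k) x) x).map_smul c (v x)
  simp only [interiorExtDerivWithin, h, map_smul, ContinuousLinearMap.comp_apply, sub_apply,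
    smul_apply, smul_eq_mul]
  ring

theorem hamiltonianForm_add (μ : VolumeForm k M) {x : M} (hs : s ∈ 𝓝 x)
    (hm : SmoothOneFormOn m s) (hv : SmoothVFieldOn v s) (hu : SmoothVFieldOn u s)
    (w : TangentSpace (𝓡 (k + 1)) x) :
    hamiltonianForm μ s m (v + u) x w =
      hamiltonianForm μ s m v x w + hamiltonianForm μ s m u x w := by
  have h : (fun z => m z ((v + u) z)) = fun z => m z (v z) + m z (u z) := by
    ext z; exact map_add _ _ _
  rw [hamiltonianForm_apply, hamiltonianForm_apply, hamiltonianForm_apply,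
    interiorExtDerivWithin_add, divWithin_add μ hs hv hu, h,
    dWithin_add hs (contMDiffOn_oneForm_apply hm hv) (contMDiffOn_oneForm_apply hm hu)]
  ring

theorem hamiltonianForm_smul (μ : VolumeForm k M) (c : ℝ) {x : M} (hs : s ∈ 𝓝 x)
    (hm : SmoothOneFormOn m s) (hv : SmoothVFieldOn v s) (w : TangentSpace (𝓡 (k + 1)) x) :
    hamiltonianForm μ s m (c • v) x w = c * hamiltonianForm μ s m v x w := by
  have h : (fun z => m z ((c • v) z)) = fun z => c * m z (v z) := by
    ext z; exact (m z).map_smul c (v z)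
  rw [hamiltonianForm_apply, hamiltonianForm_apply,
    interiorExtDerivWithin_smul, divWithin_smul μ c hs hv, h,
    dWithin_const_mul c hs (contMDiffOn_oneForm_apply hm hv)]
  ring

theorem Sheet.IsSide.mem_nhds (hS : S.IsSide ε D C) {x : M} (hx : x ∈ D) : C ∈ 𝓝 x :=
  mem_of_superset (hS.isOpen.mem_nhds hx) hS.subset

theorem Sheet.IsSide.integrableOn_oneForm_mlieBracketWithin (hS : S.IsSide ε D C)
    (μ : VolumeForm k M) (hm : SmoothOneFormOn m C) (hv : SmoothVFieldOn v C)
    (hu : SmoothVFieldOn u C) (hK : IsCompact K) (h0 : ∀ x ∉ K, u x = 0) :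
    IntegrableOn (fun x => m x (VectorField.mlieBracketWithin (𝓡 (k + 1)) v u C x)) D μ.measure := by
  refine hS.integrableOn μ (.of_continuousOn (contMDiffOn_oneForm_mlieBracketWithin
    hS.uniqueMDiffOn hm hv hu).continuousOn) hK fun x hx hxK => ?_
  rw [oneForm_mlieBracketWithin (hS.mem_nhds hx) hm hv hu, h0 x hxK, map_zero, map_zero,
    dWithin_const 0 (hS.mem_nhds hx) ?_, sub_zero, sub_zero]
  filter_upwards [hK.isClosed.isOpen_compl.mem_nhds hxK] with z hz
  rw [h0 z hz, map_zero]

theorem Sheet.IsSide.integrableOn_mul_divWithin (hS : S.IsSide ε D C) (μ : VolumeForm k M)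
    {h : M → ℝ} (hh : ContMDiffOn (𝓡 (k + 1)) 𝓘(ℝ, ℝ) ∞ h C) (hv : SmoothVFieldOn v C)
    (hK : IsCompact K) (h0 : ∀ x ∉ K, v x = 0) :
    IntegrableOn (fun x => h x * divWithin μ C v x) D μ.measure :=
  hS.integrableOn μ ((ExtendsContinuously.of_continuousOn hh.continuousOn).mul
    (hS.extendsContinuously_divWithin μ hv)) hK fun x hx hxK => by
      rw [hS.divWithin_eq_zero μ hK h0 hx hxK, mul_zero]

theorem Sheet.IsSide.integrableOn_dWithin (hS : S.IsSide ε D C) (μ : VolumeForm k M)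
    {h : M → ℝ} (hh : ContMDiffOn (𝓡 (k + 1)) 𝓘(ℝ, ℝ) ∞ h C) (hv : SmoothVFieldOn v C)
    (hK : IsCompact K) (h0 : ∀ x ∉ K, v x = 0) :
    IntegrableOn (fun x => dWithin C h x (v x)) D μ.measure :=
  hS.integrableOn μ (.of_continuousOn
    (contMDiffOn_dWithin_apply hS.uniqueMDiffOn hh hv).continuousOn) hK fun x _ hxK => by
      rw [h0 x hxK, map_zero]

/-- Integrability is read off from the rewritten form: the bracket term and the two parts of the
divergence are each integrable, so the exterior derivative, computed in a moving chart, need not be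
estimated. -/
theorem Sheet.IsSide.integrableOn_hamiltonianForm (hS : S.IsSide ε D C) (μ : VolumeForm k M)
    (hm : SmoothOneFormOn m C) (hv : SmoothVFieldOn v C) (hu : SmoothVFieldOn u C)
    (hK : IsCompact K) (hv0 : ∀ x ∉ K, v x = 0) {L : Set M} (hL : IsCompact L)
    (hu0 : ∀ x ∉ L, u x = 0) :
    IntegrableOn (fun x => hamiltonianForm μ C m v x (u x)) D μ.measure := by
  have h1 := (hS.integrableOn_oneForm_mlieBracketWithin μ hm hv hu hL hu0).sub
    ((hS.integrableOn_mul_divWithin μ (contMDiffOn_oneForm_apply hm hu) hv hK hv0).add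
      (hS.integrableOn_dWithin μ (contMDiffOn_oneForm_apply hm hu) hv hK hv0))
  refine h1.congr_fun (fun x hx => ?_) hS.isOpen.measurableSet
  exact (hamiltonianForm_apply_eq μ (hS.mem_nhds hx) hm hv hu).symm

end HamiltonianForm

/-! ### Integrals over both sides and the density part of the operator -/

section Operator

variable {k : ℕ} {M : Type*} [TopologicalSpace M] [ChartedSpace (Coord k) M]
  [IsManifold (𝓡 (k + 1)) ∞ M]

variable {S : Sheet k M} {m : OneForm k M × OneForm k M}

theorem Sheet.anchor_add (μ : VolumeForm k M) (v u : S.DVect) :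
    S.anchor μ (v + u) = S.anchor μ v + S.anchor μ u := by
  ext x : 1
  by_cases hx : x ∈ S.Γ
  · rw [Pi.add_apply, S.anchor_of_mem μ _ hx, S.anchor_of_mem μ _ hx, S.anchor_of_mem μ _ hx]
    have h := (μ.form x).curryLeft.map_add (v.1.1 x) (u.1.1 x)
    exact congrArg (fun f => AlternatingMap.compLinearMap f (S.tangent x).subtype) h
  · simp [S.anchor_of_notMem μ _ hx]

theorem Sheet.anchor_smul (μ : VolumeForm k M) (c : ℝ) (v : S.DVect) :
    S.anchor μ (c • v) = c • S.anchor μ v := by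
  ext x : 1
  by_cases hx : x ∈ S.Γ
  · rw [Pi.smul_apply, S.anchor_of_mem μ _ hx, S.anchor_of_mem μ _ hx]
    have h := (μ.form x).curryLeft.map_smul c (v.1.1 x)
    exact congrArg (fun f => AlternatingMap.compLinearMap f (S.tangent x).subtype) h
  · simp [S.anchor_of_notMem μ _ hx]

theorem Sheet.jumpContract_add (hm : m ∈ S.DOneForm) (v u : S.DVect) :
    S.jumpContract hm (v + u) = S.jumpContract hm v + S.jumpContract hm u := by
  refine Subtype.ext (funext fun x => ?_)
  change S.jump _ x = S.jump _ x + S.jump _ x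
  by_cases hx : x ∈ S.Γ
  · simp only [jump, indicator_of_mem hx]
    have h1 : m.1 x ((v + u).1.1 x) = m.1 x (v.1.1 x) + m.1 x (u.1.1 x) := map_add _ _ _
    have h2 : m.2 x ((v + u).1.2 x) = m.2 x (v.1.2 x) + m.2 x (u.1.2 x) := map_add _ _ _
    simp only [contract, h1, h2]
    ring
  · simp only [jump, indicator_of_notMem hx, add_zero]

theorem Sheet.jumpContract_smul (hm : m ∈ S.DOneForm) (c : ℝ) (v : S.DVect) :
    S.jumpContract hm (c • v) = c • S.jumpContract hm v := by
  refine Subtype.ext (funext fun x => ?_)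
  change S.jump _ x = c * S.jump _ x
  by_cases hx : x ∈ S.Γ
  · simp only [jump, indicator_of_mem hx]
    have h1 : m.1 x ((c • v).1.1 x) = c * m.1 x (v.1.1 x) := (m.1 x).map_smul c _
    have h2 : m.2 x ((c • v).1.2 x) = c * m.2 x (v.1.2 x) := (m.2 x).map_smul c _
    simp only [contract, h1, h2]
    ring
  · simp only [jump, indicator_of_notMem hx, mul_zero]

variable [T2Space M] [MeasurableSpace M] [BorelSpace M]

/-- Integrability of a discontinuous function over the two regions. -/
def Sheet.IsIntegrable (S : Sheet k M) (μ : VolumeForm k M) (f : (M → ℝ) × (M → ℝ)) : Prop :=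
  IntegrableOn f.1 S.Dp μ.measure ∧ IntegrableOn f.2 S.Dm μ.measure

theorem Sheet.integral_add (μ : VolumeForm k M) {f g : (M → ℝ) × (M → ℝ)}
    (hf : S.IsIntegrable μ f) (hg : S.IsIntegrable μ g) :
    S.integral μ (f + g) = S.integral μ f + S.integral μ g := by
  have h1 := MeasureTheory.integral_add hf.1 hg.1
  have h2 := MeasureTheory.integral_add hf.2 hg.2
  rw [integral, integral, integral, add_add_add_comm, ← h1, ← h2]
  rfl

theorem Sheet.integral_sub (μ : VolumeForm k M) {f g : (M → ℝ) × (M → ℝ)}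
    (hf : S.IsIntegrable μ f) (hg : S.IsIntegrable μ g) :
    S.integral μ (f - g) = S.integral μ f - S.integral μ g := by
  have h1 := MeasureTheory.integral_sub hf.1 hg.1
  have h2 := MeasureTheory.integral_sub hf.2 hg.2
  rw [integral, integral, integral, add_sub_add_comm, ← h1, ← h2]
  rfl

theorem Sheet.integral_smul (μ : VolumeForm k M) (c : ℝ) (f : (M → ℝ) × (M → ℝ)) :
    S.integral μ (c • f) = c * S.integral μ f := by
  rw [integral, integral, mul_add, ← integral_const_mul, ← integral_const_mul]
  rfl

theorem Sheet.integral_congr (μ : VolumeForm k M) {f g : (M → ℝ) × (M → ℝ)}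
    (h1 : EqOn f.1 g.1 S.Dp) (h2 : EqOn f.2 g.2 S.Dm) : S.integral μ f = S.integral μ g := by
  rw [integral, integral, setIntegral_congr_fun S.isOpen_Dp.measurableSet h1,
    setIntegral_congr_fun S.isOpen_Dm.measurableSet h2]

theorem Sheet.isIntegrable_mul_divR (μ : VolumeForm k M) {h : (M → ℝ) × (M → ℝ)}
    (h1 : ContMDiffOn (𝓡 (k + 1)) 𝓘(ℝ, ℝ) ∞ h.1 S.Cp)
    (h2 : ContMDiffOn (𝓡 (k + 1)) 𝓘(ℝ, ℝ) ∞ h.2 S.Cm) (v : S.DVect) :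
    S.IsIntegrable μ (h * S.divR μ v.1) := by
  obtain ⟨K, hK, h0⟩ := v.2.2.2.2.2.1
  exact ⟨S.isSide_pos.integrableOn_mul_divWithin μ h1 v.2.1 hK fun x hx => (h0 x hx).1,
    S.isSide_neg.integrableOn_mul_divWithin μ h2 v.2.2.1 hK fun x hx => (h0 x hx).2⟩

theorem Sheet.isIntegrable_contract_dR (μ : VolumeForm k M) {h : (M → ℝ) × (M → ℝ)}
    (h1 : ContMDiffOn (𝓡 (k + 1)) 𝓘(ℝ, ℝ) ∞ h.1 S.Cp)
    (h2 : ContMDiffOn (𝓡 (k + 1)) 𝓘(ℝ, ℝ) ∞ h.2 S.Cm) (v : S.DVect) :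
    S.IsIntegrable μ (contract v.1 (S.dR h)) := by
  obtain ⟨K, hK, h0⟩ := v.2.2.2.2.2.1
  exact ⟨S.isSide_pos.integrableOn_dWithin μ h1 v.2.1 hK fun x hx => (h0 x hx).1,
    S.isSide_neg.integrableOn_dWithin μ h2 v.2.2.1 hK fun x hx => (h0 x hx).2⟩

theorem Sheet.isIntegrable_contract_lieBracketR (μ : VolumeForm k M) (hm : m ∈ S.DOneForm)
    (v u : S.DVect) : S.IsIntegrable μ (contract (S.lieBracketR v.1 u.1) m) := by
  obtain ⟨K, hK, h0⟩ := u.2.2.2.2.2.1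
  exact ⟨S.isSide_pos.integrableOn_oneForm_mlieBracketWithin μ hm.1 v.2.1 u.2.1 hK
      fun x hx => (h0 x hx).1,
    S.isSide_neg.integrableOn_oneForm_mlieBracketWithin μ hm.2.1 v.2.2.1 u.2.2.1 hK
      fun x hx => (h0 x hx).2⟩

/-- The discontinuous divergence theorem read from right to left, with its integrand split into the
differential and the divergence terms. -/
theorem Sheet.dualAnchor_eq [SigmaCompactSpace M] (μ : VolumeForm k M) {h : (M → ℝ) × (M → ℝ)}
    (hh : h ∈ S.DFun) {n : S.cotangent} (hn : S.jump h = n) (u : S.DVect) :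
    S.dualAnchor μ n u = S.density μ (S.dR h) u + S.divDual μ h u := by
  rw [dualAnchor, ← hn, ← S.integral_div_add_d μ hh.1 hh.2.1 u,
    S.integral_add μ (S.isIntegrable_mul_divR μ hh.1 hh.2.1 u)
      (S.isIntegrable_contract_dR μ hh.1 hh.2.1 u), add_comm, mul_comm]
  rfl

/-- The discontinuous `1`-form `-i_v dm - div(v) m - d(i_v m)`. -/
def Sheet.hamiltonianFormR (S : Sheet k M) (μ : VolumeForm k M) (m : OneForm k M × OneForm k M)
    (v : VField k M × VField k M) : OneForm k M × OneForm k M :=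
  -S.interiorExtDerivR m v - mulForm (S.divR μ v) m - S.dR (contract v m)

theorem Sheet.isIntegrable_contract_hamiltonianFormR (μ : VolumeForm k M) (hm : m ∈ S.DOneForm)
    (v u : S.DVect) : S.IsIntegrable μ (contract u.1 (S.hamiltonianFormR μ m v.1)) := by
  obtain ⟨K, hK, h0⟩ := v.2.2.2.2.2.1
  obtain ⟨L, hL, hu0⟩ := u.2.2.2.2.2.1
  exact ⟨S.isSide_pos.integrableOn_hamiltonianForm μ hm.1 v.2.1 u.2.1 hK
      (fun x hx => (h0 x hx).1) hL fun x hx => (hu0 x hx).1,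
    S.isSide_neg.integrableOn_hamiltonianForm μ hm.2.1 v.2.2.1 u.2.2.1 hK
      (fun x hx => (h0 x hx).2) hL fun x hx => (hu0 x hx).2⟩

/-- The central computation: the pointwise Cartan identity is integrated over both regions, and the
divergence of `m(u) v` becomes a boundary term by `Sheet.integral_div_add_d` with `h = i_u m`. -/
theorem Sheet.density_hamiltonianFormR [SigmaCompactSpace M] (μ : VolumeForm k M)
    (hm : m ∈ S.DOneForm) (v u : S.DVect) :
    S.density μ (S.hamiltonianFormR μ m v.1) u =
      S.integral μ (contract (S.lieBracketR v.1 u.1) m) -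
        S.pairingΓ μ (S.jumpContract hm u) (S.anchor μ v) := by
  have h1 := contMDiffOn_oneForm_apply hm.1 u.2.1
  have h2 := contMDiffOn_oneForm_apply hm.2.1 u.2.2.1
  have e1 := S.integral_div_add_d μ (h := contract u.1 m) h1 h2 v
  have e2 := S.integral_add μ (S.isIntegrable_mul_divR μ (h := contract u.1 m) h1 h2 v)
    (S.isIntegrable_contract_dR μ (h := contract u.1 m) h1 h2 v)
  have hi : S.IsIntegrable μ (contract u.1 m * S.divR μ v.1 +
      contract v.1 (S.dR (contract u.1 m))) := by
    have a := S.isIntegrable_mul_divR μ (h := contract u.1 m) h1 h2 v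
    have b := S.isIntegrable_contract_dR μ (h := contract u.1 m) h1 h2 v
    exact ⟨a.1.add b.1, a.2.add b.2⟩
  change _ = _ - S.pairingΓ μ (S.jump (contract u.1 m)) (S.anchor μ v)
  rw [← e1, ← S.integral_sub μ (S.isIntegrable_contract_lieBracketR μ hm v u) hi]
  refine S.integral_congr μ (fun x hx => ?_) fun x hx => ?_
  · exact hamiltonianForm_apply_eq μ (S.isSide_pos.mem_nhds hx) hm.1 v.2.1 u.2.1
  · exact hamiltonianForm_apply_eq μ (S.isSide_neg.mem_nhds hx) hm.2.1 v.2.2.1 u.2.2.1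

theorem Sheet.density_hamiltonianFormR_add_right (μ : VolumeForm k M) (hm : m ∈ S.DOneForm)
    (v u u' : S.DVect) : S.density μ (S.hamiltonianFormR μ m v.1) (u + u') =
      S.density μ (S.hamiltonianFormR μ m v.1) u + S.density μ (S.hamiltonianFormR μ m v.1) u' := by
  rw [density, density, density, ← S.integral_add μ
    (S.isIntegrable_contract_hamiltonianFormR μ hm v u)
    (S.isIntegrable_contract_hamiltonianFormR μ hm v u')]
  exact S.integral_congr μ (fun x _ => map_add (hamiltonianForm μ S.Cp m.1 v.1.1 x) _ _)
    fun x _ => map_add (hamiltonianForm μ S.Cm m.2 v.1.2 x) _ _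

theorem Sheet.density_hamiltonianFormR_smul_right (μ : VolumeForm k M) (c : ℝ)
    (v u : S.DVect) : S.density μ (S.hamiltonianFormR μ m v.1) (c • u) =
      c * S.density μ (S.hamiltonianFormR μ m v.1) u := by
  rw [density, density, ← S.integral_smul μ]
  exact S.integral_congr μ (fun x _ => map_smul (hamiltonianForm μ S.Cp m.1 v.1.1 x) _ _)
    fun x _ => map_smul (hamiltonianForm μ S.Cm m.2 v.1.2 x) _ _

theorem Sheet.density_hamiltonianFormR_add_left (μ : VolumeForm k M) (hm : m ∈ S.DOneForm)
    (v v' u : S.DVect) : S.density μ (S.hamiltonianFormR μ m (v + v').1) u =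
      S.density μ (S.hamiltonianFormR μ m v.1) u + S.density μ (S.hamiltonianFormR μ m v'.1) u := by
  rw [density, density, density, ← S.integral_add μ
    (S.isIntegrable_contract_hamiltonianFormR μ hm v u)
    (S.isIntegrable_contract_hamiltonianFormR μ hm v' u)]
  exact S.integral_congr μ
    (fun x hx => hamiltonianForm_add μ (S.isSide_pos.mem_nhds hx) hm.1 v.2.1 v'.2.1 _)
    fun x hx => hamiltonianForm_add μ (S.isSide_neg.mem_nhds hx) hm.2.1 v.2.2.1 v'.2.2.1 _

theorem Sheet.density_hamiltonianFormR_smul_left (μ : VolumeForm k M) (hm : m ∈ S.DOneForm) (c : ℝ)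
    (v u : S.DVect) : S.density μ (S.hamiltonianFormR μ m (c • v).1) u =
      c * S.density μ (S.hamiltonianFormR μ m v.1) u := by
  rw [density, density, ← S.integral_smul μ]
  exact S.integral_congr μ
    (fun x hx => hamiltonianForm_smul μ c (S.isSide_pos.mem_nhds hx) hm.1 v.2.1 _)
    fun x hx => hamiltonianForm_smul μ c (S.isSide_neg.mem_nhds hx) hm.2.1 v.2.2.1 _

end Operator

/-! ### Nondegeneracy of the pairing on `Γ` -/

section Nondegeneracy

variable {k : ℕ} {M : Type*} [TopologicalSpace M] [ChartedSpace (Coord k) M]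
  [IsManifold (𝓡 (k + 1)) ∞ M]

variable {S : Sheet k M} {φ : OpenPartialHomeomorph M (Coord k)}

variable [T2Space M] [MeasurableSpace M] [BorelSpace M]

theorem tangentFrame_surjective (hφ : φ ∈ S.adaptedCharts) {x : M} (hx : x ∈ φ.source)
    (hΓ : x ∈ S.Γ) : Function.Surjective (tangentFrame hφ hx hΓ) := by
  rintro ⟨w, hw⟩
  refine ⟨tailL k (chartDeriv φ x w), Subtype.ext ?_⟩
  change chartFrame φ x (incl (tailL k (chartDeriv φ x w))) = w
  rw [incl_tailL ((S.mem_tangent_iff hφ hx hΓ).1 hw), chartFrame_chartDeriv hφ.1 hx]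

/-- A `k`-form pulled back to the `k`-dimensional slice is a multiple of the determinant, and the
slice frame maps onto the tangent space of `Γ`. -/
theorem Sheet.GammaForm.eq_zero_of_coeff_eq_zero {ξ : S.GammaForm} (hφ : φ ∈ S.adaptedCharts)
    {y : EuclideanSpace ℝ (Fin k)} (hy : y ∈ sliceTarget φ) (h : coeff ξ φ y = 0) :
    ξ (φ.symm (incl y)) = 0 := by
  rw [coeff_eq ξ hφ hy] at h
  set T := tangentFrame hφ (slice_mem_source hy) (slice_mem_Γ hφ hy) with hT
  have h1 := ((ξ (φ.symm (incl y))).compLinearMap T).eq_smul_basis_det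
    (EuclideanSpace.basisFun (Fin k) ℝ).toBasis
  have h2 : ((ξ (φ.symm (incl y))).compLinearMap T)
      (EuclideanSpace.basisFun (Fin k) ℝ).toBasis = 0 := by
    rw [← h]
    simp only [AlternatingMap.compLinearMap_apply]
    congr 1
    ext j : 1
    simp
  rw [h2, zero_smul] at h1
  ext w
  choose w' hw' using fun j => tangentFrame_surjective hφ (slice_mem_source hy)
    (slice_mem_Γ hφ hy) (w j)
  have h3 : w = fun j => T (w' j) := funext fun j => (hw' j).symm
  rw [h3]
  exact DFunLike.congr_fun h1 w'

/-- The pairing of `C^∞(Γ)` and `Ω^k(Γ)` is nondegenerate. -/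
theorem Sheet.eq_zero_of_pairingΓ_eq_zero [SigmaCompactSpace M] (μ : VolumeForm k M) {η : S.GammaForm}
    (hη : η ∈ S.topForms) (h : ∀ n : S.cotangent, S.pairingΓ μ n η = 0) : η = 0 := by
  by_contra hne
  obtain ⟨x, hx⟩ := Function.ne_iff.1 hne
  have hxΓ : x ∈ S.Γ := by
    by_contra hΓ
    exact hx (hη.2.1 x hΓ)
  obtain ⟨φ, hφ, hxφ⟩ := S.exists_adaptedChart x
  set c := GammaForm.orientedCoeff μ η φ with hc
  set y₀ := tailL k (φ x) with hy₀
  have hy₀s : y₀ ∈ sliceTarget φ := tailL_mem_sliceTarget hφ hxφ hxΓ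
  have hxy : φ.symm (incl y₀) = x := by rw [incl_tailL_chart hφ hxφ hxΓ, φ.left_inv hxφ]
  have hcy : c y₀ ≠ 0 := by
    refine mul_ne_zero ?_ fun h0 => hx ?_
    · rw [ne_eq, Real.sign_eq_zero_iff]
      exact μ.coeff_ne_zero hφ.1 hy₀s
    · have := GammaForm.eq_zero_of_coeff_eq_zero hφ hy₀s h0
      rwa [hxy] at this
  have hηc : GammaForm.IsContinuous η := by
    obtain ⟨h1, -, h3⟩ := hη
    exact ⟨fun φ hφ => (h1 φ hφ).continuousOn, h3⟩
  have hcc : ContinuousOn c (sliceTarget φ) := GammaForm.continuousOn_orientedCoeff μ hηc hφ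
  have hA : {y | 0 < c y * c y₀} ∈ 𝓝 y₀ := by
    have h1 : ContinuousAt (fun y => c y * c y₀) y₀ :=
      (hcc.continuousAt (isOpen_sliceTarget.mem_nhds hy₀s)).mul continuousAt_const
    exact h1.eventually_const_lt (mul_self_pos.2 hcy)
  have hU : φ.source ∩ {z | 0 < c (tailL k (φ z)) * c y₀} ∈ 𝓝 x := by
    refine inter_mem (φ.open_source.mem_nhds hxφ) ?_
    have h1 : ContinuousAt (fun z => tailL k (φ z)) x :=
      (tailL k).continuous.continuousAt.comp (φ.continuousAt hxφ)
    exact h1.preimage_mem_nhds hA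
  -- Two nested bump functions: `g` lives where the coefficient keeps its sign, and `f`, the test
  -- function, lives where `g` is locally `1`. Then `g` alone is a partition of unity near the
  -- support of `f`, and the integral over `Γ` reduces to one chart.
  obtain ⟨g, -, hg⟩ := (SmoothBumpFunction.nhds_basis_tsupport (I := 𝓡 (k + 1)) x).mem_iff.1 hU
  have hV : {z | ∀ᶠ z' in 𝓝 z, g z' = 1} ∈ 𝓝 x :=
    isOpen_setOfPred_eventually_nhds.mem_nhds g.eventuallyEq_one
  obtain ⟨f, -, hf⟩ := (SmoothBumpFunction.nhds_basis_tsupport (I := 𝓡 (k + 1)) x).mem_iff.1 hV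
  have hfc : IsCompact (tsupport f) := f.hasCompactSupport
  have hgc : IsCompact (tsupport g) := g.hasCompactSupport
  have hfg : tsupport f ⊆ tsupport g := fun z hz => by
    have h1 : g z = 1 := (hf hz).self_of_nhds
    exact subset_tsupport _ (by rw [Function.mem_support, h1]; exact one_ne_zero)
  let π : S.ChartPartition (tsupport f) :=
    { index := {x}
      chart := fun _ => φ
      fn := fun _ => g
      chart_mem := fun _ => hφ
      contMDiff := fun _ => g.contMDiff
      isCompact := fun _ => hgc
      tsupport_subset := fun _ => hg.trans inter_subset_left
      nonneg := fun _ _ => g.nonneg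
      sum_eq_one := fun z hz => by simpa using hf hz }
  have hfs : ContMDiff (𝓡 (k + 1)) 𝓘(ℝ, ℝ) ∞ f := f.contMDiff
  have hn : S.Γ.indicator f ∈ S.cotangent :=
    ⟨hfs.contMDiffOn.congr fun z hz => indicator_of_mem hz _, fun z hz => indicator_of_notMem hz _⟩
  have h0 := h ⟨_, hn⟩
  rw [S.pairingΓ_congr μ hη (n' := f) fun z hz => indicator_of_mem hz _, pairingΓ,
    (GammaForm.IsContinuous.of_mem_topForms hη hfs.continuous.continuousOn).integralΓ_eq μ hfc
      (fun z hz => by simp [image_eq_zero_of_notMem_tsupport hz]) π] at h0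
  have h1 : ∫ y in sliceTarget φ, f (φ.symm (incl y)) * c y = 0 := by
    rw [← h0]
    change _ = ∑ i ∈ {x}, ∫ y in sliceTarget φ, g (φ.symm (incl y)) * _
    rw [Finset.sum_singleton]
    refine integral_congr_ae (.of_forall fun y => ?_)
    simp only [GammaForm.orientedCoeff, GammaForm.coeff_fun_smul, hc]
    by_cases hy : φ.symm (incl y) ∈ tsupport f
    · rw [(hf hy).self_of_nhds]
      ring
    · rw [image_eq_zero_of_notMem_tsupport hy]
      ring
  set Q : Set (EuclideanSpace ℝ (Fin k)) := tailL k '' (φ '' tsupport f ∩ {y | y 0 = 0}) with hQ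
  have hfφ : tsupport f ⊆ φ.source := hfg.trans (hg.trans inter_subset_left)
  have hQc : IsCompact Q := ((isCompact_image_chart hfc hfφ).inter_right
    (isClosed_eq (by fun_prop) continuous_const)).image (tailL k).continuous
  have hQs : Q ⊆ sliceTarget φ := by
    rintro _ ⟨_, ⟨⟨z, hz, rfl⟩, h0⟩, rfl⟩
    rw [sliceTarget, mem_ofPred_eq, incl_tailL h0]
    exact φ.map_source (hfφ hz)
  have hQf : ∀ y ∈ sliceTarget φ, y ∉ Q → f (φ.symm (incl y)) = 0 := fun y hy hyQ =>
    image_eq_zero_of_notMem_tsupport fun h => hyQ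
      ⟨incl y, ⟨⟨_, h, φ.right_inv hy⟩, rfl⟩, tailL_incl y⟩
  -- The factor `c y₀` makes the integrand nonnegative, with value `(c y₀)²` at `y₀`; its integral
  -- is therefore positive, against the assumed vanishing of the pairing.
  let F : EuclideanSpace ℝ (Fin k) → ℝ :=
    (sliceTarget φ).indicator fun y => f (φ.symm (incl y)) * c y * c y₀
  obtain ⟨F1, F2⟩ := continuous_of_continuousOn_of_eq_zero (g := F)
    isOpen_sliceTarget hQc hQs
    ((((hfs.continuous.comp_continuousOn continuousOn_slice).mul hcc).mul
      continuousOn_const).congr fun y hy => indicator_of_mem hy _) fun y hy => by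
        by_cases hys : y ∈ sliceTarget φ
        · simp [F, hys, hQf y hys hy]
        · exact indicator_of_notMem hys _
  refine (F1.integral_pos_of_hasCompactSupport_nonneg_nonzero (μ := volume) (x := y₀) F2
    (fun y => ?_) ?_).ne' ?_
  · by_cases hys : y ∈ sliceTarget φ
    · simp only [F, indicator_of_mem hys, Pi.zero_apply]
      by_cases hy : φ.symm (incl y) ∈ tsupport f
      · have h2 := (hg (hfg hy)).2
        rw [mem_ofPred_eq, φ.right_inv hys, tailL_incl] at h2
        rw [mul_assoc]
        exact mul_nonneg f.nonneg h2.le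
      · rw [image_eq_zero_of_notMem_tsupport hy, zero_mul, zero_mul]
    · exact (indicator_of_notMem hys _).ge
  · simp only [F, indicator_of_mem hy₀s, hxy, f.eq_one, one_mul]
    exact mul_ne_zero hcy hcy
  · rw [integral_indicator isOpen_sliceTarget.measurableSet, integral_mul_const, h1, zero_mul]

end Nondegeneracy

/-! ### Functions with prescribed jump -/

section Extension

variable {k : ℕ} {M : Type*} [TopologicalSpace M] [ChartedSpace (Coord k) M]
  [IsManifold (𝓡 (k + 1)) ∞ M]

variable {S : Sheet k M}

theorem Sheet.isClosed_Γ (S : Sheet k M) : IsClosed S.Γ := by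
  have h : S.Γ = (S.Dp ∪ S.Dm)ᶜ := by
    ext x
    have h1 := S.disjoint_Dp_Γ.notMem_of_mem_left (a := x)
    have h2 := S.disjoint_Dm_Γ.notMem_of_mem_left (a := x)
    have h3 := S.mem_Dp_or x
    simp only [mem_union, mem_compl_iff]
    tauto
  rw [h]
  exact (S.isOpen_Dp.union S.isOpen_Dm).isClosed_compl

/-- Extending `n` is a convex condition on the value at each point, so local extensions glue. Near
`Γ` the extension is constant along `y₀` in an adapted chart; off the closed set `Γ` the condition
is empty. -/
theorem Sheet.exists_contMDiff_extension [T2Space M] [SigmaCompactSpace M] (n : S.cotangent) :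
    ∃ g : M → ℝ, ContMDiff (𝓡 (k + 1)) 𝓘(ℝ, ℝ) ∞ g ∧ EqOn g n S.Γ := by
  suffices h : ∃ g : ContMDiffMap (𝓡 (k + 1)) 𝓘(ℝ, ℝ) M ℝ ∞, ∀ x,
      g x ∈ {r : ℝ | x ∈ S.Γ → r = n.1 x} by
    obtain ⟨g, hg⟩ := h
    exact ⟨g, g.contMDiff, fun x hx => hg x hx⟩
  refine exists_contMDiffMap_forall_mem_convex_of_local (𝓡 (k + 1)) (fun x => ?_) fun x => ?_
  · intro a ha b hb s t _ _ hst hx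
    rw [ha hx, hb hx, ← add_smul, hst, one_smul]
  · by_cases hx : x ∈ S.Γ
    · obtain ⟨φ, hφ, hxφ⟩ := S.exists_adaptedChart x
      have h1 : ContMDiffOn (𝓡 (k + 1)) 𝓘(ℝ, Coord k) ∞ φ φ.source :=
        contMDiffOn_of_mem_maximalAtlas hφ.1
      have h2 : ContMDiffOn 𝓘(ℝ, Coord k) (𝓡 (k + 1)) ∞ φ.symm φ.target :=
        contMDiffOn_symm_of_mem_maximalAtlas hφ.1
      have h3 : ContMDiff 𝓘(ℝ, Coord k) 𝓘(ℝ, Coord k) ∞ ((inclL k).comp (tailL k)) :=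
        ((inclL k).comp (tailL k)).contMDiff
      have h4 : ContMDiffOn (𝓡 (k + 1)) 𝓘(ℝ, Coord k) ∞ (fun z => incl (tailL k (φ z))) φ.source :=
        h3.comp_contMDiffOn h1
      have ho : IsOpen (φ.source ∩ (fun z => incl (tailL k (φ z))) ⁻¹' φ.target) :=
        h4.continuousOn.isOpen_inter_preimage φ.open_source φ.open_target
      refine ⟨_, ho.mem_nhds ⟨hxφ, ?_⟩, fun z => n.1 (φ.symm (incl (tailL k (φ z)))), ?_, ?_⟩
      · rw [mem_preimage, incl_tailL_chart hφ hxφ hx]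
        exact φ.map_source hxφ
      · refine n.2.1.comp (h2.comp (h4.mono inter_subset_left) fun z hz => hz.2) fun z hz => ?_
        exact slice_mem_Γ hφ hz.2
      · intro z hz hzΓ
        simp only [incl_tailL_chart hφ hz.1 hzΓ, φ.left_inv hz.1]
    · exact ⟨S.Γᶜ, S.isClosed_Γ.isOpen_compl.mem_nhds hx, fun _ => 0, contMDiffOn_const,
        fun y hy hy' => absurd hy' hy⟩

/-- Cut a smooth extension of `n` off to `D⁺ ∪ Γ` and take zero on the other side. -/
theorem Sheet.exists_jump_eq [T2Space M] [SigmaCompactSpace M] (n : S.cotangent) :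
    ∃ h ∈ S.DFun, S.jump h = n := by
  obtain ⟨g, hg, hgn⟩ := S.exists_contMDiff_extension n
  refine ⟨(S.Cp.indicator g, fun _ => 0), ⟨hg.contMDiffOn.congr fun x hx => indicator_of_mem hx _,
    contMDiffOn_const, fun x hx => indicator_of_notMem hx _, fun _ _ => rfl⟩, funext fun x => ?_⟩
  by_cases hx : x ∈ S.Γ
  · rw [jump, indicator_of_mem hx, sub_zero, ← hgn hx]
    exact indicator_of_mem (S.isSide_pos.Γ_subset hx) _
  · rw [jump, indicator_of_notMem hx, n.2.2 x hx]

end Extension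

/-! ### The Hamiltonian operator: existence and uniqueness -/

section HamiltonianOperator

variable {k : ℕ} {M : Type*} [TopologicalSpace M] [ChartedSpace (Coord k) M]
  [IsManifold (𝓡 (k + 1)) ∞ M] [T2Space M] [SigmaCompactSpace M] [MeasurableSpace M] [BorelSpace M]

variable {S : Sheet k M} {m : OneForm k M × OneForm k M}

theorem Sheet.dualAnchor_add_right (μ : VolumeForm k M) (n : S.cotangent) (u u' : S.DVect) :
    S.dualAnchor μ n (u + u') = S.dualAnchor μ n u + S.dualAnchor μ n u' := by
  rw [dualAnchor, S.anchor_add, S.pairingΓ_add_right μ n.2.1.continuousOn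
    (S.anchor_mem_topForms μ u) (S.anchor_mem_topForms μ u')]
  rfl

theorem Sheet.dualAnchor_smul_right (μ : VolumeForm k M) (n : S.cotangent) (c : ℝ) (u : S.DVect) :
    S.dualAnchor μ n (c • u) = c * S.dualAnchor μ n u := by
  rw [dualAnchor, S.anchor_smul, S.pairingΓ_smul_right μ c n.2.1.continuousOn
    (S.anchor_mem_topForms μ u)]
  rfl

theorem Sheet.dualAnchor_add_left (μ : VolumeForm k M) (n n' : S.cotangent) (u : S.DVect) :
    S.dualAnchor μ (n + n') u = S.dualAnchor μ n u + S.dualAnchor μ n' u :=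
  S.pairingΓ_add μ n.2.1.continuousOn n'.2.1.continuousOn (S.anchor_mem_topForms μ u)

theorem Sheet.dualAnchor_smul_left (μ : VolumeForm k M) (c : ℝ) (n : S.cotangent) (u : S.DVect) :
    S.dualAnchor μ (c • n) u = c * S.dualAnchor μ n u :=
  S.pairingΓ_smul μ c n.2.1.continuousOn (S.anchor_mem_topForms μ u)

/-- The Hamiltonian operator
`(v, n) ↦ ((-i_v dm - div(v) m - d(i_v m)) ⊗ μ + #* jump(i_v m) - #* n, #v)`. -/
def Sheet.hamiltonianOperator (S : Sheet k M) (μ : VolumeForm k M) (hm : m ∈ S.DOneForm) :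
    S.DVect × S.cotangent →ₗ[ℝ] Module.Dual ℝ S.DVect × S.topForms where
  toFun a :=
    ({ toFun u := S.density μ (S.hamiltonianFormR μ m a.1.1) u +
        S.dualAnchor μ (S.jumpContract hm a.1) u - S.dualAnchor μ a.2 u
       map_add' u u' := by
        rw [S.density_hamiltonianFormR_add_right μ hm, S.dualAnchor_add_right,
          S.dualAnchor_add_right]
        ring
       map_smul' c u := by
        rw [S.density_hamiltonianFormR_smul_right μ, S.dualAnchor_smul_right,
          S.dualAnchor_smul_right, RingHom.id_apply, smul_eq_mul]
        ring }, ⟨S.anchor μ a.1, S.anchor_mem_topForms μ a.1⟩)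
  map_add' a b := by
    refine Prod.ext (LinearMap.ext fun u => ?_) (Subtype.ext (S.anchor_add μ a.1 b.1))
    change S.density μ (S.hamiltonianFormR μ m (a.1 + b.1).1) u +
        S.dualAnchor μ (S.jumpContract hm (a.1 + b.1)) u - S.dualAnchor μ (a.2 + b.2) u =
      S.density μ (S.hamiltonianFormR μ m a.1.1) u +
        S.dualAnchor μ (S.jumpContract hm a.1) u - S.dualAnchor μ a.2 u +
      (S.density μ (S.hamiltonianFormR μ m b.1.1) u +
        S.dualAnchor μ (S.jumpContract hm b.1) u - S.dualAnchor μ b.2 u)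
    rw [S.density_hamiltonianFormR_add_left μ hm, S.jumpContract_add, S.dualAnchor_add_left,
      S.dualAnchor_add_left]
    ring
  map_smul' c a := by
    refine Prod.ext (LinearMap.ext fun u => ?_) (Subtype.ext (S.anchor_smul μ c a.1))
    change S.density μ (S.hamiltonianFormR μ m (c • a.1).1) u +
        S.dualAnchor μ (S.jumpContract hm (c • a.1)) u - S.dualAnchor μ (c • a.2) u =
      c * (S.density μ (S.hamiltonianFormR μ m a.1.1) u +
        S.dualAnchor μ (S.jumpContract hm a.1) u - S.dualAnchor μ a.2 u)
    rw [S.density_hamiltonianFormR_smul_left μ hm, S.jumpContract_smul, S.dualAnchor_smul_left,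
      S.dualAnchor_smul_left]
    ring

theorem Sheet.hamiltonianOperator_fst_apply (μ : VolumeForm k M) (hm : m ∈ S.DOneForm)
    (a : S.DVect × S.cotangent) (u : S.DVect) :
    (S.hamiltonianOperator μ hm a).1 u = S.density μ (S.hamiltonianFormR μ m a.1.1) u +
      S.dualAnchor μ (S.jumpContract hm a.1) u - S.dualAnchor μ a.2 u := rfl

theorem Sheet.hamiltonianOperator_snd (μ : VolumeForm k M) (hm : m ∈ S.DOneForm)
    (a : S.DVect × S.cotangent) :
    ((S.hamiltonianOperator μ hm a).2 : S.GammaForm) = S.anchor μ a.1 := rfl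

/-- For `a = (v, n)` and `b = (u, n')`, the density gives the bracket term and `-jump(i_u m)` paired
with `#v`; the second component adds `n'` paired with `#v`; the two `#*` terms give `-(n - jump(i_v
m))` paired with `#u`. Together this is the Poisson bracket. -/
theorem Sheet.isHamiltonianOperator_hamiltonianOperator (μ : VolumeForm k M)
    (hm : m ∈ S.DOneForm) : S.IsHamiltonianOperator μ hm (S.hamiltonianOperator μ hm) := by
  intro a b
  have h : ∀ (n j : S.cotangent) (v : S.DVect), S.pairingΓ μ ((n : M → ℝ) - j) (S.anchor μ v) =
      S.pairingΓ μ n (S.anchor μ v) - S.pairingΓ μ j (S.anchor μ v) := fun n j v =>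
    S.pairingΓ_sub μ n.2.1.continuousOn j.2.1.continuousOn (S.anchor_mem_topForms μ v)
  rw [S.hamiltonianOperator_fst_apply, S.hamiltonianOperator_snd, S.density_hamiltonianFormR μ hm,
    poisson, h, h, dualAnchor, dualAnchor]
  ring

/-- Uniqueness of the Hamiltonian operator. -/
theorem Sheet.IsHamiltonianOperator.unique {μ : VolumeForm k M} {hm : m ∈ S.DOneForm}
    {P Q : S.DVect × S.cotangent → Module.Dual ℝ S.DVect × S.topForms}
    (hP : S.IsHamiltonianOperator μ hm P) (hQ : S.IsHamiltonianOperator μ hm Q) : Q = P := by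
  have h0 : ∀ ξ : S.topForms, S.pairingΓ μ 0 ξ = 0 := fun ξ => by
    have := S.pairingΓ_smul μ 0 (n := 0) continuousOn_const ξ.2
    rwa [zero_smul, zero_mul] at this
  refine funext fun a => Prod.ext (LinearMap.ext fun u => ?_) (Subtype.ext ?_)
  -- Covectors `(u, 0)` see only the functional component.
  · have h := (hQ a (u, 0)).trans (hP a (u, 0)).symm
    have e : ((0 : S.cotangent) : M → ℝ) = 0 := rfl
    simpa only [e, h0, add_zero] using h
  · refine sub_eq_zero.1 (S.eq_zero_of_pairingΓ_eq_zero μ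
      (S.topForms.sub_mem (Q a).2.2 (P a).2.2) fun n => ?_)
    -- Covectors `(0, n)` see only the form on `Γ`, to which nondegeneracy applies.
    have h := (hQ a (0, n)).trans (hP a (0, n)).symm
    simp only [map_zero, zero_add] at h
    have hneg := S.pairingΓ_smul_right μ (-1) n.2.1.continuousOn (P a).2.2
    rw [sub_eq_add_neg, ← neg_one_smul ℝ ((P a).2 : S.GammaForm),
      S.pairingΓ_add_right μ n.2.1.continuousOn (Q a).2.2 (S.topForms.smul_mem (-1) (P a).2.2),
      hneg, h]
    ring

end HamiltonianOperator

end VortexSheet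

end

theorem mainTheorem3 {k : ℕ} {M : Type*} [TopologicalSpace M] [T2Space M]
    [SecondCountableTopology M] [ChartedSpace (VortexSheet.Coord k) M]
    [IsManifold (𝓡 (k + 1)) ∞ M] [MeasurableSpace M] [BorelSpace M]
    (μ : VortexSheet.VolumeForm k M) (S : VortexSheet.Sheet k M)
    (m : VortexSheet.OneForm k M × VortexSheet.OneForm k M) (hm : m ∈ S.DOneForm) :
    (∃ P : S.DVect × S.cotangent →ₗ[ℝ] Module.Dual ℝ S.DVect × S.topForms,
      S.IsHamiltonianOperator μ hm P ∧
      (∀ Q : S.DVect × S.cotangent → Module.Dual ℝ S.DVect × S.topForms,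
        S.IsHamiltonianOperator μ hm Q → Q = P) ∧
      ∀ (v : S.DVect) (n : S.cotangent),
        (∀ u : S.DVect, (P (v, n)).1 u =
          S.density μ
              (-S.interiorExtDerivR m v.1 - VortexSheet.Sheet.mulForm (S.divR μ v.1) m
                - S.dR (VortexSheet.Sheet.contract v.1 m)) u
            + S.dualAnchor μ (S.jumpContract hm v) u
            - S.dualAnchor μ n u) ∧
        ((P (v, n)).2 : S.GammaForm) = S.anchor μ v) ∧
    ∀ n : S.cotangent,
      (∃ h ∈ S.DFun, S.jump h = n) ∧
      ∀ h ∈ S.DFun, S.jump h = n →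
        ∀ u : S.DVect, S.dualAnchor μ n u = S.density μ (S.dR h) u + S.divDual μ h u := by
  -- Together with second countability this yields the σ-compactness needed for the partitions of
  -- unity.
  have : LocallyCompactSpace M := ChartedSpace.locallyCompactSpace (VortexSheet.Coord k) M
  exact ⟨⟨S.hamiltonianOperator μ hm, S.isHamiltonianOperator_hamiltonianOperator μ hm,
    fun Q hQ => (S.isHamiltonianOperator_hamiltonianOperator μ hm).unique hQ,
    fun v n => ⟨fun u => rfl, rfl⟩⟩,
    fun n => ⟨S.exists_jump_eq n, fun h hh hn u => S.dualAnchor_eq μ hh hn u⟩⟩
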